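/- **Theorem 2 ($T1$ theorem for square functions).** Let $n\ge 1$ and let $E\subset\mathbb R^{n+1}$ be a closed set, bounded or unbounded, which is $n$-dimensional Ahlfors–David regular: with $\sigma=\mathcal H^n|_E$ there is $A>0$ with $A^{-1}r^n\le\sigma(B(x,r))\le A\,r^n$ for all $x\in E$ and $0<r<\operatorname{diam}(E)$. Put $\Omega=\mathbb R^{n+1}\setminus E$ and $\delta(X)=\operatorname{dist}(X,E)$. Let $\mathbb D=\bigcup_k\mathbb D_k$ be a dyadic grid on $E$, where $k$ runs over all integers with $2^{-k}\le c_0\operatorname{diam}(E)$ (all of $\mathbb Z$ if $E$ is unbounded). That is, each $\mathbb D_k$ is a family of Borel sets (cubes) with union $E$; if $k<k'$, a cube of $\mathbb D_{k'}$ is either disjoint from or contained in a given cube of $\mathbb D_k$, and is contained in exactly one cube of $\mathbb D_k$; and each $Q\in\mathbb D_k$, with length $\ell(Q)=2^{-k}$, satisfies $C_1^{-1}2^{-k}\le\operatorname{diam}(Q)\le C_12^{-k}$ and $C_1^{-1}2^{-kn}\le\sigma(Q)\le C_12^{-kn}$, contains a set $B(x,a_02^{-k})\cap E$ with $x\in E$,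 and satisfies $\sigma(\{x\in Q:\operatorname{dist}(x,E\setminus Q)\le\tau2^{-k}\})\le C_2\tau^{\eta}\sigma(Q)$ for $0<\tau<a_0$ (with $\operatorname{dist}(x,\emptyset)=\infty$). Here $c_0,a_0,\eta,C_1,C_2>0$. Let $\mathcal W$ be a Whitney decomposition of $\Omega$: a covering of $\Omega$ by closed dyadic cubes $I\subset\Omega$ of side length $\ell(I)$, with pairwise disjoint interiors, such that $4\operatorname{diam}(I)\le\operatorname{dist}(4I,E)\le\operatorname{dist}(I,E)\le40\operatorname{diam}(I)$ and the diameters of cubes that touch differ by a factor of at most $4$. For $Q\in\mathbb D$ and $\beta>0$ let $\mathcal U_Q$ be the union of all $I\in\mathcal W$ with $\ell(I)/8\le\ell(Q)\le8\ell(I)$ and $\operatorname{dist}(Q,I)\le\beta\,\ell(Q)$, and for $x\in Q$ let $\Gamma_Q(x)$ be the union of $\mathcal U_{Q'}$ over all $Q'\in\mathbb D$ with $x\in Q'\subseteq Q$. Let $\psi:\Omega\times E\to\mathbb C$ be measurable and suppose that for some $K,\alpha>0$ $$|\psi(X,y)|\le K\frac{\delta(X)^\alpha}{|X-y|^{n+\alpha}},\qquad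 |\psi(X,y)-\psi(X,y')|\le K\frac{|y-y'|^\alpha}{|X-y|^{n+\alpha}}\ \text{ if } 2|y-y'|\le|X-y|,$$ for $X\in\Omega$, $y,y'\in E$. Put $\Theta f(X)=\int_E\psi(X,y)f(y)\,d\sigma(y)$. Then there is $\beta_0>0$ depending only on $n$ and $A$ such that the following holds for every $\beta\ge\beta_0$. If $$\sup_{Q\in\mathbb D}\frac1{\sigma(Q)}\int_Q\iint_{\Gamma_Q(x)}|\Theta1(Y)|^2\,\frac{dY}{\delta(Y)^{n+1}}\,d\sigma(x)\le M<\infty,$$ then for every $f\in L^2(E,\sigma)$ the integral defining $\Theta f(X)$ converges absolutely for every $X\in\Omega$, and $$\iint_\Omega|\Theta f(Y)|^2\,\frac{dY}{\delta(Y)}\le C\int_E|f|^2\,d\sigma,$$ where $C$ depends only on $n$, $A$, $\beta$, $c_0,a_0,\eta,C_1,C_2$, $\alpha$, $K$ and $M$. -/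

import Mathlib

open MeasureTheory Set
open scoped ENNReal NNReal

noncomputable section

namespace SquareFunction

/-- The ambient Euclidean space `ℝⁿ⁺¹`. -/
abbrev Space (n : ℕ) : Type := EuclideanSpace ℝ (Fin (n + 1))

/-- The surface measure `σ`: `n`-dimensional Hausdorff measure restricted to `E`. -/
def surface {n : ℕ} (E : Set (Space n)) : Measure (Space n) :=
  (Measure.hausdorffMeasure (n : ℝ)).restrict E

/-- The distance `δ(X)` from `X` to `E`. -/
def delta {n : ℕ} (E : Set (Space n)) (X : Space n) : ℝ := Metric.infDist X E

/-- The distance between two sets, as an extended nonnegative real. -/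
def setDist {n : ℕ} (A B : Set (Space n)) : ℝ≥0∞ := ⨅ a ∈ A, ⨅ b ∈ B, edist a b

/-- The length `2⁻ᵏ` of generation `k`. -/
def len (k : ℤ) : ℝ := (2 : ℝ) ^ (-k)

/-- `E` is closed and Ahlfors-David regular of dimension `n` with constant `C`. The diameter is
taken in `[0, ∞]`, so that for unbounded `E` all radii `r > 0` are admitted. -/
structure IsADR {n : ℕ} (C : ℝ) (E : Set (Space n)) : Prop where
  isClosed : IsClosed E
  lower : ∀ x ∈ E, ∀ r : ℝ, 0 < r → ENNReal.ofReal r < Metric.ediam E →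
    ENNReal.ofReal (C⁻¹ * r ^ n) ≤ surface E (Metric.ball x r)
  upper : ∀ x ∈ E, ∀ r : ℝ, 0 < r → ENNReal.ofReal r < Metric.ediam E →
    surface E (Metric.ball x r) ≤ ENNReal.ofReal (C * r ^ n)

/-- The generations that are used: those `k` with `2⁻ᵏ ≤ c₀ diam E`. These are all integers if `E`
is unbounded (and `c₀ > 0`). -/
def generations {n : ℕ} (c₀ : ℝ) (E : Set (Space n)) : Set ℤ :=
  {k | ENNReal.ofReal (len k) ≤ ENNReal.ofReal c₀ * Metric.ediam E}

/-- `D k`, for `k` in `generations c₀ E`, are the cubes of generation `k` of a dyadic grid on `E`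
with constants `a₀, η, C₁, C₂`. In `small_boundary` the distance to the empty set is `∞`. -/
structure IsDyadicGrid {n : ℕ} (c₀ a₀ η C₁ C₂ : ℝ) (E : Set (Space n))
    (D : ℤ → Set (Set (Space n))) : Prop where
  borel : ∀ k ∈ generations c₀ E, ∀ Q ∈ D k, MeasurableSet Q
  cover : ∀ k ∈ generations c₀ E, ⋃₀ D k = E
  nested : ∀ k ∈ generations c₀ E, ∀ k' ∈ generations c₀ E, k < k' →
    ∀ Q ∈ D k, ∀ Q' ∈ D k', Q' ∩ Q = ∅ ∨ Q' ⊆ Q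
  ancestor : ∀ k ∈ generations c₀ E, ∀ k' ∈ generations c₀ E, k < k' →
    ∀ Q' ∈ D k', ∃! Q, Q ∈ D k ∧ Q' ⊆ Q
  diam_lower : ∀ k ∈ generations c₀ E, ∀ Q ∈ D k,
    ENNReal.ofReal (C₁⁻¹ * len k) ≤ Metric.ediam Q
  diam_upper : ∀ k ∈ generations c₀ E, ∀ Q ∈ D k,
    Metric.ediam Q ≤ ENNReal.ofReal (C₁ * len k)
  measure_lower : ∀ k ∈ generations c₀ E, ∀ Q ∈ D k,
    ENNReal.ofReal (C₁⁻¹ * len k ^ n) ≤ surface E Q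
  measure_upper : ∀ k ∈ generations c₀ E, ∀ Q ∈ D k,
    surface E Q ≤ ENNReal.ofReal (C₁ * len k ^ n)
  surface_ball : ∀ k ∈ generations c₀ E, ∀ Q ∈ D k,
    ∃ x ∈ E, Metric.ball x (a₀ * len k) ∩ E ⊆ Q
  small_boundary : ∀ k ∈ generations c₀ E, ∀ Q ∈ D k, ∀ τ : ℝ, 0 < τ → τ < a₀ →
    surface E {x ∈ Q | Metric.infEDist x (E \ Q) ≤ ENNReal.ofReal (τ * len k)}
      ≤ ENNReal.ofReal (C₂ * τ ^ η) * surface E Q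

/-- A dyadic cube of `ℝⁿ⁺¹` is coded by `(k, m)`: side length `2⁻ᵏ` and lower corner `2⁻ᵏ m`. -/
abbrev CubeCode (n : ℕ) : Type := ℤ × (Fin (n + 1) → ℤ)

/-- The concentric dilate by the factor `t` of the closed dyadic cube with code `I`. -/
def dilate {n : ℕ} (t : ℝ) (I : CubeCode n) : Set (Space n) :=
  {x | ∀ i, |x i - ((I.2 i : ℝ) + 1 / 2) * len I.1| ≤ t * (len I.1 / 2)}

/-- The closed dyadic cube `∏ᵢ [2⁻ᵏ mᵢ, 2⁻ᵏ (mᵢ + 1)]` with code `I = (k, m)`. -/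
def cube {n : ℕ} (I : CubeCode n) : Set (Space n) :=
  {x | ∀ i, (I.2 i : ℝ) * len I.1 ≤ x i ∧ x i ≤ ((I.2 i : ℝ) + 1) * len I.1}

/-- `W` is a Whitney decomposition of `Ω = ℝⁿ⁺¹ \ E` into dyadic cubes. -/
structure IsWhitney {n : ℕ} (E : Set (Space n)) (W : Set (CubeCode n)) : Prop where
  cover : ⋃ I ∈ W, cube I = Eᶜ
  nonoverlapping : W.PairwiseDisjoint fun I => interior (cube I)
  dist_lower : ∀ I ∈ W, 4 * Metric.ediam (cube I) ≤ setDist (dilate 4 I) E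
  dist_mono : ∀ I ∈ W, setDist (dilate 4 I) E ≤ setDist (cube I) E
  dist_upper : ∀ I ∈ W, setDist (cube I) E ≤ 40 * Metric.ediam (cube I)
  neighbours : ∀ I ∈ W, ∀ J ∈ W, (cube I ∩ cube J).Nonempty →
    Metric.ediam (cube I) ≤ 4 * Metric.ediam (cube J)

/-- The collection `𝒞_{Q,β}` of Whitney cubes associated with a cube `Q` of generation `k`. -/
def whitneyCubes {n : ℕ} (W : Set (CubeCode n)) (β : ℝ) (k : ℤ) (Q : Set (Space n)) :
    Set (CubeCode n) :=
  {I ∈ W | len I.1 / 8 ≤ len k ∧ len k ≤ 8 * len I.1 ∧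
    setDist Q (cube I) ≤ ENNReal.ofReal (β * len k)}

/-- The Whitney region `𝒰_{Q,β}` of a cube `Q` of generation `k`. -/
def whitneyRegion {n : ℕ} (W : Set (CubeCode n)) (β : ℝ) (k : ℤ) (Q : Set (Space n)) :
    Set (Space n) :=
  ⋃ I ∈ whitneyCubes W β k Q, cube I

/-- The `Q`-truncated cone `Γ_{Q,β}(x)`: the union of the Whitney regions of all grid cubes `Q'`
with `x ∈ Q' ⊆ Q`. -/
def truncatedCone {n : ℕ} (c₀ : ℝ) (E : Set (Space n)) (D : ℤ → Set (Set (Space n)))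
    (W : Set (CubeCode n)) (β : ℝ) (Q : Set (Space n)) (x : Space n) : Set (Space n) :=
  ⋃ k ∈ generations c₀ E, ⋃ Q' ∈ {Q' ∈ D k | x ∈ Q' ∧ Q' ⊆ Q}, whitneyRegion W β k Q'

/-- The measurability, size and Hölder conditions on the kernel `ψ(X, y)`, for `X ∉ E`, `y ∈ E`. -/
structure IsKernel {n : ℕ} (α C : ℝ) (E : Set (Space n)) (ψ : Space n → Space n → ℂ) : Prop where
  measurable : AEStronglyMeasurable (fun p : Space n × Space n => ψ p.1 p.2)
    ((volume.restrict Eᶜ).prod (surface E))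
  size : ∀ X ∈ Eᶜ, ∀ y ∈ E, ‖ψ X y‖ ≤ C * (delta E X ^ α / dist X y ^ ((n : ℝ) + α))
  holder : ∀ X ∈ Eᶜ, ∀ y ∈ E, ∀ y' ∈ E, 2 * dist y y' ≤ dist X y →
    ‖ψ X y - ψ X y'‖ ≤ C * (dist y y' ^ α / dist X y ^ ((n : ℝ) + α))

/-- The operator `Θ f (X) = ∫_E ψ(X, y) f(y) dσ(y)`. -/
def theta {n : ℕ} (E : Set (Space n)) (ψ : Space n → Space n → ℂ) (f : Space n → ℂ)
    (X : Space n) : ℂ :=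
  ∫ y, ψ X y * f y ∂surface E

end SquareFunction

end

open SquareFunction

/-! The complement of `E` is split at `δ(X) = diam E`. Where `δ(X) ≥ diam E`, which can happen only
for bounded `E`, the size of the kernel and Cauchy-Schwarz suffice (`exists_far_bound`). On the near
region write `Θf = Rf + Θ1 · Sf`, where `Sf(X)` is a smooth average of `f` over the part of `E`
within `3δ(X)` of `X`. The size condition makes `Θ1` bounded, so the kernel of `R = Θ - Θ1 · S`
still satisfies size and Hölder conditions (`IsKernel.cancelKernel`), and in addition its integral
over `E` vanishes (`integral_cancelKernel`).

The remainder `R` is handled by almost orthogonality. If `r_X` is its kernel at `X`, the vanishing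
integral at whichever of `X, X'` is closer to `E` is played against the Hölder continuity at the
other, and `|∫ r_X conj(r_X') dσ|` is dominated by `gramBound` (`exists_pairing_bound`). This kernel
satisfies Schur's condition for `dX / δ(X)` (`exists_schur_bound`), and a continuous Bessel
inequality (`lintegral_inner_sq_le`) turns this into the `L²` bound.

The paraproduct `Θ1 · S` is bounded by Carleson's embedding theorem (`exists_carleson_embedding`)
for the measure `|Θ1|² dX / δ(X)`. Its Carleson condition comes from the hypothesis on cones by
Fubini: a point `X` close to `E` lies in `Γ_Q(z)` for every `z` in a cube `Q'` with `σ(Q')` at least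
a multiple of `δ(X)ⁿ`, and this mass pays for the extra `δ(X)⁻ⁿ` in the hypothesis. Points of the
near region too far away for the cubes of the grid have `δ(X)` comparable with `diam E`, and there
the boundedness of `Θ1` is enough. -/

namespace SquareFunction

open scoped InnerProductSpace

variable {n : ℕ}

/-! ### Measures of polynomial growth and radial integrals. -/

/-- Growth of order `d` with constant `G`, at all points and all scales. -/
def HasGrowth {n : ℕ} (d G : ℝ) (μ : Measure (Space n)) : Prop :=
  ∀ x : Space n, ∀ r : ℝ, 0 < r → μ (Metric.ball x r) ≤ ENNReal.ofReal (G * r ^ d)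

theorem summable_pow_natAbs {q : ℝ} (h0 : 0 ≤ q) (h1 : q < 1) :
    Summable fun j : ℤ => q ^ j.natAbs := by
  refine Summable.of_nat_of_neg ?_ ?_ <;>
    simpa using summable_geometric_of_lt_one h0 h1

/-- The factor 2 is needed for negative `j`, where the minimum is `t`, bounded only by the upper end
`2 ^ (j + 1)` of its dyadic interval. -/
theorem min_le_two_mul_pow_natAbs {t : ℝ} {j : ℤ} (ht : (2 : ℝ) ^ j ≤ t)
    (ht' : t < (2 : ℝ) ^ (j + 1)) : min t t⁻¹ ≤ 2 * (1 / 2 : ℝ) ^ j.natAbs := by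
  have h0 : (0 : ℝ) < 2 ^ j := by positivity
  obtain ⟨m, rfl | rfl⟩ := j.eq_nat_or_neg
  · refine (min_le_right _ _).trans ?_
    have : t⁻¹ ≤ ((2 : ℝ) ^ (m : ℤ))⁻¹ := inv_anti₀ h0 ht
    have h2 : ((2 : ℝ) ^ (m : ℤ))⁻¹ = (1 / 2) ^ m := by simp
    simp only [Int.natAbs_natCast]
    have h3 : (0 : ℝ) ≤ (1 / 2) ^ m := by positivity
    linarith
  · refine (min_le_left _ _).trans ?_
    rw [zpow_add₀ two_ne_zero, zpow_neg] at ht'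
    simp only [Int.natAbs_neg, Int.natAbs_natCast]
    have h2 : ((2 : ℝ) ^ (m : ℤ))⁻¹ = (1 / 2) ^ m := by simp
    rw [h2] at ht'
    simp only [zpow_one] at ht'
    linarith

/-- A measure of growth `d` integrates `ρ⁻ᵈ min(ρ / R, R / ρ)ᵃ`, where `ρ` is the distance to a
point, with a bound independent of the point and of `R`. -/
theorem exists_radial_bound (n : ℕ) {d G a : ℝ} (hd : 0 ≤ d) (hG : 0 ≤ G) (ha : 0 < a) :
    ∃ C : ℝ≥0, ∀ μ : Measure (Space n), HasGrowth d G μ → ∀ (X : Space n) (R : ℝ), 0 < R →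
      ∫⁻ y in {y | 0 < dist X y}, ENNReal.ofReal
        (dist X y ^ (-d) * (min (dist X y / R) (R / dist X y)) ^ a) ∂μ ≤ C := by
  set q : ℝ := (1 / 2 : ℝ) ^ a with hq
  have hq0 : 0 < q := by positivity
  have hq1 : q < 1 := Real.rpow_lt_one (by norm_num) (by norm_num) ha
  have hsum : Summable fun j : ℤ => G * 2 ^ d * 2 ^ a * q ^ j.natAbs :=
    (summable_pow_natAbs hq0.le hq1).mul_left _
  refine ⟨(∑' j : ℤ, G * 2 ^ d * 2 ^ a * q ^ j.natAbs).toNNReal, fun μ hμ X R hR => ?_⟩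
  -- Dyadic annuli around `X` at scale `R`: growth of order `d` cancels the factor `ρ⁻ᵈ`, and the
  -- power of the minimum leaves the two-sided geometric series of ratio `q`.
  set S : ℤ → Set (Space n) := fun j =>
    {y | (2 : ℝ) ^ j * R ≤ dist X y ∧ dist X y < (2 : ℝ) ^ (j + 1) * R} with hS
  have hmeas : ∀ j, MeasurableSet (S j) := fun j => by
    have h : Measurable fun y => dist X y := by fun_prop
    exact (measurableSet_le measurable_const h).inter (measurableSet_lt h measurable_const)
  have hcov : {y | 0 < dist X y} ⊆ ⋃ j, S j := by
    intro y (hy : 0 < dist X y)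
    obtain ⟨j, hj⟩ := exists_mem_Ico_zpow (div_pos hy hR) (one_lt_two (α := ℝ))
    refine mem_iUnion.2 ⟨j, ?_, ?_⟩
    · have := hj.1; rwa [le_div_iff₀ hR] at this
    · have := hj.2; rwa [div_lt_iff₀ hR] at this
  have hbound : ∀ j, ∫⁻ y in S j, ENNReal.ofReal
      (dist X y ^ (-d) * (min (dist X y / R) (R / dist X y)) ^ a) ∂μ
      ≤ ENNReal.ofReal (G * 2 ^ d * 2 ^ a * q ^ j.natAbs) := by
    intro j
    have hp : (0 : ℝ) < 2 ^ j * R := by positivity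
    calc _ ≤ ∫⁻ y in S j, ENNReal.ofReal (((2 : ℝ) ^ j * R) ^ (-d) * (2 ^ a * q ^ j.natAbs)) ∂μ := by
          refine setLIntegral_mono' (hmeas j) fun y hy => ENNReal.ofReal_le_ofReal ?_
          have hy0 : 0 < dist X y := hp.trans_le hy.1
          refine mul_le_mul ?_ ?_ (by positivity) (by positivity)
          · exact Real.rpow_le_rpow_of_nonpos hp hy.1 (by linarith)
          · have h1 : min (dist X y / R) (R / dist X y) ≤ 2 * (1 / 2 : ℝ) ^ j.natAbs := by
              have := min_le_two_mul_pow_natAbs (t := dist X y / R) (j := j)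
                ((le_div_iff₀ hR).2 hy.1) ((div_lt_iff₀ hR).2 hy.2)
              rwa [inv_div] at this
            calc _ ≤ (2 * (1 / 2 : ℝ) ^ j.natAbs) ^ a :=
                  Real.rpow_le_rpow (by positivity) h1 ha.le
              _ = 2 ^ a * q ^ j.natAbs := by
                  rw [Real.mul_rpow (by norm_num) (by positivity), hq, ← Real.rpow_natCast,
                    ← Real.rpow_natCast, ← Real.rpow_mul (by norm_num),
                    ← Real.rpow_mul (by norm_num), mul_comm a]
      _ = ENNReal.ofReal (((2 : ℝ) ^ j * R) ^ (-d) * (2 ^ a * q ^ j.natAbs)) * μ (S j) := by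
          rw [lintegral_const, Measure.restrict_apply_univ]
      _ ≤ ENNReal.ofReal (((2 : ℝ) ^ j * R) ^ (-d) * (2 ^ a * q ^ j.natAbs)) *
            ENNReal.ofReal (G * (2 ^ (j + 1) * R) ^ d) := by
          gcongr
          refine (measure_mono ?_).trans (hμ X _ (by positivity))
          intro y hy
          rw [Metric.mem_ball, dist_comm]
          exact hy.2
      _ = _ := by
          rw [← ENNReal.ofReal_mul (by positivity)]
          congr 1
          have : (2 : ℝ) ^ (j + 1) * R = 2 * (2 ^ j * R) := by
            rw [zpow_add₀ two_ne_zero, zpow_one]; ring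
          rw [this, Real.mul_rpow (by norm_num) hp.le, Real.rpow_neg hp.le]
          have : ((2 : ℝ) ^ j * R) ^ d ≠ 0 := by positivity
          field_simp
  calc _ ≤ ∫⁻ y in ⋃ j, S j, ENNReal.ofReal
        (dist X y ^ (-d) * (min (dist X y / R) (R / dist X y)) ^ a) ∂μ := lintegral_mono_set hcov
    _ ≤ ∑' j, ∫⁻ y in S j, ENNReal.ofReal
        (dist X y ^ (-d) * (min (dist X y / R) (R / dist X y)) ^ a) ∂μ := lintegral_iUnion_le _ _
    _ ≤ ∑' j : ℤ, ENNReal.ofReal (G * 2 ^ d * 2 ^ a * q ^ j.natAbs) :=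
        ENNReal.tsum_le_tsum hbound
    _ = _ := by
        rw [← ENNReal.ofReal_tsum_of_nonneg (fun j => by positivity) hsum]
        rfl

theorem HasGrowth.isLocallyFiniteMeasure {d G : ℝ} {μ : Measure (Space n)} (h : HasGrowth d G μ) :
    IsLocallyFiniteMeasure μ :=
  ⟨fun x => ⟨Metric.ball x 1, Metric.ball_mem_nhds x one_pos,
    (h x 1 one_pos).trans_lt ENNReal.ofReal_lt_top⟩⟩

/-! ### Growth of Lebesgue measure and of surface measure. -/

theorem exists_volume_growth (n : ℕ) :
    ∃ G : ℝ, 0 ≤ G ∧ HasGrowth ((n : ℝ) + 1) G (volume : Measure (Space n)) := by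
  refine ⟨(volume (Metric.ball (0 : Space n) 1)).toReal, ENNReal.toReal_nonneg, fun x r hr => ?_⟩
  rw [Measure.addHaar_ball _ _ hr.le, finrank_euclideanSpace, Fintype.card_fin,
    mul_comm, ENNReal.ofReal_mul ENNReal.toReal_nonneg,
    ENNReal.ofReal_toReal Metric.isBounded_ball.measure_lt_top.ne]
  have : r ^ ((n : ℝ) + 1) = r ^ (n + 1) := by
    rw [← Real.rpow_natCast]; push_cast; rfl
  rw [this]

theorem ae_mem_surface {E : Set (Space n)} (hE : IsClosed E) : ∀ᵐ y ∂surface E, y ∈ E :=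
  ae_restrict_mem hE.measurableSet

theorem surface_inter_self {E : Set (Space n)} (hE : IsClosed E) (s : Set (Space n)) :
    surface E (s ∩ E) = surface E s := by
  rw [surface, Measure.restrict_apply' hE.measurableSet, Measure.restrict_apply' hE.measurableSet,
    inter_assoc, inter_self]

/-- Such a set has at most one point, and points are null for `ℋⁿ` because `n ≥ 1`. In this
degenerate case regularity says nothing, as no radius is admitted. -/
theorem surface_eq_zero_of_ediam_eq_zero (hn : 1 ≤ n) {E : Set (Space n)}
    (h : Metric.ediam E = 0) : surface E = 0 := by
  have : NullSingletonClass (Measure.hausdorffMeasure (n : ℝ) : Measure (Space n)) :=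
    Measure.nullSingletonClass_hausdorff _ (by exact_mod_cast hn)
  rw [surface, Measure.restrict_eq_zero]
  exact (Metric.ediam_eq_zero_iff.1 h).measure_zero _

/-- Every set of diameter at most `d` is covered by a bounded number of balls of radius `d / 4`. -/
theorem exists_cover_balls (n : ℕ) : ∃ N : ℕ, ∀ (x : Space n) (d : ℝ), 0 < d →
    ∃ t : Finset (Space n), t.card ≤ N ∧
      Metric.closedBall x d ⊆ ⋃ c ∈ t, Metric.ball c (d / 4) := by
  obtain ⟨t, -, htf, ht⟩ := (isCompact_closedBall (0 : Space n) 1).finite_cover_balls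
    (e := 1 / 4) (by norm_num)
  refine ⟨htf.toFinset.card, fun x d hd => ?_⟩
  classical
  refine ⟨htf.toFinset.image fun c => x + d • c, Finset.card_image_le, fun y hy => ?_⟩
  have hy' : d⁻¹ • (y - x) ∈ Metric.closedBall (0 : Space n) 1 := by
    rw [mem_closedBall_zero_iff, norm_smul, norm_inv, Real.norm_of_nonneg hd.le,
      inv_mul_le_iff₀ hd, mul_one, ← dist_eq_norm]
    exact hy
  obtain ⟨c, hc, hyc⟩ := mem_iUnion₂.1 (ht hy')
  refine mem_iUnion₂.2 ⟨x + d • c, ?_, ?_⟩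
  · simp only [Finset.mem_image, Finite.mem_toFinset]
    exact ⟨c, hc, rfl⟩
  · rw [Metric.mem_ball, dist_eq_norm] at hyc ⊢
    have : y - (x + d • c) = d • (d⁻¹ • (y - x) - c) := by
      rw [smul_sub, smul_smul, mul_inv_cancel₀ hd.ne', one_smul]; abel
    rw [this, norm_smul, Real.norm_of_nonneg hd.le]
    nlinarith

/-- Regularity bounds balls centred on `E` of radius less than `diam E`. A ball that meets `E` is
contained in one of twice the radius centred on `E`; if that radius is too large, all of `E` is
covered by boundedly many admissible balls. -/
theorem exists_surface_growth (hn : 1 ≤ n) {A : ℝ} (hA : 0 < A) :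
    ∃ G : ℝ, 0 ≤ G ∧ ∀ E : Set (Space n), IsADR A E → HasGrowth n G (surface E) := by
  obtain ⟨N, hN⟩ := exists_cover_balls n
  refine ⟨(N + 1) * A * 2 ^ n, by positivity, fun E hE x r hr => ?_⟩
  rw [Real.rpow_natCast]
  rcases (Metric.ball x r ∩ E).eq_empty_or_nonempty with h | ⟨e, hex, heE⟩
  · rw [← surface_inter_self hE.isClosed, h, measure_empty]; exact zero_le
  by_cases hd : ENNReal.ofReal (2 * r) < Metric.ediam E
  · calc _ ≤ surface E (Metric.ball e (2 * r)) := by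
          refine measure_mono (Metric.ball_subset_ball' ?_)
          rw [dist_comm]
          have := Metric.mem_ball.1 hex
          linarith
      _ ≤ ENNReal.ofReal (A * (2 * r) ^ n) := hE.upper e heE _ (by positivity) hd
      _ ≤ _ := by
          refine ENNReal.ofReal_le_ofReal ?_
          rw [mul_pow]
          have : 0 ≤ N * (A * (2 ^ n * r ^ n)) := by positivity
          linarith
  · push Not at hd
    have hfin : Metric.ediam E ≠ ⊤ := ne_top_of_le_ne_top ENNReal.ofReal_ne_top hd
    rcases eq_or_ne (Metric.ediam E) 0 with h0 | h0
    · rw [surface_eq_zero_of_ediam_eq_zero hn h0]; simp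
    set d := (Metric.ediam E).toReal with hdd
    have hEd : Metric.ediam E = ENNReal.ofReal d := (ENNReal.ofReal_toReal hfin).symm
    have hdpos : 0 < d := ENNReal.toReal_pos h0 hfin
    have hdr : d ≤ 2 * r := by
      rw [hEd] at hd; exact (ENNReal.ofReal_le_ofReal_iff (by positivity)).1 hd
    -- Balls of radius `d / 4`, once recentred on `E`, have radius `d / 2`, strictly below the
    -- diameter as the regularity bound requires.
    obtain ⟨t, htN, ht⟩ := hN e d hdpos
    have hsub : E ⊆ ⋃ c ∈ t, Metric.ball c (d / 4) := by
      refine fun y hy => ht ?_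
      rw [Metric.mem_closedBall, ← ENNReal.ofReal_le_ofReal_iff hdpos.le, ← edist_dist, ← hEd]
      exact Metric.edist_le_ediam_of_mem hy heE
    have hball : ∀ c, surface E (Metric.ball c (d / 4)) ≤ ENNReal.ofReal (A * r ^ n) := by
      intro c
      rcases (Metric.ball c (d / 4) ∩ E).eq_empty_or_nonempty with h | ⟨e', hce, hE'⟩
      · rw [← surface_inter_self hE.isClosed, h, measure_empty]; exact zero_le
      · calc _ ≤ surface E (Metric.ball e' (d / 2)) := by
              refine measure_mono (Metric.ball_subset_ball' ?_)
              rw [dist_comm]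
              have := Metric.mem_ball.1 hce
              linarith
          _ ≤ ENNReal.ofReal (A * (d / 2) ^ n) := by
              refine hE.upper e' hE' _ (by positivity) ?_
              rw [hEd]
              exact (ENNReal.ofReal_lt_ofReal_iff hdpos).2 (by linarith)
          _ ≤ _ := by
              refine ENNReal.ofReal_le_ofReal ?_
              have : d / 2 ≤ r := by linarith
              gcongr
    calc _ ≤ surface E univ := measure_mono (subset_univ _)
      _ = surface E E := by rw [← surface_inter_self hE.isClosed, univ_inter]
      _ ≤ ∑ c ∈ t, surface E (Metric.ball c (d / 4)) :=
          (measure_mono hsub).trans (measure_biUnion_finset_le _ _)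
      _ ≤ ∑ c ∈ t, ENNReal.ofReal (A * r ^ n) := Finset.sum_le_sum fun c _ => hball c
      _ = ENNReal.ofReal (t.card * (A * r ^ n)) := by
          rw [Finset.sum_const, nsmul_eq_mul, ENNReal.ofReal_mul (Nat.cast_nonneg _),
            ENNReal.ofReal_natCast]
      _ ≤ _ := by
          refine ENNReal.ofReal_le_ofReal ?_
          have h1 : (t.card : ℝ) ≤ N := by exact_mod_cast htN
          have h2 : (1 : ℝ) ≤ 2 ^ n := one_le_pow₀ (by norm_num)
          have h3 : 0 ≤ A * r ^ n := by positivity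
          calc (t.card : ℝ) * (A * r ^ n) ≤ (N + 1) * (A * r ^ n) := by gcongr; linarith
            _ ≤ (N + 1) * (A * r ^ n) * 2 ^ n := le_mul_of_one_le_right (by positivity) h2
            _ = _ := by ring

/-! ### The distance to `E`, the near region and the Poisson-like kernel. -/

theorem delta_pos {E : Set (Space n)} (hE : IsClosed E) (hne : E.Nonempty) {X : Space n}
    (hX : X ∈ Eᶜ) : 0 < delta E X :=
  (hE.notMem_iff_infDist_pos hne).1 hX

theorem delta_le_dist {E : Set (Space n)} {y : Space n} (hy : y ∈ E) (X : Space n) :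
    delta E X ≤ dist X y :=
  Metric.infDist_le_dist_of_mem hy

theorem exists_dist_eq_delta {E : Set (Space n)} (hE : IsClosed E) (hne : E.Nonempty)
    (X : Space n) : ∃ y ∈ E, dist X y = delta E X := by
  obtain ⟨y, hy, h⟩ := hE.exists_infDist_eq_dist hne X
  exact ⟨y, hy, h.symm⟩

theorem continuous_delta (E : Set (Space n)) : Continuous (delta E) :=
  Metric.continuous_infDist_pt E

@[fun_prop]
theorem measurable_delta (E : Set (Space n)) : Measurable (delta E) :=
  (continuous_delta E).measurable

/-- The points of the complement of `E` whose distance to `E` is less than the diameter of `E`. -/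
def nearRegion (E : Set (Space n)) : Set (Space n) :=
  {X | X ∈ Eᶜ ∧ ENNReal.ofReal (delta E X) < Metric.ediam E}

theorem measurableSet_nearRegion {E : Set (Space n)} (hE : IsClosed E) :
    MeasurableSet (nearRegion E) :=
  hE.measurableSet.compl.inter
    (measurableSet_lt (measurable_delta E).ennreal_ofReal measurable_const)

/-- The ball of radius `δ(X)` about a nearest point of `E` lies in `B(X, 2δ(X))`; membership of the
near region makes this radius admissible for the lower bound. -/
theorem IsADR.le_surface_ball {A : ℝ} {E : Set (Space n)} (h : IsADR A E) (hne : E.Nonempty)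
    {X : Space n} (hX : X ∈ nearRegion E) :
    ENNReal.ofReal (A⁻¹ * delta E X ^ n) ≤ surface E (Metric.ball X (2 * delta E X)) := by
  obtain ⟨y, hy, hXy⟩ := exists_dist_eq_delta h.isClosed hne X
  have hpos := delta_pos h.isClosed hne hX.1
  refine (h.lower y hy _ hpos hX.2).trans (measure_mono (Metric.ball_subset_ball' ?_))
  rw [dist_comm, hXy]
  linarith

/-- The Poisson-like kernel `δ(X)ᵃ / |X - y|ⁿ⁺ᵃ`. -/
noncomputable def poisson (E : Set (Space n)) (a : ℝ) (X y : Space n) : ℝ :=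
  delta E X ^ a / dist X y ^ ((n : ℝ) + a)

theorem delta_nonneg (E : Set (Space n)) (X : Space n) : 0 ≤ delta E X := Metric.infDist_nonneg

theorem poisson_nonneg (E : Set (Space n)) (a : ℝ) (X y : Space n) : 0 ≤ poisson E a X y :=
  div_nonneg (Real.rpow_nonneg (delta_nonneg E X) _) (Real.rpow_nonneg dist_nonneg _)

theorem measurable_poisson (E : Set (Space n)) (a : ℝ) :
    Measurable fun p : Space n × Space n => poisson E a p.1 p.2 := by
  unfold poisson
  have := measurable_delta E
  fun_prop

theorem poisson_eq {E : Set (Space n)} {a : ℝ} {X y : Space n}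
    (hX : 0 < delta E X) (hy : y ∈ E) :
    poisson E a X y = dist X y ^ (-(n : ℝ)) * (delta E X / dist X y) ^ a := by
  have hd : 0 < dist X y := hX.trans_le (delta_le_dist hy X)
  rw [poisson, Real.div_rpow hX.le hd.le, Real.rpow_neg hd.le, Real.rpow_add hd]
  field_simp

theorem poisson_anti {E : Set (Space n)} {a b : ℝ} (hab : a ≤ b) {X y : Space n}
    (hX : 0 < delta E X) (hy : y ∈ E) : poisson E b X y ≤ poisson E a X y := by
  have hd : 0 < dist X y := hX.trans_le (delta_le_dist hy X)
  rw [poisson_eq hX hy, poisson_eq hX hy]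
  refine mul_le_mul_of_nonneg_left ?_ (by positivity)
  exact Real.rpow_le_rpow_of_exponent_ge (by positivity)
    ((div_le_one hd).2 (delta_le_dist hy X)) hab

theorem poisson_le {E : Set (Space n)} {a : ℝ} (ha : 0 ≤ a) {X y : Space n}
    (hX : 0 < delta E X) (hy : y ∈ E) : poisson E a X y ≤ (delta E X ^ n)⁻¹ := by
  have hd := delta_le_dist hy X
  rw [poisson_eq hX hy, ← Real.rpow_natCast, ← Real.rpow_neg hX.le]
  have h1 : dist X y ^ (-(n : ℝ)) ≤ delta E X ^ (-(n : ℝ)) :=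
    Real.rpow_le_rpow_of_nonpos hX hd (by simp)
  have h2 : (delta E X / dist X y) ^ a ≤ 1 :=
    Real.rpow_le_one (by positivity) ((div_le_one (hX.trans_le hd)).2 hd) ha
  have h3 : 0 ≤ dist X y ^ (-(n : ℝ)) := by positivity
  nlinarith

/-- On `E` one has `δ(X) ≤ |X - y|`, so with `R = δ(X)` the minimum in the radial bound is `δ(X) /
|X - y|` and the radial integrand is exactly the Poisson-like kernel. -/
theorem exists_poisson_bound (n : ℕ) {G a : ℝ} (hG : 0 ≤ G) (ha : 0 < a) :
    ∃ C : ℝ≥0, ∀ E : Set (Space n), IsClosed E → HasGrowth n G (surface E) → ∀ X ∈ Eᶜ,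
      ∫⁻ y, ENNReal.ofReal (poisson E a X y) ∂surface E ≤ C := by
  obtain ⟨C, hC⟩ := exists_radial_bound n (Nat.cast_nonneg n) hG ha
  refine ⟨C, fun E hE hg X hX => ?_⟩
  rcases E.eq_empty_or_nonempty with rfl | hne
  · simp [surface]
  have hpos := delta_pos hE hne hX
  refine le_trans ?_ (hC _ hg X _ hpos)
  have hm : MeasurableSet {y | 0 < dist X y} := by
    have h : Measurable fun y => dist X y := by fun_prop
    exact measurableSet_lt measurable_const h
  rw [← lintegral_indicator hm]
  refine lintegral_mono_ae ?_
  filter_upwards [ae_mem_surface hE] with y hy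
  have hd := delta_le_dist hy X
  have hd0 := hpos.trans_le hd
  rw [indicator_of_mem (by exact hd0), poisson_eq hpos hy, min_eq_right]
  exact ((div_le_one hd0).2 hd).trans ((one_le_div hpos).2 hd)

/-! ### A continuous Bessel inequality. -/

theorem two_mul_mul_le_sq_add_sq (s t : ℝ≥0∞) : 2 * (s * t) ≤ s ^ 2 + t ^ 2 := by
  rcases eq_or_ne s ⊤ with rfl | hs
  · simp
  rcases eq_or_ne t ⊤ with rfl | ht
  · simp
  lift s to ℝ≥0 using hs
  lift t to ℝ≥0 using ht
  exact_mod_cast (by linarith [two_mul_le_add_sq s t] : 2 * (s * t) ≤ s ^ 2 + t ^ 2)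

theorem add_sq_le_two_mul (s t : ℝ≥0∞) : (s + t) ^ 2 ≤ 2 * (s ^ 2 + t ^ 2) := by
  calc (s + t) ^ 2 = s ^ 2 + t ^ 2 + 2 * (s * t) := by ring
    _ ≤ s ^ 2 + t ^ 2 + (s ^ 2 + t ^ 2) := by gcongr; exact two_mul_mul_le_sq_add_sq s t
    _ = _ := by ring

/-- A continuous Bessel inequality: a family of vectors whose Gram kernel is dominated by a
symmetric kernel satisfying Schur's condition. -/
theorem lintegral_inner_sq_le {X H : Type*} [MeasurableSpace X] [NormedAddCommGroup H]
    [InnerProductSpace ℂ H] [CompleteSpace H] {μ : Measure X} [SFinite μ] (v : X → H)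
    (hv : ∀ h : H, AEStronglyMeasurable (fun x => ⟪v x, h⟫_ℂ) μ)
    (k : X → X → ℝ≥0∞) (hk : Measurable (Function.uncurry k)) (hsymm : ∀ x y, k x y = k y x)
    (hvk : ∀ᵐ x ∂μ, ∀ᵐ y ∂μ, ‖⟪v x, v y⟫_ℂ‖ₑ ≤ k x y) {C : ℝ≥0}
    (hC : ∀ᵐ x ∂μ, ∫⁻ y, k x y ∂μ ≤ C)
    (S : ℕ → Set X) (hS : ∀ N, MeasurableSet (S N)) (hmono : Monotone S)
    (hSμ : ∀ N, μ (S N) < ⊤) (hSv : ∀ N, ∃ B : ℝ, ∀ x ∈ S N, ‖v x‖ ≤ B)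
    (hcov : ∀ᵐ x ∂μ, x ∈ ⋃ N, S N) (f : H) :
    ∫⁻ x, ‖⟪v x, f⟫_ℂ‖ₑ ^ 2 ∂μ ≤ C * ‖f‖ₑ ^ 2 := by
  have key : ∀ N, ∫⁻ x in S N, ‖⟪v x, f⟫_ℂ‖ₑ ^ 2 ∂μ ≤ C * ‖f‖ₑ ^ 2 := by
    intro N
    obtain ⟨B, hB⟩ := hSv N
    set F : X → ℂ := fun x => ⟪v x, f⟫_ℂ with hF
    -- On `S N` the measure is finite and `v` is bounded, so every integral below is finite and may
    -- be divided out; the exhaustion is removed at the end by monotone convergence.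
    set ν := μ.restrict (S N) with hν
    have : IsFiniteMeasure ν := ⟨by rw [hν, Measure.restrict_apply_univ]; exact hSμ N⟩
    have hbd : ∀ h : H, ∀ᵐ x ∂ν, ‖⟪v x, h⟫_ℂ‖ ≤ B * ‖h‖ := fun h => by
      filter_upwards [ae_restrict_mem (hS N)] with x hx
      exact (norm_inner_le_norm _ _).trans (by gcongr; exact hB x hx)
    have hm : ∀ h : H, AEStronglyMeasurable (fun x => ⟪v x, h⟫_ℂ) ν := fun h => (hv h).restrict
    have hint : ∀ h : H, Integrable (fun x => starRingEnd ℂ (F x) * ⟪v x, h⟫_ℂ) ν := by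
      intro h
      refine Integrable.of_bound (C := (B * ‖f‖) * (B * ‖h‖))
        ((Complex.continuous_conj.comp_aestronglyMeasurable (hm f)).mul (hm h)) ?_
      filter_upwards [hbd f, hbd h] with x h1 h2
      rw [norm_mul, RCLike.norm_conj]
      exact mul_le_mul h1 h2 (norm_nonneg _) ((norm_nonneg _).trans h1)
    -- The functional represented by `g = ∫ F(x) v(x) dν`, the adjoint applied to `F`. Defining `g`
    -- weakly through Riesz representation needs only that the scalar products of `v` are
    -- measurable.
    let L : H →ₗ[ℂ] ℂ :=
      { toFun := fun h => ∫ x, starRingEnd ℂ (F x) * ⟪v x, h⟫_ℂ ∂ν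
        map_add' := fun a b => by
          rw [← integral_add (hint a) (hint b)]
          simp only [inner_add_right, mul_add]
        map_smul' := fun c a => by
          rw [RingHom.id_apply, smul_eq_mul, ← integral_const_mul]
          congr 1; ext x; rw [inner_smul_right]; ring }
    let L' : StrongDual ℂ H := L.mkContinuous (B * ‖f‖ * B * ν.real univ) fun h => by
      refine (norm_integral_le_of_norm_le_const (C := (B * ‖f‖) * (B * ‖h‖)) ?_).trans (le_of_eq ?_)
      · filter_upwards [hbd f, hbd h] with x h1 h2
        rw [norm_mul, RCLike.norm_conj]
        exact mul_le_mul h1 h2 (norm_nonneg _) ((norm_nonneg _).trans h1)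
      · ring
    set g : H := (InnerProductSpace.toDual ℂ H).symm L' with hg
    have hgi : ∀ h, ⟪g, h⟫_ℂ = ∫ x, starRingEnd ℂ (F x) * ⟪v x, h⟫_ℂ ∂ν := fun h =>
      InnerProductSpace.toDual_symm_apply
    set a : ℝ≥0∞ := ∫⁻ x, ‖F x‖ₑ ^ 2 ∂ν with ha
    have hFm : AEStronglyMeasurable F ν := hm f
    have hFe : AEMeasurable (fun x => ‖F x‖ₑ) ν := hFm.enorm
    have ha_top : a ≠ ⊤ := by
      have hb : a ≤ ∫⁻ x, ENNReal.ofReal (B * ‖f‖) ^ 2 ∂ν := by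
        refine lintegral_mono_ae ?_
        filter_upwards [hbd f] with x hx
        gcongr
        rw [← ofReal_norm]
        exact ENNReal.ofReal_le_ofReal hx
      refine ne_top_of_le_ne_top ?_ hb
      rw [lintegral_const]
      exact ENNReal.mul_ne_top (ENNReal.pow_ne_top ENNReal.ofReal_ne_top) (measure_ne_top _ _)
    have hgf : a = ‖⟪g, f⟫_ℂ‖ₑ := by
      have h1 : ⟪g, f⟫_ℂ = ((∫ x, ‖F x‖ ^ 2 ∂ν : ℝ) : ℂ) := by
        rw [hgi, ← integral_complex_ofReal]
        congr 1; ext x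
        rw [Complex.conj_mul']; push_cast; rfl
      have h0 : 0 ≤ ∫ x, ‖F x‖ ^ 2 ∂ν := integral_nonneg fun x => by positivity
      rw [h1, ← ofReal_norm, Complex.norm_real, Real.norm_of_nonneg h0,
        ofReal_integral_eq_lintegral_ofReal]
      · refine lintegral_congr fun x => ?_
        rw [← ofReal_norm, ENNReal.ofReal_pow (norm_nonneg _)]
      · have := (hint f).norm
        refine this.congr (Filter.Eventually.of_forall fun x => ?_)
        simp only [norm_mul, RCLike.norm_conj]
        rw [sq]
      · exact Filter.Eventually.of_forall fun x => by positivity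
    have hk2 : ∀ x, Measurable (k x) := fun x => hk.of_uncurry_left
    have hgv : ∀ᵐ x ∂ν, ‖⟪v x, g⟫_ℂ‖ₑ ≤ ∫⁻ y, ‖F y‖ₑ * k x y ∂ν := by
      filter_upwards [ae_restrict_of_ae hvk] with x hx
      rw [← inner_conj_symm, RCLike.enorm_conj, hgi]
      refine (enorm_integral_le_lintegral_enorm _).trans (lintegral_mono_ae ?_)
      filter_upwards [ae_restrict_of_ae hx] with y hy
      rw [enorm_mul, RCLike.enorm_conj, ← inner_conj_symm, RCLike.enorm_conj]
      gcongr
    -- Schur's test: `‖g‖²` is at most `∬ |F(x)| |F(y)| k(x, y)`, and after `2st ≤ s² + t²` the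
    -- symmetry of `k` makes both halves equal.
    have hgg : ‖g‖ₑ ^ 2 ≤ C * a := by
      have h1 : ‖g‖ₑ ^ 2 = ‖⟪g, g⟫_ℂ‖ₑ := by
        rw [← ofReal_norm, ← ofReal_norm, ← inner_self_re_eq_norm, inner_self_eq_norm_sq,
          ENNReal.ofReal_pow (norm_nonneg _)]
      have hle : ∀ s t c : ℝ≥0∞, s * (t * c) ≤ 2⁻¹ * (s ^ 2 * c) + 2⁻¹ * (t ^ 2 * c) := by
        intro s t c
        calc s * (t * c) = 2⁻¹ * (2 * (s * t) * c) := by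
              rw [← mul_assoc, ← mul_assoc, ← mul_assoc,
                ENNReal.inv_mul_cancel two_ne_zero ENNReal.ofNat_ne_top, one_mul]
          _ ≤ 2⁻¹ * ((s ^ 2 + t ^ 2) * c) := by gcongr; exact two_mul_mul_le_sq_add_sq s t
          _ = _ := by ring
      have hA : ∫⁻ x, ∫⁻ y, ‖F x‖ₑ ^ 2 * k x y ∂ν ∂ν ≤ C * a := by
        calc _ = ∫⁻ x, ‖F x‖ₑ ^ 2 * ∫⁻ y, k x y ∂ν ∂ν :=
              lintegral_congr fun x => lintegral_const_mul _ (hk2 x)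
          _ ≤ ∫⁻ x, ‖F x‖ₑ ^ 2 * C ∂ν := by
              refine lintegral_mono_ae ?_
              filter_upwards [ae_restrict_of_ae hC] with x hx
              gcongr
              exact (lintegral_mono' Measure.restrict_le_self le_rfl).trans hx
          _ = _ := by rw [lintegral_mul_const'' _ (hFe.pow_const 2), mul_comm]
      have hB' : ∫⁻ x, ∫⁻ y, ‖F y‖ₑ ^ 2 * k x y ∂ν ∂ν ≤ C * a := by
        rw [lintegral_lintegral_swap]
        · simp_rw [fun x y => hsymm x y]
          exact hA
        · exact ((hFe.comp_snd).pow_const 2).mul hk.aemeasurable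
      calc ‖g‖ₑ ^ 2 = ‖⟪g, g⟫_ℂ‖ₑ := h1
        _ ≤ ∫⁻ x, ‖F x‖ₑ * ∫⁻ y, ‖F y‖ₑ * k x y ∂ν ∂ν := by
            rw [hgi]
            refine (enorm_integral_le_lintegral_enorm _).trans (lintegral_mono_ae ?_)
            filter_upwards [hgv] with x hx
            rw [enorm_mul, RCLike.enorm_conj]
            gcongr
        _ ≤ ∫⁻ x, (2⁻¹ * ∫⁻ y, ‖F x‖ₑ ^ 2 * k x y ∂ν) + 2⁻¹ * ∫⁻ y, ‖F y‖ₑ ^ 2 * k x y ∂ν ∂ν := by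
            refine lintegral_mono fun x => ?_
            simp only
            rw [← lintegral_const_mul' _ _ enorm_ne_top, ← lintegral_const_mul' _ _ (by simp),
              ← lintegral_const_mul' _ _ (by simp),
              ← lintegral_add_left ((((hk2 x).const_mul _)).const_mul _)]
            exact lintegral_mono fun y => hle _ _ _
        _ = 2⁻¹ * ∫⁻ x, ∫⁻ y, ‖F x‖ₑ ^ 2 * k x y ∂ν ∂ν +
              2⁻¹ * ∫⁻ x, ∫⁻ y, ‖F y‖ₑ ^ 2 * k x y ∂ν ∂ν := by
            have m1 : AEMeasurable (fun x => ∫⁻ y, ‖F x‖ₑ ^ 2 * k x y ∂ν) ν :=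
              (((hFe.comp_fst).pow_const 2).mul hk.aemeasurable).lintegral_prod_right'
            rw [lintegral_add_left' (m1.const_mul _), lintegral_const_mul' _ _ (by simp),
              lintegral_const_mul' _ _ (by simp)]
        _ ≤ 2⁻¹ * (C * a) + 2⁻¹ * (C * a) := by gcongr
        _ = C * a := by rw [← add_mul, ENNReal.inv_two_add_inv_two, one_mul]
    -- Since `a = ⟪g, f⟫`, Cauchy-Schwarz gives `a² ≤ ‖g‖² ‖f‖² ≤ C a ‖f‖²`; the finite factor `a`
    -- then cancels.
    have hle : a * a ≤ a * (C * ‖f‖ₑ ^ 2) := by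
      calc a * a = a ^ 2 := (sq a).symm
        _ ≤ (‖g‖ₑ * ‖f‖ₑ) ^ 2 := by
            gcongr
            rw [hgf, ← ofReal_norm, ← ofReal_norm, ← ofReal_norm,
              ← ENNReal.ofReal_mul (norm_nonneg _)]
            exact ENNReal.ofReal_le_ofReal (norm_inner_le_norm _ _)
        _ = ‖g‖ₑ ^ 2 * ‖f‖ₑ ^ 2 := mul_pow _ _ _
        _ ≤ C * a * ‖f‖ₑ ^ 2 := by gcongr
        _ = _ := by ring
    rcases eq_or_ne a 0 with h0 | h0
    · rw [h0]; exact zero_le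
    · exact (ENNReal.mul_le_mul_iff_right h0 ha_top).1 hle
  calc ∫⁻ x, ‖⟪v x, f⟫_ℂ‖ₑ ^ 2 ∂μ = ∫⁻ x in ⋃ N, S N, ‖⟪v x, f⟫_ℂ‖ₑ ^ 2 ∂μ := by
        rw [Measure.restrict_eq_self_of_ae_mem hcov]
    _ = ⨆ N, ∫⁻ x in S N, ‖⟪v x, f⟫_ℂ‖ₑ ^ 2 ∂μ := by
        rw [setLIntegral_iUnion_of_directed _ hmono.directed_le]
    _ ≤ _ := iSup_le key

/-! ### The Gram kernel and Schur's condition. -/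

/-- The kernel that dominates the Gram kernel of a cancellative square function. -/
noncomputable def gramBound (E : Set (Space n)) (γ : ℝ) (X Y : Space n) : ℝ :=
  (delta E X * delta E Y) ^ γ / max (max (delta E X) (delta E Y)) (dist X Y) ^ ((n : ℝ) + 2 * γ)

theorem gramBound_comm (E : Set (Space n)) (γ : ℝ) (X Y : Space n) :
    gramBound E γ X Y = gramBound E γ Y X := by
  rw [gramBound, gramBound, mul_comm (delta E X), max_comm (delta E X), dist_comm]

theorem measurable_gramBound (E : Set (Space n)) (γ : ℝ) :
    Measurable fun p : Space n × Space n => gramBound E γ p.1 p.2 := by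
  unfold gramBound
  have := measurable_delta E
  fun_prop

/-- As `z` is within `2δ(Y)` of `Y`, the distance `|z - Y|` is comparable with `δ(Y)`, and both `|X
- z|` and `|z - Y|` are at most three times the maximum in `gramBound`. The result is a Poisson-like
kernel in `(X, z)` times a radial kernel in `(z, Y)`, each integrable separately. -/
theorem gramBound_div_le {E : Set (Space n)} {γ : ℝ} (hγ : 0 < γ) {X Y z : Space n}
    (hX : 0 < delta E X) (hY : 0 < delta E Y) (hz : z ∈ E) (hYz : dist Y z < 2 * delta E Y) :
    gramBound E γ X Y * (delta E Y ^ (n + 1))⁻¹ ≤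
      3 ^ ((n : ℝ) + 2 * γ) * 2 ^ (n + 1) * poisson E γ X z *
        (dist z Y ^ (-((n : ℝ) + 1)) * min (dist z Y / dist X z) (dist X z / dist z Y) ^ γ) := by
  set δ := delta E X
  set δ' := delta E Y
  set D := dist X z with hD
  set ρ := dist z Y with hρ
  set m := max (max δ δ') (dist X Y) with hm
  have h1 : δ ≤ D := delta_le_dist hz X
  have h2 : δ' ≤ ρ := by rw [hρ, dist_comm]; exact delta_le_dist hz Y
  have h3 : ρ < 2 * δ' := by rw [hρ, dist_comm]; exact hYz
  have hD0 : 0 < D := hX.trans_le h1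
  have hρ0 : 0 < ρ := hY.trans_le h2
  have hmX : δ ≤ m := (le_max_left _ _).trans (le_max_left _ _)
  have hmY : δ' ≤ m := (le_max_right _ _).trans (le_max_left _ _)
  have hmd : dist X Y ≤ m := le_max_right _ _
  have hm0 : 0 < m := hX.trans_le hmX
  have hDm : D ≤ 3 * m := by
    have := dist_triangle X Y z
    have : dist Y z = ρ := by rw [hρ, dist_comm]
    linarith [hD]
  have hρm : ρ ≤ 3 * m := by linarith
  set M := max D ρ with hM
  have hM0 : 0 < M := hD0.trans_le (le_max_left _ _)
  have hMm : M ≤ 3 * m := max_le hDm hρm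
  have e1 : (m ^ ((n : ℝ) + 2 * γ))⁻¹ ≤ 3 ^ ((n : ℝ) + 2 * γ) * (M ^ ((n : ℝ) + 2 * γ))⁻¹ := by
    have : M ^ ((n : ℝ) + 2 * γ) ≤ 3 ^ ((n : ℝ) + 2 * γ) * m ^ ((n : ℝ) + 2 * γ) := by
      rw [← Real.mul_rpow (by norm_num) hm0.le]
      exact Real.rpow_le_rpow hM0.le hMm (by positivity)
    rw [← div_eq_mul_inv, le_div_iff₀ (by positivity), inv_mul_le_iff₀ (by positivity)]
    linarith
  have e2 : (δ' ^ (n + 1))⁻¹ ≤ 2 ^ (n + 1) * ρ ^ (-((n : ℝ) + 1)) := by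
    have : ρ ^ ((n : ℝ) + 1) = ρ ^ (n + 1) := by rw [← Real.rpow_natCast]; push_cast; rfl
    rw [Real.rpow_neg hρ0.le, this, ← div_eq_mul_inv, ← div_pow, ← inv_pow]
    refine pow_le_pow_left₀ (by positivity) ?_ _
    rw [inv_le_comm₀ hY (by positivity), inv_div]
    linarith
  have e3 : D ^ ((n : ℝ) + γ) * ρ ^ γ ≤ M ^ ((n : ℝ) + 2 * γ) * min (ρ / D) (D / ρ) ^ γ := by
    rcases le_total ρ D with h | h
    · have hMD : M = D := max_eq_left h
      have hmin : min (ρ / D) (D / ρ) = ρ / D :=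
        min_eq_left (((div_le_one hD0).2 h).trans ((one_le_div hρ0).2 h))
      rw [hMD, hmin, Real.div_rpow hρ0.le hD0.le, two_mul, ← add_assoc, Real.rpow_add hD0 ((n : ℝ) + γ) γ]
      exact le_of_eq (by field_simp)
    · have hMD : M = ρ := max_eq_right h
      have hmin : min (ρ / D) (D / ρ) = D / ρ :=
        min_eq_right (((div_le_one hρ0).2 h).trans ((one_le_div hD0).2 h))
      rw [hMD, hmin, Real.div_rpow hD0.le hρ0.le, two_mul, ← add_assoc, Real.rpow_add hρ0 ((n : ℝ) + γ) γ,
        Real.rpow_add hD0, Real.rpow_add hρ0]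
      have : D ^ (n : ℝ) ≤ ρ ^ (n : ℝ) := Real.rpow_le_rpow hD0.le h (by positivity)
      calc _ = D ^ (n : ℝ) * (D ^ γ * ρ ^ γ) := by ring
        _ ≤ ρ ^ (n : ℝ) * (D ^ γ * ρ ^ γ) := by gcongr
        _ = _ := by field_simp
  have e4 : δ' ^ γ ≤ ρ ^ γ := Real.rpow_le_rpow hY.le h2 hγ.le
  have e5 : ρ ^ γ * (M ^ ((n : ℝ) + 2 * γ))⁻¹ ≤
      (D ^ ((n : ℝ) + γ))⁻¹ * min (ρ / D) (D / ρ) ^ γ := by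
    rw [← div_eq_mul_inv, div_le_iff₀ (by positivity), inv_mul_eq_div, div_mul_eq_mul_div,
      le_div_iff₀ (by positivity)]
    linarith
  unfold gramBound poisson
  change (δ * δ') ^ γ / m ^ _ * _ ≤ _ * (δ ^ γ / D ^ _) * _
  rw [Real.mul_rpow hX.le hY.le, div_eq_mul_inv, div_eq_mul_inv]
  calc δ ^ γ * δ' ^ γ * (m ^ ((n : ℝ) + 2 * γ))⁻¹ * (δ' ^ (n + 1))⁻¹
      ≤ δ ^ γ * ρ ^ γ * (3 ^ ((n : ℝ) + 2 * γ) * (M ^ ((n : ℝ) + 2 * γ))⁻¹) *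
        (2 ^ (n + 1) * ρ ^ (-((n : ℝ) + 1))) := by gcongr
    _ = 3 ^ ((n : ℝ) + 2 * γ) * 2 ^ (n + 1) * δ ^ γ * ρ ^ (-((n : ℝ) + 1)) *
        (ρ ^ γ * (M ^ ((n : ℝ) + 2 * γ))⁻¹) := by ring
    _ ≤ 3 ^ ((n : ℝ) + 2 * γ) * 2 ^ (n + 1) * δ ^ γ * ρ ^ (-((n : ℝ) + 1)) *
        ((D ^ ((n : ℝ) + γ))⁻¹ * min (ρ / D) (D / ρ) ^ γ) := by gcongr
    _ = _ := by ring

theorem measurableSet_dist_pos (z : Space n) : MeasurableSet {y | 0 < dist z y} := by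
  have h : Measurable fun y => dist z y := by fun_prop
  exact measurableSet_lt measurable_const h

/-- The factor `δ(Y)ⁿ` is replaced by the mass `σ(B(Y, 2δ(Y)))`, that is, by an integral over points
`z` of `E`. After exchanging the integrals, the factorization of `gramBound_div_le` lets one
integrate first in `Y` and then in `z`. -/
theorem exists_schur_bound (n : ℕ) {A G γ : ℝ} (hA : 0 < A) (hG : 0 ≤ G) (hγ : 0 < γ) :
    ∃ C : ℝ≥0, ∀ E : Set (Space n), IsADR A E → HasGrowth n G (surface E) → E.Nonempty →
      ∀ X ∈ Eᶜ, ∫⁻ Y in nearRegion E,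
        ENNReal.ofReal (gramBound E γ X Y) * (ENNReal.ofReal (delta E Y))⁻¹ ≤ C := by
  obtain ⟨V, hV0, hV⟩ := exists_volume_growth n
  obtain ⟨C₁, hC₁⟩ := exists_radial_bound n (d := (n : ℝ) + 1) (by positivity) hV0 hγ
  obtain ⟨C₂, hC₂⟩ := exists_poisson_bound n hG hγ
  set c : ℝ := A * (3 ^ ((n : ℝ) + 2 * γ) * 2 ^ (n + 1)) with hc
  have hc0 : 0 ≤ c := by positivity
  refine ⟨c.toNNReal * C₁ * C₂, fun E hE hg hne X hX => ?_⟩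
  have := hg.isLocallyFiniteMeasure
  have hX0 := delta_pos hE.isClosed hne hX
  set H : Space n → Space n → ℝ≥0∞ := fun z => indicator {Y | 0 < dist z Y} fun Y =>
    ENNReal.ofReal (dist z Y ^ (-((n : ℝ) + 1)) *
      min (dist z Y / dist X z) (dist X z / dist z Y) ^ γ) with hH
  have hHm : Measurable fun p : Space n × Space n => H p.2 p.1 := by
    have : (fun p : Space n × Space n => H p.2 p.1) =
        indicator {p : Space n × Space n | 0 < dist p.2 p.1} fun p =>
          ENNReal.ofReal (dist p.2 p.1 ^ (-((n : ℝ) + 1)) *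
            min (dist p.2 p.1 / dist X p.2) (dist X p.2 / dist p.2 p.1) ^ γ) := by
      ext p; simp only [hH, indicator]; rfl
    rw [this]
    refine Measurable.indicator (by fun_prop) (measurableSet_lt measurable_const (by fun_prop))
  have hPm : Measurable fun z => ENNReal.ofReal (c * poisson E γ X z) := by
    have := (measurable_poisson E γ).comp (measurable_prodMk_left (x := X))
    exact (this.const_mul c).ennreal_ofReal
  calc _ ≤ ∫⁻ Y in nearRegion E, ∫⁻ z, ENNReal.ofReal (c * poisson E γ X z) * H z Y ∂surface E := by
        refine setLIntegral_mono' (measurableSet_nearRegion hE.isClosed) fun Y hY => ?_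
        have hY0 := delta_pos hE.isClosed hne hY.1
        set q := gramBound E γ X Y * (delta E Y ^ (n + 1))⁻¹ with hq
        have hq0 : 0 ≤ q := by
          rw [hq, gramBound]; positivity
        calc _ = ENNReal.ofReal (A * q) * ENNReal.ofReal (A⁻¹ * delta E Y ^ n) := by
              rw [← ENNReal.ofReal_inv_of_pos hY0, ← ENNReal.ofReal_mul (by
                unfold gramBound; positivity), ← ENNReal.ofReal_mul (by positivity), hq, pow_succ]
              congr 1
              field_simp
          _ ≤ ENNReal.ofReal (A * q) * surface E (Metric.ball Y (2 * delta E Y)) := by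
              gcongr
              exact hE.le_surface_ball hne hY
          _ = ∫⁻ z in Metric.ball Y (2 * delta E Y), ENNReal.ofReal (A * q) ∂surface E := by
              rw [lintegral_const, Measure.restrict_apply_univ]
          _ = ∫⁻ z, indicator (Metric.ball Y (2 * delta E Y))
                (fun _ => ENNReal.ofReal (A * q)) z ∂surface E := by
              rw [lintegral_indicator Metric.isOpen_ball.measurableSet]
          _ ≤ _ := by
              refine lintegral_mono_ae ?_
              filter_upwards [ae_mem_surface hE.isClosed] with z hz
              refine indicator_apply_le' (fun hzY => ?_) (fun _ => bot_le)
              have hzY' : dist Y z < 2 * delta E Y := by rw [dist_comm]; exact hzY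
              have hpos : 0 < dist z Y := by
                rw [dist_comm]; exact hY0.trans_le (delta_le_dist hz Y)
              have hPp := poisson_nonneg E γ X z
              simp only [hH]
              rw [indicator_of_mem (by exact hpos), ← ENNReal.ofReal_mul (by positivity)]
              refine ENNReal.ofReal_le_ofReal ?_
              have := gramBound_div_le hγ hX0 hY0 hz hzY'
              calc A * q ≤ A * _ := mul_le_mul_of_nonneg_left this hA.le
                _ = _ := by rw [hc]; ring
    _ = ∫⁻ z, (∫⁻ Y in nearRegion E, ENNReal.ofReal (c * poisson E γ X z) * H z Y) ∂surface E := by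
        have hm : AEMeasurable (Function.uncurry fun Y z : Space n =>
            ENNReal.ofReal (c * poisson E γ X z) * H z Y)
            ((volume.restrict (nearRegion E)).prod (surface E)) :=
          (hPm.comp measurable_snd).aemeasurable.mul hHm.aemeasurable
        exact lintegral_lintegral_swap hm
    -- The radial bound for Lebesgue measure, of growth `n + 1`, centred at `z` with scale `R = |X -
    -- z|`.
    _ ≤ ∫⁻ z, ENNReal.ofReal (c * poisson E γ X z) * C₁ ∂surface E := by
        refine lintegral_mono_ae ?_
        filter_upwards [ae_mem_surface hE.isClosed] with z hz
        rw [lintegral_const_mul' _ _ ENNReal.ofReal_ne_top]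
        gcongr
        refine (lintegral_mono' Measure.restrict_le_self le_rfl).trans ?_
        simp only [hH]
        rw [lintegral_indicator (measurableSet_dist_pos z)]
        exact hC₁ _ hV z _ (hX0.trans_le (delta_le_dist hz X))
    _ = ENNReal.ofReal c * C₁ * ∫⁻ z, ENNReal.ofReal (poisson E γ X z) ∂surface E := by
        rw [← lintegral_const_mul' _ _ (by finiteness)]
        refine lintegral_congr fun z => ?_
        rw [ENNReal.ofReal_mul hc0]; ring
    _ ≤ ENNReal.ofReal c * C₁ * C₂ := by
        gcongr
        exact hC₂ E hE.isClosed hg X hX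
    _ = _ := by push_cast; rfl

/-! ### Elementary consequences of the kernel conditions. -/

section Kernel

variable {α K : ℝ} {E : Set (Space n)} {ψ : Space n → Space n → ℂ}

/-- Both conditions involve a power of a ratio at most 1, namely `δ(X) / |X - y|` or `|y - y'| / |X
- y|`. Lowering the exponent permits `α ≤ 1`, as the Lipschitz averages require, and permits
spending only half of the Hölder exponent. -/
theorem IsKernel.mono (h : IsKernel α K E ψ) (hE : IsClosed E) (hK : 0 ≤ K) {a : ℝ} (ha0 : 0 < a)
    (ha : a ≤ α) : IsKernel a K E ψ where
  measurable := h.measurable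
  size X hX y hy := (h.size X hX y hy).trans
    (mul_le_mul_of_nonneg_left (poisson_anti ha (delta_pos hE ⟨y, hy⟩ hX) hy) hK)
  holder X hX y hy y' hy' hyy := by
    refine (h.holder X hX y hy y' hy' hyy).trans (mul_le_mul_of_nonneg_left ?_ hK)
    have hd : 0 < dist X y := (delta_pos hE ⟨y, hy⟩ hX).trans_le (delta_le_dist hy X)
    have key : ∀ b : ℝ, dist y y' ^ b / dist X y ^ ((n : ℝ) + b) =
        (dist y y' / dist X y) ^ b / dist X y ^ (n : ℝ) := fun b => by
      rw [Real.div_rpow dist_nonneg hd.le, Real.rpow_add hd]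
      field_simp
    rw [key, key]
    refine div_le_div_of_nonneg_right ?_ (by positivity)
    rcases (dist_nonneg (x := y) (y := y')).eq_or_lt with h0 | h0
    · rw [← h0, zero_div, Real.zero_rpow (ha0.trans_le ha).ne', Real.zero_rpow ha0.ne']
    · exact Real.rpow_le_rpow_of_exponent_ge (by positivity)
        ((div_le_one hd).2 (by linarith)) ha

/-- Joint measurability up to null sets says nothing about an individual slice `ψ(X, ·)`; continuity
on `E` makes every slice measurable, hence `Θf(X)` meaningful at every `X`. -/
theorem IsKernel.continuousOn (h : IsKernel α K E ψ) (hE : IsClosed E) (hα : 0 < α)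
    {X : Space n} (hX : X ∈ Eᶜ) : ContinuousOn (ψ X) E := by
  intro y hy
  have hd : 0 < dist X y := (delta_pos hE ⟨y, hy⟩ hX).trans_le (delta_le_dist hy X)
  rw [ContinuousWithinAt, tendsto_iff_norm_sub_tendsto_zero]
  have hlim : Filter.Tendsto (fun y' => K * (dist y y' ^ α / dist X y ^ ((n : ℝ) + α)))
      (nhdsWithin y E) (nhds 0) := by
    have h1 : Continuous fun y' => K * (dist y y' ^ α / dist X y ^ ((n : ℝ) + α)) := by
      have : Continuous fun y' => dist y y' ^ α :=
        (continuous_const.dist continuous_id).rpow_const fun _ => Or.inr hα.le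
      fun_prop
    have h2 := (h1.tendsto y).mono_left (nhdsWithin_le_nhds (s := E))
    simpa [Real.zero_rpow hα.ne'] using h2
  refine squeeze_zero' (Filter.Eventually.of_forall fun _ => norm_nonneg _) ?_ hlim
  have hnear : ∀ᶠ y' in nhdsWithin y E, dist y' y < dist X y / 2 :=
    mem_nhdsWithin_of_mem_nhds (Metric.ball_mem_nhds y (by positivity))
  filter_upwards [hnear, self_mem_nhdsWithin] with y' h1 h2
  rw [norm_sub_rev]
  refine h.holder X hX y hy y' h2 ?_
  rw [dist_comm y y']
  linarith

theorem IsKernel.aestronglyMeasurable (h : IsKernel α K E ψ) (hE : IsClosed E) (hα : 0 < α)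
    {X : Space n} (hX : X ∈ Eᶜ) : AEStronglyMeasurable (ψ X) (surface E) :=
  (h.continuousOn hE hα hX).aestronglyMeasurable hE.measurableSet

theorem IsKernel.enorm_le (h : IsKernel α K E ψ) (hK : 0 ≤ K) {X y : Space n} (hX : X ∈ Eᶜ)
    (hy : y ∈ E) : ‖ψ X y‖ₑ ≤ ENNReal.ofReal K * ENNReal.ofReal (poisson E α X y) := by
  rw [← ENNReal.ofReal_mul hK, ← ofReal_norm]
  exact ENNReal.ofReal_le_ofReal (h.size X hX y hy)

end Kernel

theorem exists_lintegral_kernel_bound (n : ℕ) {G α K : ℝ} (hG : 0 ≤ G) (hα : 0 < α) (hK : 0 ≤ K) :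
    ∃ C : ℝ≥0, ∀ E : Set (Space n), IsClosed E → HasGrowth n G (surface E) →
      ∀ ψ : Space n → Space n → ℂ, IsKernel α K E ψ → ∀ X ∈ Eᶜ,
        ∫⁻ y, ‖ψ X y‖ₑ ∂surface E ≤ C := by
  obtain ⟨C, hC⟩ := exists_poisson_bound n hG hα
  refine ⟨K.toNNReal * C, fun E hE hg ψ hψ X hX => ?_⟩
  calc _ ≤ ∫⁻ y, ENNReal.ofReal K * ENNReal.ofReal (poisson E α X y) ∂surface E := by
        refine lintegral_mono_ae ?_
        filter_upwards [ae_mem_surface hE] with y hy using hψ.enorm_le hK hX hy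
    _ = ENNReal.ofReal K * ∫⁻ y, ENNReal.ofReal (poisson E α X y) ∂surface E :=
        lintegral_const_mul' _ _ ENNReal.ofReal_ne_top
    _ ≤ ENNReal.ofReal K * C := by gcongr; exact hC E hE hg X hX
    _ = _ := by push_cast; rfl

section Kernel

variable {α K G : ℝ} {E : Set (Space n)} {ψ : Space n → Space n → ℂ}

theorem IsKernel.integrable (h : IsKernel α K E ψ) (hE : IsClosed E) (hα : 0 < α) (hK : 0 ≤ K)
    (hG : 0 ≤ G) (hg : HasGrowth n G (surface E)) {X : Space n} (hX : X ∈ Eᶜ) :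
    Integrable (ψ X) (surface E) := by
  obtain ⟨C, hC⟩ := exists_lintegral_kernel_bound n hG hα hK
  exact ⟨h.aestronglyMeasurable hE hα hX, (hC E hE hg ψ h X hX).trans_lt ENNReal.coe_lt_top⟩

theorem IsKernel.ae_norm_le (h : IsKernel α K E ψ) (hE : IsClosed E) (hα : 0 < α) (hK : 0 ≤ K)
    {X : Space n} (hX : X ∈ Eᶜ) : ∀ᵐ y ∂surface E, ‖ψ X y‖ ≤ K * (delta E X ^ n)⁻¹ := by
  filter_upwards [ae_mem_surface hE] with y hy
  exact (h.size X hX y hy).trans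
    (mul_le_mul_of_nonneg_left (poisson_le hα.le (delta_pos hE ⟨y, hy⟩ hX) hy) hK)

/-- A bounded integrable function is square integrable. -/
theorem IsKernel.memLp (h : IsKernel α K E ψ) (hE : IsClosed E) (hα : 0 < α) (hK : 0 ≤ K)
    (hG : 0 ≤ G) (hg : HasGrowth n G (surface E)) {X : Space n} (hX : X ∈ Eᶜ) :
    MemLp (ψ X) 2 (surface E) := by
  have hm := h.aestronglyMeasurable hE hα hX
  rw [memLp_two_iff_integrable_sq_norm hm]
  have h1 := ((h.integrable hE hα hK hG hg hX).norm).const_mul (K * (delta E X ^ n)⁻¹)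
  refine h1.mono' (hm.norm.pow 2) ?_
  filter_upwards [h.ae_norm_le hE hα hK hX] with y hy
  rw [Real.norm_of_nonneg (by positivity), sq]
  exact mul_le_mul_of_nonneg_right hy (norm_nonneg _)

/-! ### Almost orthogonality of kernels with vanishing integral. -/

/-- Here `y₀` is a point of `E` nearest to `X'`. The decay in `X, X'` is split off as a factor free
of `y`, leaving Poisson-like kernels that can be integrated in `y`. The point is that `|y - y₀| ≤
2|X' - y|`, so a power of `|y - y₀|` can be absorbed by the decay of `ψ(X', ·)`. -/
theorem IsKernel.norm_sub_mul_norm_le (h : IsKernel α K E ψ) (hE : IsClosed E) (hα : 0 < α)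
    (hK : 0 ≤ K) {X X' y y₀ : Space n} (hX : X ∈ Eᶜ) (hX' : X' ∈ Eᶜ) (hy : y ∈ E) (hy₀ : y₀ ∈ E)
    (hXy₀ : dist X' y₀ = delta E X') (hle : delta E X' ≤ delta E X) :
    ‖ψ X y - ψ X y₀‖ * ‖ψ X' y‖ ≤ K ^ 2 * 4 ^ ((n : ℝ) + α) *
      (delta E X' ^ (α / 2) / dist X y₀ ^ ((n : ℝ) + α / 2)) *
        (poisson E (α / 2) X' y + poisson E α X y) := by
  have hδ := delta_pos hE ⟨y, hy⟩ hX
  have hδ' := delta_pos hE ⟨y, hy⟩ hX'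
  set δ := delta E X
  set δ' := delta E X'
  set d := dist X y₀ with hd
  set ρ := dist y₀ y with hρ
  set ρ' := dist X' y with hρ'
  have h1 : δ ≤ d := delta_le_dist hy₀ X
  have h2 : δ' ≤ ρ' := delta_le_dist hy X'
  have hd0 : 0 < d := hδ.trans_le h1
  have hρ0 : 0 ≤ ρ := dist_nonneg
  have hρ'0 : 0 < ρ' := hδ'.trans_le h2
  have hρρ' : ρ ≤ 2 * ρ' := by
    have := dist_triangle y₀ X' y
    rw [dist_comm y₀ X', hXy₀] at this
    linarith
  set e := α / 2 with he
  have he0 : 0 < e := by positivity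
  have hα2 : α = e + e := by rw [he]; ring
  have hP' := poisson_nonneg E α X' y
  have hP := poisson_nonneg E α X y
  have hPe := poisson_nonneg E e X' y
  set Q := δ' ^ e / d ^ ((n : ℝ) + e) with hQ
  have hQ0 : 0 ≤ Q := by positivity
  -- the contribution of the Hölder bound
  have t1 : (ρ / d) ^ e * (d ^ (n : ℝ))⁻¹ * poisson E α X' y ≤ 2 ^ e * Q * poisson E e X' y := by
    have hr : ρ ^ e ≤ 2 ^ e * ρ' ^ e := by
      rw [← Real.mul_rpow (by norm_num) hρ'0.le]
      exact Real.rpow_le_rpow hρ0 hρρ' he0.le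
    have hp : poisson E α X' y * ρ' ^ e = δ' ^ e * poisson E e X' y := by
      rw [poisson, poisson, hα2, ← add_assoc, Real.rpow_add hδ', Real.rpow_add hρ'0 ((n : ℝ) + e) e]
      change δ' ^ e * δ' ^ e / (ρ' ^ _ * _) * _ = _ * (δ' ^ e / ρ' ^ _)
      field_simp
    rw [Real.div_rpow hρ0 hd0.le, hQ, Real.rpow_add hd0]
    calc ρ ^ e / d ^ e * (d ^ (n : ℝ))⁻¹ * poisson E α X' y
        ≤ 2 ^ e * ρ' ^ e / d ^ e * (d ^ (n : ℝ))⁻¹ * poisson E α X' y := by gcongr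
      _ = 2 ^ e / d ^ e * (d ^ (n : ℝ))⁻¹ * (poisson E α X' y * ρ' ^ e) := by ring
      _ = _ := by rw [hp]; field_simp
  have hpow : (2 : ℝ) ^ e * 2 ^ e ≤ 4 ^ ((n : ℝ) + α) := by
    rw [← Real.mul_rpow (by norm_num) (by norm_num), show (2 : ℝ) * 2 = 4 by norm_num]
    exact Real.rpow_le_rpow_of_exponent_le (by norm_num) (by linarith [n.cast_nonneg (α := ℝ)])
  have hone : (1 : ℝ) ≤ 2 ^ e := Real.one_le_rpow (by norm_num) he0.le
  have hX'y : ‖ψ X' y‖ ≤ K * poisson E α X' y := h.size X' hX' y hy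
  have hXy : ‖ψ X y‖ ≤ K * poisson E α X y := h.size X hX y hy
  have hXy0 : ‖ψ X y₀‖ ≤ K * poisson E α X y₀ := h.size X hX y₀ hy₀
  rcases le_total (2 * ρ) d with hc | hc
  -- Hölder regime. Spending the exponent `α / 2` leaves `poisson E (α / 2) X'`; with the full
  -- exponent `α` the remaining `|X' - y|⁻ⁿ` would have no decay to spare.
  · have hdiff : ‖ψ X y - ψ X y₀‖ ≤ K * ((ρ / d) ^ e * (d ^ (n : ℝ))⁻¹) := by
      rw [norm_sub_rev]
      refine ((h.mono hE hK he0 (by linarith)).holder X hX y₀ hy₀ y hy hc).trans (le_of_eq ?_)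
      change K * (ρ ^ e / d ^ _) = _
      rw [Real.div_rpow hρ0 hd0.le, Real.rpow_add hd0]
      field_simp
    calc _ ≤ K * ((ρ / d) ^ e * (d ^ (n : ℝ))⁻¹) * (K * poisson E α X' y) := by gcongr
      _ = K ^ 2 * ((ρ / d) ^ e * (d ^ (n : ℝ))⁻¹ * poisson E α X' y) := by ring
      _ ≤ K ^ 2 * (2 ^ e * Q * poisson E e X' y) := by gcongr
      _ = K ^ 2 * 2 ^ e * Q * poisson E e X' y := by ring
      _ ≤ _ := by gcongr <;> nlinarith
  -- Here `y` is far from `y₀`, and the two terms of the difference are bounded separately. Since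
  -- `2ρ / d ≥ 1`, the value at `y₀` is again controlled by the Hölder expression in `t1`.
  · have hP0 : poisson E α X y₀ ≤ 2 ^ e * ((ρ / d) ^ e * (d ^ (n : ℝ))⁻¹) := by
      have e1 : poisson E α X y₀ ≤ (d ^ (n : ℝ))⁻¹ := by
        rw [poisson_eq hδ hy₀, Real.rpow_neg dist_nonneg]
        exact mul_le_of_le_one_right (by positivity)
          (Real.rpow_le_one (by positivity) ((div_le_one hd0).2 h1) hα.le)
      have e2 : 1 ≤ 2 ^ e * (ρ / d) ^ e := by
        rw [← Real.mul_rpow (by norm_num) (by positivity)]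
        refine Real.one_le_rpow ?_ he0.le
        rw [← mul_div_assoc, one_le_div hd0]
        exact hc
      calc _ ≤ 1 * (d ^ (n : ℝ))⁻¹ := by rw [one_mul]; exact e1
        _ ≤ 2 ^ e * (ρ / d) ^ e * (d ^ (n : ℝ))⁻¹ := by gcongr
        _ = _ := by ring
    -- For the value at `y`, the decay comes from `ψ(X', y)` through `d ≤ 2ρ ≤ 4ρ'`. One surplus
    -- factor `(δ' / d)^(α / 2)` is dropped, by `δ' ≤ δ ≤ d`.
    have hP2 : poisson E α X' y ≤ 4 ^ ((n : ℝ) + α) * Q := by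
      have hd4 : d ≤ 4 * ρ' := by linarith
      have e1 : d ^ ((n : ℝ) + α) ≤ 4 ^ ((n : ℝ) + α) * ρ' ^ ((n : ℝ) + α) := by
        rw [← Real.mul_rpow (by norm_num) hρ'0.le]
        exact Real.rpow_le_rpow hd0.le hd4 (by positivity)
      have e2 : poisson E α X' y ≤ 4 ^ ((n : ℝ) + α) * (δ' ^ α / d ^ ((n : ℝ) + α)) := by
        change δ' ^ α / ρ' ^ ((n : ℝ) + α) ≤ _
        rw [← mul_div_assoc, div_le_div_iff₀ (by positivity) (by positivity)]
        calc _ ≤ δ' ^ α * (4 ^ ((n : ℝ) + α) * ρ' ^ ((n : ℝ) + α)) := by gcongr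
          _ = _ := by ring
      refine e2.trans (mul_le_mul_of_nonneg_left ?_ (by positivity))
      rw [hQ, hα2, ← add_assoc, Real.rpow_add hδ', Real.rpow_add hd0 ((n : ℝ) + e) e, mul_div_mul_comm]
      refine mul_le_of_le_one_right (by positivity) ?_
      rw [div_le_one (by positivity)]
      exact Real.rpow_le_rpow hδ'.le (hle.trans h1) he0.le
    calc _ ≤ (K * poisson E α X y + K * poisson E α X y₀) * (K * poisson E α X' y) := by
          have := poisson_nonneg E α X y₀
          exact mul_le_mul ((norm_sub_le _ _).trans (add_le_add hXy hXy0)) hX'y (norm_nonneg _)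
            (by positivity)
      _ = K ^ 2 * (poisson E α X y₀ * poisson E α X' y) +
            K ^ 2 * (poisson E α X' y * poisson E α X y) := by ring
      _ ≤ K ^ 2 * (2 ^ e * ((ρ / d) ^ e * (d ^ (n : ℝ))⁻¹) * poisson E α X' y) +
            K ^ 2 * (4 ^ ((n : ℝ) + α) * Q * poisson E α X y) := by gcongr
      _ = K ^ 2 * (2 ^ e * ((ρ / d) ^ e * (d ^ (n : ℝ))⁻¹ * poisson E α X' y)) +
            K ^ 2 * (4 ^ ((n : ℝ) + α) * Q * poisson E α X y) := by ring
      _ ≤ K ^ 2 * (2 ^ e * (2 ^ e * Q * poisson E e X' y)) +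
            K ^ 2 * (4 ^ ((n : ℝ) + α) * Q * poisson E α X y) := by gcongr
      _ = K ^ 2 * (2 ^ e * 2 ^ e) * Q * poisson E e X' y +
            K ^ 2 * 4 ^ ((n : ℝ) + α) * Q * poisson E α X y := by ring
      _ ≤ K ^ 2 * 4 ^ ((n : ℝ) + α) * Q * poisson E e X' y +
            K ^ 2 * 4 ^ ((n : ℝ) + α) * Q * poisson E α X y := by gcongr
      _ = _ := by ring

/-- All three quantities in the maximum of `gramBound` are at most `2|X - y₀|`. The numerator is
symmetrized using `δ(X') ≤ δ(X)`, which halves the exponent once more and is the origin of `α / 4`.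
-/
theorem delta_rpow_div_le_gramBound (hα : 0 < α) {X X' y₀ : Space n} (hX : 0 < delta E X)
    (hX' : 0 < delta E X') (hy₀ : y₀ ∈ E)
    (hXy₀ : dist X' y₀ = delta E X') (hle : delta E X' ≤ delta E X) :
    delta E X' ^ (α / 2) / dist X y₀ ^ ((n : ℝ) + α / 2) ≤
      2 ^ ((n : ℝ) + α / 2) * gramBound E (α / 4) X X' := by
  have h1 : delta E X ≤ dist X y₀ := delta_le_dist hy₀ X
  have hd0 := hX.trans_le h1
  have hm : max (max (delta E X) (delta E X')) (dist X X') ≤ 2 * dist X y₀ := by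
    refine max_le (max_le ?_ ?_) ?_
    · linarith
    · linarith
    · have := dist_triangle X y₀ X'
      rw [dist_comm y₀ X', hXy₀] at this
      linarith
  have hm0 : 0 < max (max (delta E X) (delta E X')) (dist X X') :=
    hX.trans_le ((le_max_left _ _).trans (le_max_left _ _))
  rw [gramBound, show 2 * (α / 4) = α / 2 by ring, ← mul_div_assoc,
    div_le_div_iff₀ (by positivity) (by positivity)]
  have e1 : delta E X' ^ (α / 2) ≤ (delta E X * delta E X') ^ (α / 4) := by
    rw [Real.mul_rpow hX.le hX'.le, show α / 2 = α / 4 + α / 4 by ring, Real.rpow_add hX']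
    gcongr
  have e2 : max (max (delta E X) (delta E X')) (dist X X') ^ ((n : ℝ) + α / 2) ≤
      2 ^ ((n : ℝ) + α / 2) * dist X y₀ ^ ((n : ℝ) + α / 2) := by
    rw [← Real.mul_rpow (by norm_num) hd0.le]
    exact Real.rpow_le_rpow hm0.le hm (by positivity)
  calc _ ≤ (delta E X * delta E X') ^ (α / 4) *
        (2 ^ ((n : ℝ) + α / 2) * dist X y₀ ^ ((n : ℝ) + α / 2)) := by gcongr
    _ = _ := by ring

end Kernel

theorem exists_pairing_bound (n : ℕ) {G α K : ℝ} (hG : 0 ≤ G) (hα : 0 < α) (hK : 0 ≤ K) :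
    ∃ C : ℝ≥0, ∀ E : Set (Space n), IsClosed E → E.Nonempty → HasGrowth n G (surface E) →
      ∀ r : Space n → Space n → ℂ, IsKernel α K E r →
        (∀ X ∈ Eᶜ, ∫ y, r X y ∂surface E = 0) → ∀ X ∈ Eᶜ, ∀ X' ∈ Eᶜ,
          ‖∫ y, r X y * starRingEnd ℂ (r X' y) ∂surface E‖ₑ ≤
            C * ENNReal.ofReal (gramBound E (α / 4) X X') := by
  obtain ⟨C₁, hC₁⟩ := exists_poisson_bound n hG hα
  obtain ⟨C₂, hC₂⟩ := exists_poisson_bound n hG (half_pos hα)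
  set c : ℝ := K ^ 2 * 4 ^ ((n : ℝ) + α) * 2 ^ ((n : ℝ) + α / 2) with hc
  have hc0 : 0 ≤ c := by positivity
  refine ⟨c.toNNReal * (C₂ + C₁), fun E hE hne hg r hr hr0 X hX X' hX' => ?_⟩
  wlog hle : delta E X' ≤ delta E X generalizing X X'
  · have := this X' hX' X hX (le_of_not_ge hle)
    rw [gramBound_comm]
    refine le_trans (le_of_eq ?_) this
    rw [← RCLike.enorm_conj (K := ℂ), ← integral_conj]
    congr 2
    ext y
    rw [map_mul, starRingEnd_self_apply, mul_comm]
  obtain ⟨y₀, hy₀, hXy₀⟩ := exists_dist_eq_delta hE hne X'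
  have hi : Integrable (fun y => r X y * starRingEnd ℂ (r X' y)) (surface E) :=
    (hr.memLp hE hα hK hG hg hX).integrable_mul (hr.memLp hE hα hK hG hg hX').star
  have hi' : Integrable (fun y => starRingEnd ℂ (r X' y)) (surface E) :=
    (Complex.conjCLE : ℂ →L[ℝ] ℂ).integrable_comp (hr.integrable hE hα hK hG hg hX')
  -- The cancellation: as `r(X', ·)` has integral zero, the constant `r(X, y₀)` may be subtracted
  -- from the other factor.
  have heq : ∫ y, r X y * starRingEnd ℂ (r X' y) ∂surface E =
      ∫ y, (r X y - r X y₀) * starRingEnd ℂ (r X' y) ∂surface E := by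
    simp_rw [sub_mul]
    rw [integral_sub hi (hi'.const_mul _), integral_const_mul, integral_conj, hr0 X' hX', map_zero,
      mul_zero, sub_zero]
  set g := gramBound E (α / 4) X X' with hgdef
  have hg0 : 0 ≤ g := by
    have := delta_nonneg E X; have := delta_nonneg E X'
    rw [hgdef, gramBound]; positivity
  have hP : Measurable fun y => ENNReal.ofReal (poisson E (α / 2) X' y) :=
    ((measurable_poisson E (α / 2)).comp (measurable_prodMk_left (x := X'))).ennreal_ofReal
  calc _ ≤ ∫⁻ y, ‖(r X y - r X y₀) * starRingEnd ℂ (r X' y)‖ₑ ∂surface E := by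
        rw [heq]; exact enorm_integral_le_lintegral_enorm _
    _ ≤ ∫⁻ y, ENNReal.ofReal (c * g) * (ENNReal.ofReal (poisson E (α / 2) X' y) +
          ENNReal.ofReal (poisson E α X y)) ∂surface E := by
        refine lintegral_mono_ae ?_
        filter_upwards [ae_mem_surface hE] with y hy
        have hpn := poisson_nonneg E (α / 2) X' y
        have hpn' := poisson_nonneg E α X y
        rw [← ENNReal.ofReal_add hpn hpn', ← ENNReal.ofReal_mul (by positivity), ← ofReal_norm,
          norm_mul, RCLike.norm_conj]
        refine ENNReal.ofReal_le_ofReal ?_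
        refine (hr.norm_sub_mul_norm_le hE hα hK hX hX' hy hy₀ hXy₀ hle).trans ?_
        have := delta_rpow_div_le_gramBound hα (delta_pos hE hne hX) (delta_pos hE hne hX') hy₀
          hXy₀ hle
        calc _ ≤ K ^ 2 * 4 ^ ((n : ℝ) + α) * (2 ^ ((n : ℝ) + α / 2) * g) *
              (poisson E (α / 2) X' y + poisson E α X y) := by gcongr
          _ = _ := by rw [hc]; ring
    _ = ENNReal.ofReal (c * g) * (∫⁻ y, ENNReal.ofReal (poisson E (α / 2) X' y) ∂surface E +
          ∫⁻ y, ENNReal.ofReal (poisson E α X y) ∂surface E) := by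
        rw [lintegral_const_mul' _ _ ENNReal.ofReal_ne_top, lintegral_add_left hP]
    _ ≤ ENNReal.ofReal (c * g) * (C₂ + C₁) := by
        gcongr
        · exact hC₂ E hE hg X' hX'
        · exact hC₁ E hE hg X hX
    _ = _ := by
        rw [ENNReal.ofReal_mul hc0]; push_cast; rw [ENNReal.ofReal]; ring

/-! ### The near measure and cancellative square functions. -/

/-- The measure `dX / δ(X)` on the part of the complement of `E` near `E`. -/
noncomputable def nearMeasure (E : Set (Space n)) : Measure (Space n) :=
  (volume.restrict (nearRegion E)).withDensity fun X => (ENNReal.ofReal (delta E X))⁻¹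

instance (E : Set (Space n)) : SFinite (nearMeasure E) := by
  unfold nearMeasure; infer_instance

theorem nearMeasure_absolutelyContinuous (E : Set (Space n)) :
    nearMeasure E ≪ volume.restrict (nearRegion E) :=
  withDensity_absolutelyContinuous _ _

theorem ae_mem_nearRegion {E : Set (Space n)} (hE : IsClosed E) :
    ∀ᵐ X ∂nearMeasure E, X ∈ nearRegion E :=
  (nearMeasure_absolutelyContinuous E).ae_le (ae_restrict_mem (measurableSet_nearRegion hE))

/-- The density is finite because `δ > 0` on the near region, so `g` need not be measurable. -/
theorem lintegral_nearMeasure {E : Set (Space n)} (hE : IsClosed E) (hne : E.Nonempty)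
    (g : Space n → ℝ≥0∞) :
    ∫⁻ X, g X ∂nearMeasure E = ∫⁻ X in nearRegion E, g X / ENNReal.ofReal (delta E X) := by
  rw [nearMeasure, lintegral_withDensity_eq_lintegral_mul_non_measurable]
  · refine lintegral_congr fun X => ?_
    rw [Pi.mul_apply, mul_comm, div_eq_mul_inv]
  · exact (measurable_delta E).ennreal_ofReal.inv
  · filter_upwards [ae_restrict_mem (measurableSet_nearRegion hE)] with X hX
    simp [delta_pos hE hne hX.1]

theorem IsKernel.aestronglyMeasurable_theta {α K : ℝ} {E : Set (Space n)}
    {ψ : Space n → Space n → ℂ} [SFinite (surface E)] (h : IsKernel α K E ψ) {f : Space n → ℂ}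
    (hf : AEStronglyMeasurable f (surface E)) :
    AEStronglyMeasurable (theta E ψ f) (volume.restrict Eᶜ) := by
  have : AEStronglyMeasurable (fun p : Space n × Space n => ψ p.1 p.2 * f p.2)
      ((volume.restrict Eᶜ).prod (surface E)) := h.measurable.mul hf.comp_snd
  exact this.integral_prod_right'

theorem IsKernel.aestronglyMeasurable_theta_nearMeasure {α K : ℝ} {E : Set (Space n)}
    {ψ : Space n → Space n → ℂ} [SFinite (surface E)] (h : IsKernel α K E ψ) {f : Space n → ℂ}
    (hf : AEStronglyMeasurable f (surface E)) :
    AEStronglyMeasurable (theta E ψ f) (nearMeasure E) :=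
  (h.aestronglyMeasurable_theta hf).mono_ac ((nearMeasure_absolutelyContinuous E).trans
    (Measure.restrict_mono (fun _ hX => hX.1) le_rfl).absolutelyContinuous)

/-- A square function whose kernel has vanishing integrals is bounded on `L²`. -/
theorem exists_cancellative_bound (n : ℕ) {A G α K : ℝ} (hA : 0 < A) (hG : 0 ≤ G) (hα : 0 < α)
    (hK : 0 ≤ K) :
    ∃ C : ℝ≥0, ∀ E : Set (Space n), IsADR A E → E.Nonempty → HasGrowth n G (surface E) →
      ∀ r : Space n → Space n → ℂ, IsKernel α K E r →
        (∀ X ∈ Eᶜ, ∫ y, r X y ∂surface E = 0) → ∀ f : Space n → ℂ, MemLp f 2 (surface E) →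
          ∫⁻ X, ‖theta E r f X‖ₑ ^ 2 ∂nearMeasure E ≤ C * ∫⁻ y, ‖f y‖ₑ ^ 2 ∂surface E := by
  obtain ⟨C₁, hC₁⟩ := exists_schur_bound n hA hG (γ := α / 4) (by positivity)
  obtain ⟨C₂, hC₂⟩ := exists_pairing_bound n hG hα hK
  refine ⟨C₂ * C₁, fun E hADR hne hg r hr hr0 f hf => ?_⟩
  have hE := hADR.isClosed
  have := hg.isLocallyFiniteMeasure
  classical
  -- The inner product is conjugate-linear in its first argument, so the vectors are the conjugated
  -- kernels and `⟪v X, h⟫` is `Θh(X)` for the kernel `r`.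
  have hL : ∀ X ∈ Eᶜ, MemLp (fun y => starRingEnd ℂ (r X y)) 2 (surface E) := fun X hX =>
    (hr.memLp hE hα hK hG hg hX).star
  set v : Space n → Lp ℂ 2 (surface E) := fun X => if hX : X ∈ Eᶜ then (hL X hX).toLp else 0 with hv
  have hvX : ∀ X (hX : X ∈ Eᶜ), v X =ᵐ[surface E] fun y => starRingEnd ℂ (r X y) := by
    intro X hX
    simp only [hv, dif_pos hX]
    exact (hL X hX).coeFn_toLp
  have hinner : ∀ X ∈ Eᶜ, ∀ h : Lp ℂ 2 (surface E), ⟪v X, h⟫_ℂ = theta E r h X := by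
    intro X hX h
    rw [L2.inner_def, theta]
    refine integral_congr_ae ?_
    filter_upwards [hvX X hX] with y hy
    rw [hy, RCLike.inner_apply, starRingEnd_self_apply, mul_comm]
  have hvv : ∀ X ∈ Eᶜ, ∀ X' ∈ Eᶜ, ‖⟪v X, v X'⟫_ℂ‖ₑ ≤
      C₂ * ENNReal.ofReal (gramBound E (α / 4) X X') := by
    intro X hX X' hX'
    rw [hinner X hX]
    refine le_trans (le_of_eq ?_) (hC₂ E hE hne hg r hr hr0 X hX X' hX')
    rw [theta]
    congr 1
    refine integral_congr_ae ?_
    filter_upwards [hvX X' hX'] with y hy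
    rw [hy]
  have hae := ae_mem_nearRegion hE
  have hdelta := measurable_delta E
  -- Staying away from `E` and from infinity makes the near measure finite and `v` bounded, as the
  -- Bessel inequality requires.
  set S : ℕ → Set (Space n) := fun N =>
    {X | X ∈ nearRegion E ∧ ((N : ℝ) + 1)⁻¹ ≤ delta E X ∧ dist X 0 ≤ N} with hS
  have hSm : ∀ N, MeasurableSet (S N) := fun N =>
    (measurableSet_nearRegion hE).inter ((measurableSet_le measurable_const hdelta).inter
      (measurableSet_le (measurable_id.dist measurable_const) measurable_const))
  have key := lintegral_inner_sq_le (μ := nearMeasure E) v (fun h => ?_)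
    (fun X X' => C₂ * ENNReal.ofReal (gramBound E (α / 4) X X'))
    (((measurable_gramBound E (α / 4)).ennreal_ofReal).const_mul _)
    (fun X X' => by rw [gramBound_comm]) ?_ (C := C₂ * C₁) ?_ S hSm ?_ ?_ ?_ ?_ (hf.toLp f)
  · have e1 : ‖hf.toLp f‖ₑ ^ 2 = ∫⁻ y, ‖f y‖ₑ ^ 2 ∂surface E := by
      rw [Lp.enorm_toLp, eLpNorm_eq_lintegral_rpow_enorm_toReal two_ne_zero ENNReal.ofNat_ne_top,
        ← ENNReal.rpow_natCast, ← ENNReal.rpow_mul]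
      simp
    rw [e1] at key
    refine le_trans (le_of_eq ?_) key
    refine lintegral_congr_ae ?_
    filter_upwards [hae] with X hX
    rw [hinner X hX.1, theta, theta]
    congr 2
    refine integral_congr_ae ?_
    filter_upwards [hf.coeFn_toLp] with y hy
    rw [hy]
  · refine (hr.aestronglyMeasurable_theta_nearMeasure (Lp.aestronglyMeasurable h)).congr ?_
    filter_upwards [hae] with X hX
    rw [hinner X hX.1]
  · filter_upwards [hae] with X hX
    filter_upwards [hae] with X' hX'
    exact hvv X hX.1 X' hX'.1
  · filter_upwards [hae] with X hX
    rw [lintegral_const_mul' _ _ ENNReal.coe_ne_top, lintegral_nearMeasure hE hne]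
    push_cast
    gcongr
    simp_rw [div_eq_mul_inv]
    exact hC₁ E hADR hg hne X hX.1
  · intro N M hNM X hX
    have : (N : ℝ) ≤ M := by exact_mod_cast hNM
    refine ⟨hX.1, le_trans ?_ hX.2.1, hX.2.2.trans this⟩
    gcongr
  · intro N
    rw [nearMeasure, withDensity_apply _ (hSm N)]
    calc _ ≤ ∫⁻ X in S N, ENNReal.ofReal ((N : ℝ) + 1) ∂volume.restrict (nearRegion E) := by
          refine setLIntegral_mono' (hSm N) fun X hX => ?_
          have hp : (0 : ℝ) < (N : ℝ) + 1 := by positivity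
          rw [← ENNReal.ofReal_inv_of_pos ((inv_pos.2 hp).trans_le hX.2.1)]
          exact ENNReal.ofReal_le_ofReal (inv_le_of_inv_le₀ hp hX.2.1)
      _ = ENNReal.ofReal ((N : ℝ) + 1) * volume.restrict (nearRegion E) (S N) := by
          rw [lintegral_const, Measure.restrict_apply_univ]
      _ ≤ ENNReal.ofReal ((N : ℝ) + 1) * volume (Metric.closedBall (0 : Space n) N) := by
          refine mul_le_mul_right ?_ _
          exact (Measure.restrict_apply_le _ _).trans (measure_mono fun X hX => hX.2.2)
      _ < ⊤ := ENNReal.mul_lt_top ENNReal.ofReal_lt_top measure_closedBall_lt_top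
  · intro N
    -- On the diagonal the Gram bound is `δ(X)⁻ⁿ ≤ (N + 1)ⁿ`, which bounds `‖v X‖²`; the added 1
    -- accounts for `s ≤ s² + 1`.
    refine ⟨C₂ * ((N : ℝ) + 1) ^ n + 1, fun X hX => ?_⟩
    have hδ := delta_pos hE hne hX.1.1
    have h1 := hvv X hX.1.1 X hX.1.1
    have h2 : gramBound E (α / 4) X X ≤ ((N : ℝ) + 1) ^ n := by
      rw [gramBound, max_self, dist_self, max_eq_left hδ.le, Real.mul_rpow hδ.le hδ.le, two_mul,
        ← add_assoc, Real.rpow_add hδ, Real.rpow_add hδ, mul_assoc, div_mul_cancel_right₀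
        (by positivity), Real.rpow_natCast, ← inv_pow]
      exact pow_le_pow_left₀ (by positivity) (inv_le_of_inv_le₀ (by positivity) hX.2.1) _
    have h3 : ‖v X‖ ^ 2 ≤ C₂ * ((N : ℝ) + 1) ^ n := by
      have h4 : ‖⟪v X, v X⟫_ℂ‖ = ‖v X‖ ^ 2 := by
        rw [← inner_self_re_eq_norm, inner_self_eq_norm_sq]
      rw [← ofReal_norm, h4] at h1
      have h5 : ENNReal.ofReal (‖v X‖ ^ 2) ≤ ENNReal.ofReal (C₂ * ((N : ℝ) + 1) ^ n) := by
        refine h1.trans ?_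
        rw [ENNReal.ofReal_mul C₂.coe_nonneg, ENNReal.ofReal_coe_nnreal]
        gcongr
      exact (ENNReal.ofReal_le_ofReal_iff (by positivity)).1 h5
    nlinarith [norm_nonneg (v X), sq_nonneg (‖v X‖ - 1)]
  · filter_upwards [hae] with X hX
    have hδ := delta_pos hE hne hX.1
    obtain ⟨N, hN⟩ := exists_nat_ge (max (delta E X)⁻¹ (dist X 0))
    refine mem_iUnion.2 ⟨N, hX, ?_, (le_max_right _ _).trans hN⟩
    rw [inv_le_comm₀ (by positivity) hδ]
    linarith [(le_max_left _ _).trans hN]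

/-! ### Smooth averages and the cancellative remainder. -/

/-- A Lipschitz bump in the variable `y`, at distance at most `3 δ(X)` from `X`. -/
noncomputable def bump (E : Set (Space n)) (X y : Space n) : ℝ := max 0 (3 * delta E X - dist X y)

theorem bump_nonneg (E : Set (Space n)) (X y : Space n) : 0 ≤ bump E X y := le_max_left _ _

theorem bump_le (E : Set (Space n)) (X y : Space n) : bump E X y ≤ 3 * delta E X :=
  max_le (by linarith [delta_nonneg E X]) (by linarith [dist_nonneg (x := X) (y := y)])

theorem bump_eq_zero {E : Set (Space n)} {X y : Space n} (h : 3 * delta E X ≤ dist X y) :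
    bump E X y = 0 := max_eq_left (by linarith)

theorem abs_bump_sub_le (E : Set (Space n)) (X y y' : Space n) :
    |bump E X y - bump E X y'| ≤ dist y y' := by
  refine (abs_max_sub_max_le_max _ _ _ _).trans ?_
  rw [sub_self, abs_zero, max_eq_right (abs_nonneg _)]
  have : 3 * delta E X - dist X y - (3 * delta E X - dist X y') = dist X y' - dist X y := by ring
  rw [this, dist_comm X, dist_comm X, dist_comm y y']
  exact abs_dist_sub_le _ _ _

theorem continuous_bump (E : Set (Space n)) :
    Continuous fun p : Space n × Space n => bump E p.1 p.2 := by
  have := continuous_delta E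
  unfold bump
  fun_prop

theorem continuous_bump_right (E : Set (Space n)) (X : Space n) : Continuous (bump E X) := by
  have : Continuous fun y => max 0 (3 * delta E X - dist X y) := by fun_prop
  exact this

theorem integrable_bump {E : Set (Space n)} [IsLocallyFiniteMeasure (surface E)] (X : Space n) :
    Integrable (bump E X) (surface E) := by
  refine (continuous_bump_right E X).integrable_of_hasCompactSupport ?_
  refine HasCompactSupport.intro (isCompact_closedBall X (3 * delta E X)) fun y hy => ?_
  refine bump_eq_zero ?_
  rw [dist_comm]
  exact (not_le.1 hy).le

/-- The normalized bump. -/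
noncomputable def smoothAvg (E : Set (Space n)) (X y : Space n) : ℝ :=
  bump E X y / ∫ z, bump E X z ∂surface E

theorem smoothAvg_nonneg (E : Set (Space n)) (X y : Space n) : 0 ≤ smoothAvg E X y :=
  div_nonneg (bump_nonneg E X y) (integral_nonneg fun z => bump_nonneg E X z)

/-- The bump is at least `δ(X)` on `B(X, 2δ(X))`, whose mass is bounded below by regularity. The
radius 3 in `bump` leaves this margin. -/
theorem IsADR.le_integral_bump {A : ℝ} {E : Set (Space n)} [IsLocallyFiniteMeasure (surface E)]
    (h : IsADR A E) (hne : E.Nonempty) {X : Space n} (hX : X ∈ nearRegion E) :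
    A⁻¹ * delta E X ^ (n + 1) ≤ ∫ z, bump E X z ∂surface E := by
  have hδ := delta_pos h.isClosed hne hX.1
  have hfin : surface E (Metric.ball X (2 * delta E X)) < ⊤ := measure_ball_lt_top
  have h1 : A⁻¹ * delta E X ^ n ≤ (surface E).real (Metric.ball X (2 * delta E X)) := by
    have := h.le_surface_ball hne hX
    exact (ENNReal.ofReal_le_iff_le_toReal hfin.ne).1 this
  calc A⁻¹ * delta E X ^ (n + 1) = A⁻¹ * delta E X ^ n * delta E X := by ring
    _ ≤ (surface E).real (Metric.ball X (2 * delta E X)) * delta E X := by gcongr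
    _ = ∫ z in Metric.ball X (2 * delta E X), delta E X ∂surface E := by
        rw [setIntegral_const, smul_eq_mul]
    _ ≤ ∫ z in Metric.ball X (2 * delta E X), bump E X z ∂surface E := by
        refine setIntegral_mono_on (integrableOn_const hfin.ne) (integrable_bump X).integrableOn
          Metric.isOpen_ball.measurableSet fun z hz => ?_
        refine le_trans ?_ (le_max_right _ _)
        rw [Metric.mem_ball, dist_comm] at hz
        linarith
    _ ≤ _ := setIntegral_le_integral (integrable_bump X)
        (Filter.Eventually.of_forall fun z => bump_nonneg E X z)

section

variable {A : ℝ} {E : Set (Space n)} [IsLocallyFiniteMeasure (surface E)]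

theorem measurable_smoothAvg : Measurable fun p : Space n × Space n => smoothAvg E p.1 p.2 := by
  have h1 := (continuous_bump E).measurable
  have h2 : StronglyMeasurable fun X => ∫ z, bump E X z ∂surface E :=
    (continuous_bump E).stronglyMeasurable.integral_prod_right'
  exact h1.div (h2.measurable.comp measurable_fst)

theorem IsADR.smoothAvg_le (hA : 0 < A) (h : IsADR A E) (hne : E.Nonempty) {X : Space n}
    (hX : X ∈ nearRegion E) (y : Space n) : smoothAvg E X y ≤ 3 * A * (delta E X ^ n)⁻¹ := by
  have hδ := delta_pos h.isClosed hne hX.1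
  have h1 := h.le_integral_bump hne hX
  have h2 : 0 < A⁻¹ * delta E X ^ (n + 1) := by positivity
  calc smoothAvg E X y ≤ 3 * delta E X / (A⁻¹ * delta E X ^ (n + 1)) :=
        div_le_div₀ (by positivity) (bump_le E X y) h2 h1
    _ = _ := by field_simp; ring

/-- Where the average does not vanish, `|X - y| < 3δ(X)`, and there the Poisson-like kernel is at
least a multiple of `δ(X)⁻ⁿ`. -/
theorem IsADR.smoothAvg_le_poisson (hA : 0 < A) (h : IsADR A E) {α : ℝ} (hα : 0 < α)
    {X y : Space n} (hX : X ∈ nearRegion E) (hy : y ∈ E) :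
    smoothAvg E X y ≤ 3 * A * 3 ^ ((n : ℝ) + α) * poisson E α X y := by
  have hδ := delta_pos h.isClosed ⟨y, hy⟩ hX.1
  have hd : 0 < dist X y := hδ.trans_le (delta_le_dist hy X)
  rcases le_or_gt (3 * delta E X) (dist X y) with hc | hc
  · rw [smoothAvg, bump_eq_zero hc, zero_div]
    have := poisson_nonneg E α X y
    positivity
  · refine (h.smoothAvg_le hA ⟨y, hy⟩ hX y).trans ?_
    rw [mul_assoc (3 * A)]
    refine mul_le_mul_of_nonneg_left ?_ (by positivity)
    rw [poisson, ← mul_div_assoc, le_div_iff₀ (by positivity)]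
    calc _ ≤ (delta E X ^ n)⁻¹ * (3 * delta E X) ^ ((n : ℝ) + α) := by gcongr
      _ = _ := by
          rw [Real.mul_rpow (by norm_num) hδ.le, Real.rpow_add hδ, Real.rpow_natCast]
          field_simp

/-- If `|X - y| ≥ 6δ(X)`, then `|X - y'| ≥ 3δ(X)` and both values vanish. Otherwise `δ(X)` exceeds
`|X - y| / 6` and the Lipschitz bound of the bump applies; `α ≤ 1` is what lets a Lipschitz bound
imply the Hölder bound. -/
theorem IsADR.abs_smoothAvg_sub_le (hA : 0 < A) (h : IsADR A E) {α : ℝ} (hα : 0 < α) (hα1 : α ≤ 1)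
    {X y y' : Space n} (hX : X ∈ nearRegion E) (hy : y ∈ E) (hyy : 2 * dist y y' ≤ dist X y) :
    |smoothAvg E X y - smoothAvg E X y'| ≤
      A * 6 ^ (n + 1) * (dist y y' ^ α / dist X y ^ ((n : ℝ) + α)) := by
  have hδ := delta_pos h.isClosed ⟨y, hy⟩ hX.1
  have hd : 0 < dist X y := hδ.trans_le (delta_le_dist hy X)
  rcases le_or_gt (6 * delta E X) (dist X y) with hc | hc
  · have h1 : 3 * delta E X ≤ dist X y' := by
      have := dist_triangle X y' y
      rw [dist_comm y' y] at this
      linarith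
    rw [smoothAvg, smoothAvg, bump_eq_zero h1, bump_eq_zero (by linarith), zero_div, sub_self,
      abs_zero]
    positivity
  · have h1 := h.le_integral_bump ⟨y, hy⟩ hX
    have h2 : 0 < A⁻¹ * delta E X ^ (n + 1) := by positivity
    set t := dist y y' / dist X y with ht
    have ht0 : 0 ≤ t := by positivity
    have ht1 : t ≤ 1 := (div_le_one hd).2 (by linarith [dist_nonneg (x := y) (y := y')])
    have htα : t ≤ t ^ α := by
      conv_lhs => rw [← Real.rpow_one t]
      exact Real.rpow_le_rpow_of_exponent_ge' ht0 ht1 hα.le hα1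
    have hform : dist y y' ^ α / dist X y ^ ((n : ℝ) + α) = t ^ α / dist X y ^ n := by
      rw [ht, Real.div_rpow dist_nonneg hd.le, Real.rpow_add hd, Real.rpow_natCast]
      field_simp
    have h6 : (dist X y / 6) ^ (n + 1) ≤ delta E X ^ (n + 1) := by gcongr; linarith
    rw [smoothAvg, smoothAvg, ← sub_div, abs_div, abs_of_pos (h2.trans_le h1), hform]
    calc _ ≤ dist y y' / (A⁻¹ * delta E X ^ (n + 1)) :=
          div_le_div₀ dist_nonneg (abs_bump_sub_le E X y y') h2 h1
      _ ≤ dist y y' / (A⁻¹ * (dist X y / 6) ^ (n + 1)) := by gcongr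
      _ = A * 6 ^ (n + 1) * (t / dist X y ^ n) := by rw [ht, div_pow]; field_simp; ring
      _ ≤ _ := by gcongr

open Classical in
/-- The kernel of `Θ - Θ1 · S` on the near region, where `S` is the smooth averaging operator. -/
noncomputable def cancelKernel (E : Set (Space n)) (ψ : Space n → Space n → ℂ) (X y : Space n) : ℂ :=
  if X ∈ nearRegion E then ψ X y - theta E ψ (fun _ => 1) X * smoothAvg E X y else 0

/-- A bounded multiple of the averaging kernel, which itself has size and Hölder bounds, is
subtracted. Outside the near region the averages lack a lower bound on their normalization; the
value zero there keeps the conditions trivially. -/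
theorem IsKernel.cancelKernel {α K B : ℝ} {ψ : Space n → Space n → ℂ} (h : IsKernel α K E ψ)
    (hADR : IsADR A E) (hA : 0 < A) (hα : 0 < α) (hα1 : α ≤ 1) (hK : 0 ≤ K) (hB : 0 ≤ B)
    (hΘ : ∀ X ∈ Eᶜ, ‖theta E ψ (fun _ => 1) X‖ ≤ B) :
    IsKernel α (K + B * (3 * A * 3 ^ ((n : ℝ) + α) + A * 6 ^ (n + 1))) E (cancelKernel E ψ) := by
  have hE := hADR.isClosed
  refine ⟨?_, fun X hX y hy => ?_, fun X hX y hy y' hy' hyy => ?_⟩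
  · have hm : AEStronglyMeasurable (fun p : Space n × Space n =>
        ψ p.1 p.2 - theta E ψ (fun _ => 1) p.1 * smoothAvg E p.1 p.2)
        ((volume.restrict Eᶜ).prod (surface E)) := by
      refine h.measurable.sub (AEStronglyMeasurable.mul ?_ ?_)
      · exact (h.aestronglyMeasurable_theta aestronglyMeasurable_const).comp_fst
      · exact (Complex.measurable_ofReal.comp measurable_smoothAvg).aestronglyMeasurable
    have := hm.indicator ((measurableSet_nearRegion hE).prod (MeasurableSet.univ (α := Space n)))
    refine this.congr (Filter.Eventually.of_forall fun p => ?_)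
    change _ = SquareFunction.cancelKernel E ψ p.1 p.2
    by_cases hp : p.1 ∈ nearRegion E
    · rw [indicator_of_mem (mk_mem_prod hp (mem_univ p.2)), SquareFunction.cancelKernel, if_pos hp]
    · rw [indicator_of_notMem (fun hp' => hp hp'.1), SquareFunction.cancelKernel, if_neg hp]
  · have hP := poisson_nonneg E α X y
    change _ ≤ _ * poisson E α X y
    rw [SquareFunction.cancelKernel]
    split_ifs with hN
    · refine (norm_sub_le _ _).trans ?_
      rw [norm_mul, Complex.norm_real, Real.norm_of_nonneg (smoothAvg_nonneg E X y)]
      have h1 : ‖ψ X y‖ ≤ K * poisson E α X y := h.size X hX y hy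
      calc _ ≤ K * poisson E α X y + B * (3 * A * 3 ^ ((n : ℝ) + α) * poisson E α X y) :=
            add_le_add h1 (mul_le_mul (hΘ X hX) (hADR.smoothAvg_le_poisson hA hα hN hy)
              (smoothAvg_nonneg E X y) hB)
        _ ≤ K * poisson E α X y + B * (3 * A * 3 ^ ((n : ℝ) + α) * poisson E α X y) +
              B * (A * 6 ^ (n + 1)) * poisson E α X y := le_add_of_nonneg_right (by positivity)
        _ = _ := by ring
    · rw [norm_zero]; positivity
  · set q := dist y y' ^ α / dist X y ^ ((n : ℝ) + α) with hq
    have hq0 : 0 ≤ q := by positivity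
    rw [SquareFunction.cancelKernel, SquareFunction.cancelKernel]
    split_ifs with hN
    · have e : ψ X y - theta E ψ (fun _ => 1) X * smoothAvg E X y -
          (ψ X y' - theta E ψ (fun _ => 1) X * smoothAvg E X y') =
          (ψ X y - ψ X y') - theta E ψ (fun _ => 1) X *
            ((smoothAvg E X y - smoothAvg E X y' : ℝ) : ℂ) := by push_cast; ring
      rw [e]
      refine (norm_sub_le _ _).trans ?_
      rw [norm_mul, Complex.norm_real, Real.norm_eq_abs]
      calc _ ≤ K * q + B * (A * 6 ^ (n + 1) * q) :=
            add_le_add (h.holder X hX y hy y' hy' hyy) (mul_le_mul (hΘ X hX)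
              (hADR.abs_smoothAvg_sub_le hA hα hα1 hN hy hyy) (abs_nonneg _) hB)
        _ ≤ K * q + B * (A * 6 ^ (n + 1) * q) + B * (3 * A * 3 ^ ((n : ℝ) + α)) * q :=
            le_add_of_nonneg_right (by positivity)
        _ = _ := by ring
    · rw [sub_self, norm_zero]; positivity

theorem integrable_smoothAvg (X : Space n) : Integrable (smoothAvg E X) (surface E) :=
  (integrable_bump X).div_const _

theorem IsADR.integral_smoothAvg (hA : 0 < A) (h : IsADR A E) (hne : E.Nonempty) {X : Space n}
    (hX : X ∈ nearRegion E) : ∫ y, smoothAvg E X y ∂surface E = 1 := by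
  have hδ := delta_pos h.isClosed hne hX.1
  have h1 := h.le_integral_bump hne hX
  have h2 : 0 < A⁻¹ * delta E X ^ (n + 1) := by positivity
  simp only [smoothAvg]
  rw [integral_div, div_self (h2.trans_le h1).ne']

/-- `ψ(X, ·)` has integral `Θ1(X)`, and the averaging kernel has integral 1. -/
theorem integral_cancelKernel {ψ : Space n → Space n → ℂ} (hADR : IsADR A E) (hA : 0 < A)
    (hne : E.Nonempty) {X : Space n} (hψ : Integrable (ψ X) (surface E)) :
    ∫ y, cancelKernel E ψ X y ∂surface E = 0 := by
  by_cases hN : X ∈ nearRegion E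
  · simp only [cancelKernel, if_pos hN]
    have h1 : Integrable (fun y => (smoothAvg E X y : ℂ)) (surface E) :=
      (integrable_smoothAvg X).ofReal
    rw [integral_sub hψ (h1.const_mul _), integral_const_mul, integral_complex_ofReal,
      hADR.integral_smoothAvg hA hne hN, theta]
    simp
  · simp [cancelKernel, hN]

end

/-! ### Carleson's embedding theorem. -/

/-- The average of `u` over the ball of radius `3 δ(X)` about `X`, up to normalization. -/
noncomputable def coneAvg (E : Set (Space n)) (u : Space n → ℝ≥0∞) (X : Space n) : ℝ≥0∞ :=
  (ENNReal.ofReal (delta E X ^ n))⁻¹ *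
    ∫⁻ y in Metric.ball X (3 * delta E X), u y ∂surface E

/-- The decomposition `Θf = Rf + Θ1 · Sf`, with `|Sf|` dominated by the rough average `coneAvg` of
`|f|`; the factor `3A` is the bound in `IsADR.smoothAvg_le`. -/
theorem enorm_theta_le {A : ℝ} {E : Set (Space n)} [IsLocallyFiniteMeasure (surface E)]
    {ψ : Space n → Space n → ℂ} (hADR : IsADR A E) (hA : 0 < A)
    (hne : E.Nonempty) {X : Space n} (hX : X ∈ nearRegion E) {f : Space n → ℂ}
    (hf : MemLp f 2 (surface E)) (hψ : MemLp (ψ X) 2 (surface E)) :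
    ‖theta E ψ f X‖ₑ ≤ ‖theta E (cancelKernel E ψ) f X‖ₑ +
      ENNReal.ofReal (3 * A) * (‖theta E ψ (fun _ => 1) X‖ₑ * coneAvg E (fun y => ‖f y‖ₑ) X) := by
  have hδ := delta_pos hADR.isClosed hne hX.1
  have hi : Integrable (fun y => ψ X y * f y) (surface E) := hψ.integrable_mul hf
  have hs : MemLp (fun y => (smoothAvg E X y : ℂ)) 2 (surface E) := by
    have hc : Continuous fun y => (smoothAvg E X y : ℂ) :=
      Complex.continuous_ofReal.comp ((continuous_bump_right E X).div_const _)
    refine hc.memLp_of_hasCompactSupport ?_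
    refine HasCompactSupport.intro (isCompact_closedBall X (3 * delta E X)) fun y hy => ?_
    rw [smoothAvg, bump_eq_zero, zero_div, Complex.ofReal_zero]
    rw [dist_comm]
    exact (not_le.1 hy).le
  have hi2 : Integrable (fun y => (smoothAvg E X y : ℂ) * f y) (surface E) := hs.integrable_mul hf
  have heq : theta E ψ f X = theta E (cancelKernel E ψ) f X +
      theta E ψ (fun _ => 1) X * ∫ y, (smoothAvg E X y : ℂ) * f y ∂surface E := by
    have : theta E (cancelKernel E ψ) f X = ∫ y, (ψ X y * f y -
        theta E ψ (fun _ => 1) X * ((smoothAvg E X y : ℂ) * f y)) ∂surface E := by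
      rw [theta]
      congr 1; ext y
      rw [cancelKernel, if_pos hX]; ring
    rw [this, integral_sub hi (hi2.const_mul _), integral_const_mul, sub_add_cancel]
    rfl
  have hS : ‖∫ y, (smoothAvg E X y : ℂ) * f y ∂surface E‖ₑ ≤
      ENNReal.ofReal (3 * A) * coneAvg E (fun y => ‖f y‖ₑ) X := by
    calc _ ≤ ∫⁻ y, ‖(smoothAvg E X y : ℂ) * f y‖ₑ ∂surface E := enorm_integral_le_lintegral_enorm _
      _ ≤ ∫⁻ y, indicator (Metric.ball X (3 * delta E X))
            (fun y => ENNReal.ofReal (3 * A * (delta E X ^ n)⁻¹) * ‖f y‖ₑ) y ∂surface E := by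
          refine lintegral_mono fun y => ?_
          simp only
          by_cases hy : y ∈ Metric.ball X (3 * delta E X)
          · rw [indicator_of_mem hy, enorm_mul]
            gcongr
            rw [← ofReal_norm, Complex.norm_real, Real.norm_of_nonneg (smoothAvg_nonneg E X y)]
            exact ENNReal.ofReal_le_ofReal (hADR.smoothAvg_le hA hne hX y)
          · rw [indicator_of_notMem hy, smoothAvg, bump_eq_zero]
            · simp
            · rw [dist_comm]; exact not_lt.1 hy
      _ = _ := by
          rw [lintegral_indicator Metric.isOpen_ball.measurableSet,
            lintegral_const_mul' _ _ ENNReal.ofReal_ne_top, ENNReal.ofReal_mul (by positivity),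
            ENNReal.ofReal_inv_of_pos (by positivity), mul_assoc, coneAvg]
  calc _ ≤ ‖theta E (cancelKernel E ψ) f X‖ₑ +
        ‖theta E ψ (fun _ => 1) X * ∫ y, (smoothAvg E X y : ℂ) * f y ∂surface E‖ₑ := by
        rw [heq]; exact enorm_add_le _ _
    _ ≤ ‖theta E (cancelKernel E ψ) f X‖ₑ + ‖theta E ψ (fun _ => 1) X‖ₑ *
        (ENNReal.ofReal (3 * A) * coneAvg E (fun y => ‖f y‖ₑ) X) := by
        rw [enorm_mul]; gcongr
    _ = _ := by ring

/-- A measure on the complement of `E` satisfying Carleson's condition with constant `c`. -/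
def IsCarleson (c : ℝ) (E : Set (Space n)) (ν : Measure (Space n)) : Prop :=
  ∀ x ∈ E, ∀ r : ℝ, 0 < r → ν (Metric.ball x r) ≤ ENNReal.ofReal (c * r ^ n)

theorem measurable_coneAvg {E : Set (Space n)} [SFinite (surface E)] {u : Space n → ℝ≥0∞}
    (hu : Measurable u) : Measurable (coneAvg E u) := by
  have hδ := measurable_delta E
  refine Measurable.mul (by fun_prop) ?_
  have hS : MeasurableSet {p : Space n × Space n | dist p.2 p.1 < 3 * delta E p.1} :=
    measurableSet_lt (by fun_prop) (by fun_prop)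
  have h := ((hu.comp measurable_snd).indicator hS).lintegral_prod_right' (ν := surface E)
  have he : (fun X => ∫⁻ y in Metric.ball X (3 * delta E X), u y ∂surface E) =
      fun X => ∫⁻ y, indicator {p : Space n × Space n | dist p.2 p.1 < 3 * delta E p.1}
        (u ∘ Prod.snd) (X, y) ∂surface E := by
    ext X
    rw [← lintegral_indicator Metric.isOpen_ball.measurableSet]
    rfl
  rw [he]
  exact h

/-- The weak type bound in Carleson's embedding theorem. -/
theorem IsCarleson.measure_coneAvg_gt_le (hn : 1 ≤ n) {c : ℝ} (hc : 0 ≤ c) {E : Set (Space n)}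
    (hE : IsClosed E) (hne : E.Nonempty) {ν : Measure (Space n)} (hν : IsCarleson c E ν)
    {u : Space n → ℝ≥0∞} (hu : ∫⁻ y, u y ∂surface E ≠ ⊤) {t : ℝ≥0∞} (ht0 : t ≠ 0) (ht : t ≠ ⊤) :
    ν {X | X ∈ Eᶜ ∧ t < coneAvg E u X} ≤
      ENNReal.ofReal (c * 17 ^ n) * (t⁻¹ * ∫⁻ y, u y ∂surface E) := by
  set P := {X | X ∈ Eᶜ ∧ t < coneAvg E u X} with hP
  have hpos : ∀ X ∈ P, 0 < delta E X := fun X hX => delta_pos hE hne hX.1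
  have hle : ∀ X ∈ P, ENNReal.ofReal (delta E X ^ n) ≤
      t⁻¹ * ∫⁻ y in Metric.ball X (3 * delta E X), u y ∂surface E := by
    intro X hX
    have h0 : ENNReal.ofReal (delta E X ^ n) ≠ 0 :=
      (ENNReal.ofReal_pos.2 (pow_pos (hpos X hX) n)).ne'
    rw [mul_comm, ← div_eq_mul_inv, ENNReal.le_div_iff_mul_le (Or.inl ht0) (Or.inl ht), mul_comm]
    have h1 := hX.2.le
    rw [coneAvg, mul_comm, ← div_eq_mul_inv,
      ENNReal.le_div_iff_mul_le (Or.inl h0) (Or.inl ENNReal.ofReal_ne_top)] at h1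
    exact h1
  set T := (t⁻¹ * ∫⁻ y, u y ∂surface E).toReal with hT
  have hTfin : t⁻¹ * ∫⁻ y, u y ∂surface E ≠ ⊤ :=
    ENNReal.mul_ne_top (ENNReal.inv_ne_top.2 ht0) hu
  -- Vitali's lemma needs bounded radii: on the level set `δ(X)ⁿ` is at most the finite `t⁻¹ ∫ u`,
  -- and `n ≥ 1` turns this into a bound for `δ(X)`.
  have hR : ∀ X ∈ P, 3 * delta E X ≤ 3 * (1 + T) := by
    intro X hX
    have h1 : delta E X ^ n ≤ T := by
      rw [hT, ← ENNReal.ofReal_le_iff_le_toReal hTfin]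
      refine (hle X hX).trans ?_
      gcongr
      exact Measure.restrict_le_self
    have h2 : 0 ≤ T := ENNReal.toReal_nonneg
    rcases le_total (delta E X) 1 with h | h
    · linarith
    · have := le_self_pow₀ h (by omega : n ≠ 0)
      linarith
  obtain ⟨Q, hQP, hdisj, hcov⟩ := Vitali.exists_disjoint_subfamily_covering_enlargement_closedBall
    P id (fun X => 3 * delta E X) _ hR 5 (by norm_num)
  simp only [id] at hdisj hcov
  have hQc : Q.Countable := by
    refine hdisj.countable_of_nonempty_interior fun X hX => ⟨X, ?_⟩
    refine mem_interior.2 ⟨Metric.ball X (3 * delta E X), Metric.ball_subset_closedBall,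
      Metric.isOpen_ball, Metric.mem_ball_self ?_⟩
    linarith [hpos X (hQP hX)]
  have hsub : P ⊆ ⋃ b ∈ Q, Metric.closedBall b (5 * (3 * delta E b)) := by
    intro X hX
    obtain ⟨b, hb, hXb⟩ := hcov X hX
    exact mem_iUnion₂.2 ⟨b, hb, hXb (Metric.mem_closedBall_self (by linarith [hpos X hX]))⟩
  -- The enlarged closed ball has radius `15δ(b)` and a nearest point of `E` is `δ(b)` away, so the
  -- open ball of radius `17δ(b)` about that point contains it.
  have hball : ∀ b ∈ Q, ν (Metric.closedBall b (5 * (3 * delta E b))) ≤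
      ENNReal.ofReal (c * 17 ^ n) *
        (t⁻¹ * ∫⁻ y in Metric.ball b (3 * delta E b), u y ∂surface E) := by
    intro b hb
    have hb0 := hpos b (hQP hb)
    obtain ⟨y, hy, hby⟩ := exists_dist_eq_delta hE hne b
    calc _ ≤ ν (Metric.ball y (17 * delta E b)) := by
          refine measure_mono fun z hz => ?_
          rw [Metric.mem_closedBall] at hz
          rw [Metric.mem_ball]
          linarith [dist_triangle z b y]
      _ ≤ ENNReal.ofReal (c * (17 * delta E b) ^ n) := hν y hy _ (by positivity)
      _ = ENNReal.ofReal (c * 17 ^ n) * ENNReal.ofReal (delta E b ^ n) := by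
          rw [← ENNReal.ofReal_mul (by positivity), mul_pow, mul_assoc]
      _ ≤ _ := by gcongr; exact hle b (hQP hb)
  have hdisj' : Q.PairwiseDisjoint fun b => Metric.ball b (3 * delta E b) :=
    hdisj.mono fun b => Metric.ball_subset_closedBall
  calc ν P ≤ ∑' b : Q, ν (Metric.closedBall (b : Space n) (5 * (3 * delta E b))) :=
        (measure_mono hsub).trans (measure_biUnion_le ν hQc _)
    _ ≤ ∑' b : Q, ENNReal.ofReal (c * 17 ^ n) *
        (t⁻¹ * ∫⁻ y in Metric.ball (b : Space n) (3 * delta E b), u y ∂surface E) :=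
        ENNReal.tsum_le_tsum fun b => hball b b.2
    _ = ENNReal.ofReal (c * 17 ^ n) * (t⁻¹ *
          ∫⁻ y in ⋃ b ∈ Q, Metric.ball b (3 * delta E b), u y ∂surface E) := by
        rw [ENNReal.tsum_mul_left, ENNReal.tsum_mul_left,
          lintegral_biUnion hQc (fun _ _ => Metric.isOpen_ball.measurableSet) hdisj']
    _ ≤ _ := by gcongr; exact Measure.restrict_le_self

/-- Carleson's embedding theorem. -/
theorem exists_carleson_embedding (hn : 1 ≤ n) {G c : ℝ} (hG : 0 ≤ G) (hc : 0 ≤ c) :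
    ∃ C : ℝ≥0, ∀ E : Set (Space n), IsClosed E → E.Nonempty → HasGrowth n G (surface E) →
      ∀ ν : Measure (Space n), IsCarleson c E ν → (∀ᵐ X ∂ν, X ∈ Eᶜ) →
        ∀ u : Space n → ℝ≥0∞, Measurable u → ∫⁻ y, u y ^ 2 ∂surface E ≠ ⊤ →
          ∫⁻ X, coneAvg E u X ^ 2 ∂ν ≤ C * ∫⁻ y, u y ^ 2 ∂surface E := by
  -- `G * 3 ^ n` bounds the average of the constant 1. With one more unit, an average of `u` above
  -- `c₁ t` forces the average of the part of `u` above `t` to exceed `t`.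
  set c₁ : ℝ := G * 3 ^ n + 1 with hc₁
  have hc₁0 : 0 < c₁ := by positivity
  refine ⟨(c₁ ^ 2 * (2 * (c * 17 ^ n))).toNNReal, fun E hE hne hg ν hν hνE u hu hu2 => ?_⟩
  have := hg.isLocallyFiniteMeasure
  have hδm := measurable_delta E
  have hball : ∀ X ∈ Eᶜ, surface E (Metric.ball X (3 * delta E X)) ≤
      ENNReal.ofReal (G * 3 ^ n) * ENNReal.ofReal (delta E X ^ n) := fun X hX => by
    have hδ := delta_pos hE hne hX
    refine (hg X _ (by positivity)).trans (le_of_eq ?_)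
    rw [← ENNReal.ofReal_mul (by positivity), Real.rpow_natCast, mul_pow, mul_assoc]
  have hfin : ∀ X ∈ Eᶜ, coneAvg E u X ≠ ⊤ := fun X hX => by
    have hδ := delta_pos hE hne hX
    refine ENNReal.mul_ne_top (ENNReal.inv_ne_top.2 (ENNReal.ofReal_pos.2 (by positivity)).ne') ?_
    have h1 : ∀ y, u y ≤ 1 + u y ^ 2 := fun y => by
      rcases le_total (u y) 1 with h | h
      · exact h.trans le_self_add
      · exact (le_self_pow₀ h two_ne_zero).trans le_add_self
    refine ne_top_of_le_ne_top ?_ (lintegral_mono h1)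
    rw [lintegral_add_left measurable_const, lintegral_const, Measure.restrict_apply_univ, one_mul]
    exact ENNReal.add_ne_top.2 ⟨measure_ball_lt_top.ne,
      ne_top_of_le_ne_top hu2 (setLIntegral_le_lintegral _ _)⟩
  set F : Space n → ℝ := fun X => (coneAvg E u X).toReal / c₁ with hF
  have hFm : Measurable F := (measurable_coneAvg hu).ennreal_toReal.div_const _
  -- Marcinkiewicz interpolation: at height `t` the weak type bound is applied only to the part of
  -- `u` exceeding `t`, integrable because it is at most `u² / t`.
  set U : ℝ → Space n → ℝ≥0∞ := fun t => indicator {y | ENNReal.ofReal t < u y} u with hU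
  have hUm : Measurable (Function.uncurry U) := by
    have : Function.uncurry U = indicator {p : ℝ × Space n | ENNReal.ofReal p.1 < u p.2}
        fun p => u p.2 := by
      ext p; simp [Function.uncurry, hU, indicator]
    rw [this]
    exact (hu.comp measurable_snd).indicator
      (measurableSet_lt (by fun_prop) (hu.comp measurable_snd))
  have hweak : ∀ t ∈ Ioi (0 : ℝ), ν {X | t < F X} * ENNReal.ofReal (t ^ ((2 : ℝ) - 1)) ≤
      ENNReal.ofReal (c * 17 ^ n) * ∫⁻ y, U t y ∂surface E := by
    intro t (ht : 0 < t)
    have ht' : ENNReal.ofReal t ≠ 0 := (ENNReal.ofReal_pos.2 ht).ne'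
    have hUfin : ∫⁻ y, U t y ∂surface E ≠ ⊤ := by
      have h1 : ∀ y, U t y ≤ (ENNReal.ofReal t)⁻¹ * u y ^ 2 := fun y => by
        refine indicator_apply_le' (fun hy => ?_) fun _ => bot_le
        rw [mul_comm, ← div_eq_mul_inv, ENNReal.le_div_iff_mul_le (Or.inl ht')
          (Or.inl ENNReal.ofReal_ne_top), sq]
        gcongr
        exact le_of_lt hy
      refine ne_top_of_le_ne_top ?_ (lintegral_mono h1)
      rw [lintegral_const_mul' _ _ (ENNReal.inv_ne_top.2 ht')]
      exact ENNReal.mul_ne_top (ENNReal.inv_ne_top.2 ht') hu2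
    have hsub : ν {X | t < F X} ≤ ν {X | X ∈ Eᶜ ∧ ENNReal.ofReal t < coneAvg E (U t) X} := by
      refine measure_mono_ae ?_
      filter_upwards [hνE] with X hX (htX : t < F X)
      refine ⟨hX, ?_⟩
      have hδ := delta_pos hE hne hX
      have h1 : ENNReal.ofReal (t * c₁) < coneAvg E u X := by
        rw [ENNReal.ofReal_lt_iff_lt_toReal (by positivity) (hfin X hX)]
        exact (lt_div_iff₀ hc₁0).1 htX
      have h0 : ENNReal.ofReal (delta E X ^ n) ≠ 0 := (ENNReal.ofReal_pos.2 (by positivity)).ne'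
      have h2 : coneAvg E u X ≤ coneAvg E (U t) X + ENNReal.ofReal (t * (G * 3 ^ n)) := by
        have hle : ∀ y, u y ≤ U t y + ENNReal.ofReal t := fun y => by
          by_cases hy : ENNReal.ofReal t < u y
          · simp only [hU]
            rw [indicator_of_mem (by exact hy)]
            exact le_self_add
          · exact (not_lt.1 hy).trans le_add_self
        calc coneAvg E u X ≤ (ENNReal.ofReal (delta E X ^ n))⁻¹ *
              ∫⁻ y in Metric.ball X (3 * delta E X), (U t y + ENNReal.ofReal t) ∂surface E := by
              rw [coneAvg]; gcongr with y; exact hle y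
          _ = coneAvg E (U t) X + (ENNReal.ofReal (delta E X ^ n))⁻¹ * (ENNReal.ofReal t *
                surface E (Metric.ball X (3 * delta E X))) := by
              rw [lintegral_add_right _ measurable_const, mul_add, lintegral_const,
                Measure.restrict_apply_univ, coneAvg]
          _ ≤ coneAvg E (U t) X + (ENNReal.ofReal (delta E X ^ n))⁻¹ * (ENNReal.ofReal t *
                (ENNReal.ofReal (G * 3 ^ n) * ENNReal.ofReal (delta E X ^ n))) := by
              gcongr; exact hball X hX
          _ = coneAvg E (U t) X + ENNReal.ofReal t * ENNReal.ofReal (G * 3 ^ n) *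
                ((ENNReal.ofReal (delta E X ^ n))⁻¹ * ENNReal.ofReal (delta E X ^ n)) := by ring
          _ = _ := by
              rw [ENNReal.inv_mul_cancel h0 ENNReal.ofReal_ne_top, mul_one,
                ← ENNReal.ofReal_mul ht.le]
      have h3 : ENNReal.ofReal (t * c₁) = ENNReal.ofReal t + ENNReal.ofReal (t * (G * 3 ^ n)) := by
        rw [← ENNReal.ofReal_add ht.le (by positivity), hc₁]; congr 1; ring
      rw [h3] at h1
      exact lt_of_add_lt_add_right (h1.trans_le h2)
    calc _ ≤ ENNReal.ofReal (c * 17 ^ n) * ((ENNReal.ofReal t)⁻¹ * ∫⁻ y, U t y ∂surface E) *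
          ENNReal.ofReal t := by
          have : t ^ ((2 : ℝ) - 1) = t := by norm_num
          rw [this]
          gcongr
          exact hsub.trans (hν.measure_coneAvg_gt_le hn hc hE hne hUfin ht' ENNReal.ofReal_ne_top)
      _ = ENNReal.ofReal (c * 17 ^ n) * (∫⁻ y, U t y ∂surface E) *
          ((ENNReal.ofReal t)⁻¹ * ENNReal.ofReal t) := by ring
      _ = _ := by rw [ENNReal.inv_mul_cancel ht' ENNReal.ofReal_ne_top, mul_one]
  -- In the layer-cake formula the weight `t` cancels the `t⁻¹` of the weak bound, and the
  -- truncation has value `u(y)` only for `0 < t < u(y)`.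
  have hlayer : ∀ y, ∫⁻ t in Ioi (0 : ℝ), U t y ≤ u y ^ 2 := by
    intro y
    rcases eq_or_ne (u y) ⊤ with h | h
    · simp [h]
    calc ∫⁻ t in Ioi (0 : ℝ), U t y ≤ ∫⁻ t in Ioi (0 : ℝ),
          indicator (Ioo 0 (u y).toReal) (fun _ => u y) t := by
          refine setLIntegral_mono' measurableSet_Ioi fun t (ht : 0 < t) => ?_
          refine indicator_apply_le' (fun hy => ?_) fun _ => bot_le
          rw [indicator_of_mem]
          exact ⟨ht, (ENNReal.ofReal_lt_iff_lt_toReal ht.le h).1 hy⟩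
      _ ≤ ∫⁻ t, indicator (Ioo 0 (u y).toReal) (fun _ => u y) t := setLIntegral_le_lintegral _ _
      _ = u y ^ 2 := by
          rw [lintegral_indicator measurableSet_Ioo, lintegral_const, Measure.restrict_apply_univ,
            Real.volume_Ioo, sub_zero, ENNReal.ofReal_toReal h, sq]
  calc ∫⁻ X, coneAvg E u X ^ 2 ∂ν = ∫⁻ X, ENNReal.ofReal (c₁ ^ 2) *
        ENNReal.ofReal (F X ^ (2 : ℝ)) ∂ν := by
        refine lintegral_congr_ae ?_
        filter_upwards [hνE] with X hX
        rw [← ENNReal.ofReal_mul (by positivity), Real.rpow_two, ← mul_pow, hF,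
          mul_div_cancel₀ _ hc₁0.ne', ENNReal.ofReal_pow ENNReal.toReal_nonneg,
          ENNReal.ofReal_toReal (hfin X hX)]
    _ = ENNReal.ofReal (c₁ ^ 2) * (ENNReal.ofReal 2 *
          ∫⁻ t in Ioi (0 : ℝ), ν {X | t < F X} * ENNReal.ofReal (t ^ ((2 : ℝ) - 1))) := by
        rw [lintegral_const_mul' _ _ ENNReal.ofReal_ne_top,
          lintegral_rpow_eq_lintegral_meas_lt_mul ν (Filter.Eventually.of_forall fun X => by
            simp only [hF]; positivity) hFm.aemeasurable two_pos]
    _ ≤ ENNReal.ofReal (c₁ ^ 2) * (ENNReal.ofReal 2 * ∫⁻ t in Ioi (0 : ℝ),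
          ENNReal.ofReal (c * 17 ^ n) * ∫⁻ y, U t y ∂surface E) := by
        exact mul_le_mul_right (mul_le_mul_right (setLIntegral_mono' measurableSet_Ioi hweak) _) _
    _ = ENNReal.ofReal (c₁ ^ 2) * (ENNReal.ofReal 2 * (ENNReal.ofReal (c * 17 ^ n) *
          ∫⁻ y, (∫⁻ t in Ioi (0 : ℝ), U t y) ∂surface E)) := by
        rw [lintegral_const_mul' _ _ ENNReal.ofReal_ne_top,
          lintegral_lintegral_swap hUm.aemeasurable]
    _ ≤ ENNReal.ofReal (c₁ ^ 2) * (ENNReal.ofReal 2 * (ENNReal.ofReal (c * 17 ^ n) *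
          ∫⁻ y, u y ^ 2 ∂surface E)) := by
        gcongr with y; exact hlayer y
    _ = _ := by
        rw [← mul_assoc, ← mul_assoc, ← ENNReal.ofReal_mul (by positivity),
          ← ENNReal.ofReal_mul (by positivity), ENNReal.ofReal, mul_assoc (c₁ ^ 2)]

/-! ### Generations, Whitney cubes and the dyadic grid. -/

theorem len_pos (k : ℤ) : 0 < len k := by unfold len; positivity

theorem len_le_len {k k' : ℤ} (h : k ≤ k') : len k' ≤ len k :=
  zpow_le_zpow_right₀ one_le_two (by omega)

theorem mem_generations_of_le {c₀ : ℝ} {E : Set (Space n)} {k k' : ℤ} (hk : k ∈ generations c₀ E)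
    (h : k ≤ k') : k' ∈ generations c₀ E :=
  (ENNReal.ofReal_le_ofReal (len_le_len h)).trans hk

theorem exists_len_lt {t : ℝ} (ht : 0 < t) : ∃ k : ℤ, len k < t := by
  obtain ⟨m, hm⟩ := exists_pow_lt_of_lt_one ht (by norm_num : (1 / 2 : ℝ) < 1)
  refine ⟨m, ?_⟩
  rwa [len, zpow_neg, zpow_natCast, ← inv_pow, ← one_div]

theorem exists_lt_len (t : ℝ) : ∃ k : ℤ, t < len k := by
  obtain ⟨m, hm⟩ := pow_unbounded_of_one_lt t one_lt_two
  refine ⟨-m, ?_⟩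
  rwa [len, neg_neg, zpow_natCast]

/-- The coarsest generation of length at most `t`. -/
theorem exists_coarsest_generation {c₀ : ℝ} (hc₀ : 0 < c₀) {E : Set (Space n)}
    (hE : Metric.ediam E ≠ 0) {t : ℝ} (ht : 0 < t) :
    ∃ k ∈ generations c₀ E, len k ≤ t ∧ ∀ j ∈ generations c₀ E, len j ≤ t → k ≤ j := by
  obtain ⟨b, hb⟩ := exists_lt_len t
  obtain ⟨k₁, hk₁⟩ := exists_len_lt ht
  have hpos : ENNReal.ofReal c₀ * Metric.ediam E ≠ 0 :=
    mul_ne_zero (ENNReal.ofReal_pos.2 hc₀).ne' hE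
  obtain ⟨s, hs0, hs⟩ : ∃ s : ℝ, 0 < s ∧ ENNReal.ofReal s ≤ ENNReal.ofReal c₀ * Metric.ediam E := by
    rcases eq_or_ne (ENNReal.ofReal c₀ * Metric.ediam E) ⊤ with h | h
    · exact ⟨1, one_pos, by rw [h]; exact le_top⟩
    · exact ⟨_, ENNReal.toReal_pos hpos h, (ENNReal.ofReal_toReal h).le⟩
  obtain ⟨k₂, hk₂⟩ := exists_len_lt hs0
  obtain ⟨k, ⟨hk, hkt⟩, hmin⟩ := Int.exists_least_of_bdd
    (P := fun k => k ∈ generations c₀ E ∧ len k ≤ t)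
    ⟨b, fun z hz => by
      by_contra! hlt
      linarith [len_le_len hlt.le, hz.2]⟩
    ⟨max k₁ k₂, (ENNReal.ofReal_le_ofReal
      ((len_le_len (le_max_right _ _)).trans hk₂.le)).trans hs,
      (len_le_len (le_max_left _ _)).trans hk₁.le⟩
  exact ⟨k, hk, hkt, fun j hj hjt => hmin j ⟨hj, hjt⟩⟩

theorem dist_le_of_mem_cube {I : CubeCode n} {x y : Space n} (hx : x ∈ cube I) (hy : y ∈ cube I) :
    dist x y ≤ √(n + 1) * len I.1 := by
  have hl := len_pos I.1
  rw [EuclideanSpace.dist_eq, Real.sqrt_le_left (by positivity), mul_pow,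
    Real.sq_sqrt (by positivity)]
  calc ∑ i, dist (x i) (y i) ^ 2 ≤ ∑ _i : Fin (n + 1), len I.1 ^ 2 := by
        refine Finset.sum_le_sum fun i _ => ?_
        refine pow_le_pow_left₀ dist_nonneg ?_ 2
        rw [Real.dist_eq, abs_le]
        have h1 := hx i; have h2 := hy i
        constructor <;> linarith [h1.1, h1.2, h2.1, h2.2]
    _ = _ := by simp

theorem ediam_cube_le (I : CubeCode n) :
    Metric.ediam (cube I) ≤ ENNReal.ofReal (√(n + 1) * len I.1) := by
  refine Metric.ediam_le fun x hx y hy => ?_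
  rw [edist_dist]
  exact ENNReal.ofReal_le_ofReal (dist_le_of_mem_cube hx hy)

theorem len_le_ediam_cube (I : CubeCode n) : ENNReal.ofReal (len I.1) ≤ Metric.ediam (cube I) := by
  have hl := len_pos I.1
  set x : Space n := WithLp.toLp 2 fun i => (I.2 i : ℝ) * len I.1 with hx
  set y : Space n := WithLp.toLp 2 fun i => ((I.2 i : ℝ) + 1) * len I.1 with hy
  have hxI : x ∈ cube I := fun i => by
    simp only [hx]; constructor <;> nlinarith
  have hyI : y ∈ cube I := fun i => by
    simp only [hy]; constructor <;> nlinarith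
  refine le_trans ?_ (Metric.edist_le_ediam_of_mem hxI hyI)
  rw [edist_dist]
  refine ENNReal.ofReal_le_ofReal ?_
  have h1 : ‖(x - y) 0‖ ≤ ‖x - y‖ := PiLp.norm_apply_le _ _
  rw [← dist_eq_norm] at h1
  refine le_trans (le_of_eq ?_) h1
  rw [PiLp.sub_apply]
  simp only [hx, hy]
  rw [Real.norm_eq_abs, abs_sub_comm, ← sub_mul, add_sub_cancel_left, one_mul, abs_of_pos hl]

theorem cube_subset_dilate (I : CubeCode n) : cube I ⊆ dilate 4 I := by
  intro x hx i
  have := hx i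
  have hl := len_pos I.1
  rw [abs_le]
  constructor <;> nlinarith [this.1, this.2]

theorem isClosed_cube (I : CubeCode n) : IsClosed (cube I) := by
  have : cube I = ⋂ i, {x : Space n | (I.2 i : ℝ) * len I.1 ≤ x i} ∩
      {x : Space n | x i ≤ ((I.2 i : ℝ) + 1) * len I.1} := by
    ext x
    exact ⟨fun h => mem_iInter.2 fun i => h i, fun h i => mem_iInter.1 h i⟩
  rw [this]
  refine isClosed_iInter fun i => ?_
  exact (isClosed_le (by fun_prop) (by fun_prop)).inter (isClosed_le (by fun_prop) (by fun_prop))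

theorem setDist_le_edist {A B : Set (Space n)} {a b : Space n} (ha : a ∈ A) (hb : b ∈ B) :
    setDist A B ≤ edist a b := iInf₂_le_of_le a ha (iInf₂_le b hb)

section Whitney

variable {E : Set (Space n)} {W : Set (CubeCode n)}

theorem IsWhitney.len_le_delta (h : IsWhitney E W) (hE : IsClosed E) (hne : E.Nonempty)
    {I : CubeCode n} (hI : I ∈ W) {X : Space n} (hX : X ∈ cube I) : 4 * len I.1 ≤ delta E X := by
  obtain ⟨y, hy, hXy⟩ := exists_dist_eq_delta hE hne X
  have h1 : 4 * ENNReal.ofReal (len I.1) ≤ ENNReal.ofReal (delta E X) := by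
    calc _ ≤ 4 * Metric.ediam (cube I) := by gcongr; exact len_le_ediam_cube I
      _ ≤ _ := h.dist_lower I hI
      _ ≤ edist X y := setDist_le_edist (cube_subset_dilate I hX) hy
      _ = _ := by rw [edist_dist, hXy]
  have h4 : (4 : ℝ≥0∞) = ENNReal.ofReal 4 := by simp
  rw [h4, ← ENNReal.ofReal_mul (by norm_num),
    ENNReal.ofReal_le_ofReal_iff (delta_nonneg E X)] at h1
  exact h1

/-- The 41 is the 40 of the Whitney condition plus one diameter to cross the cube; `√(n + 1)` is the
ratio of diameter to side length. -/
theorem IsWhitney.delta_le (h : IsWhitney E W) {I : CubeCode n} (hI : I ∈ W) {X : Space n}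
    (hX : X ∈ cube I) : delta E X ≤ 41 * √(n + 1) * len I.1 := by
  have hl := len_pos I.1
  have h1 : ENNReal.ofReal (delta E X) - Metric.ediam (cube I) ≤ setDist (cube I) E := by
    refine le_iInf₂ fun a ha => le_iInf₂ fun b hb => ?_
    rw [tsub_le_iff_left]
    calc ENNReal.ofReal (delta E X) ≤ edist X b := by
          rw [edist_dist]; exact ENNReal.ofReal_le_ofReal (delta_le_dist hb X)
      _ ≤ edist X a + edist a b := edist_triangle _ _ _
      _ ≤ _ := by gcongr; exact Metric.edist_le_ediam_of_mem hX ha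
  have h2 : ENNReal.ofReal (delta E X) ≤ ENNReal.ofReal (41 * √(n + 1) * len I.1) := by
    calc _ ≤ Metric.ediam (cube I) + 40 * Metric.ediam (cube I) :=
          tsub_le_iff_left.1 (h1.trans (h.dist_upper I hI))
      _ = 41 * Metric.ediam (cube I) := by ring
      _ ≤ 41 * ENNReal.ofReal (√(n + 1) * len I.1) := by gcongr; exact ediam_cube_le I
      _ = _ := by
          rw [mul_assoc, ENNReal.ofReal_mul (by norm_num : (0 : ℝ) ≤ 41)]
          simp
  exact (ENNReal.ofReal_le_ofReal_iff (by positivity)).1 h2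

end Whitney

section Grid

variable {c₀ a₀ η C₁ C₂ : ℝ} {E : Set (Space n)} {D : ℤ → Set (Set (Space n))}

/-- A common point of two cubes lies in a cube of the next generation, always available; by nesting
both contain it, against uniqueness of the ancestor. -/
theorem IsDyadicGrid.pairwiseDisjoint (h : IsDyadicGrid c₀ a₀ η C₁ C₂ E D) {k : ℤ}
    (hk : k ∈ generations c₀ E) : (D k).PairwiseDisjoint id := by
  intro Q hQ Q' hQ' hne
  rw [Function.onFun, id, id, Set.disjoint_left]
  intro x hx hx'
  have hk1 := mem_generations_of_le hk (by omega : k ≤ k + 1)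
  have hxE : x ∈ ⋃₀ D (k + 1) := by
    rw [h.cover _ hk1, ← h.cover _ hk]
    exact ⟨Q, hQ, hx⟩
  obtain ⟨P, hP, hxP⟩ := hxE
  have hsub : ∀ R ∈ D k, x ∈ R → P ⊆ R := fun R hR hxR =>
    (h.nested k hk (k + 1) hk1 (by omega) R hR P hP).resolve_left
      (nonempty_iff_ne_empty.1 ⟨x, hxP, hxR⟩)
  exact hne ((h.ancestor k hk (k + 1) hk1 (by omega) P hP).unique
    ⟨hQ, hsub Q hQ hx⟩ ⟨hQ', hsub Q' hQ' hx'⟩)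

theorem IsDyadicGrid.surface_pos (h : IsDyadicGrid c₀ a₀ η C₁ C₂ E D) (hC₁ : 0 < C₁) {k : ℤ}
    (hk : k ∈ generations c₀ E) {Q : Set (Space n)} (hQ : Q ∈ D k) : 0 < surface E Q := by
  have := len_pos k
  exact (ENNReal.ofReal_pos.2 (by positivity)).trans_le (h.measure_lower k hk Q hQ)

theorem IsDyadicGrid.surface_ne_top (h : IsDyadicGrid c₀ a₀ η C₁ C₂ E D) {k : ℤ}
    (hk : k ∈ generations c₀ E) {Q : Set (Space n)} (hQ : Q ∈ D k) : surface E Q ≠ ⊤ :=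
  ne_top_of_le_ne_top ENNReal.ofReal_ne_top (h.measure_upper k hk Q hQ)

theorem IsDyadicGrid.countable [SFinite (surface E)] (h : IsDyadicGrid c₀ a₀ η C₁ C₂ E D)
    (hC₁ : 0 < C₁) {k : ℤ} (hk : k ∈ generations c₀ E) : (D k).Countable := by
  have h1 := Measure.countable_meas_pos_of_disjoint_iUnion (μ := surface E)
    (As := fun Q : D k => (Q : Set (Space n))) (fun Q => h.borel k hk Q Q.2)
    (fun Q Q' hne => h.pairwiseDisjoint hk Q.2 Q'.2 fun e => hne (Subtype.ext e))
  have h2 : {Q : D k | 0 < surface E (Q : Set (Space n))} = univ :=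
    eq_univ_of_forall fun Q => h.surface_pos hC₁ hk Q.2
  rw [h2, countable_univ_iff] at h1
  exact h1

theorem measurableSet_whitneyRegion (W : Set (CubeCode n)) (β : ℝ) (k : ℤ) (Q : Set (Space n)) :
    MeasurableSet (whitneyRegion W β k Q) :=
  MeasurableSet.biUnion (to_countable _) fun I _ => (isClosed_cube I).measurableSet

/-- The set is a countable union of products `𝒰_{Q'} × Q'`; countability of each generation comes
from disjointness and positive mass. This is what Fubini needs. -/
theorem IsDyadicGrid.measurableSet_cone [SFinite (surface E)] (h : IsDyadicGrid c₀ a₀ η C₁ C₂ E D)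
    (hC₁ : 0 < C₁) (W : Set (CubeCode n)) (β : ℝ) (Q : Set (Space n)) :
    MeasurableSet {p : Space n × Space n | p.1 ∈ truncatedCone c₀ E D W β Q p.2} := by
  have : {p : Space n × Space n | p.1 ∈ truncatedCone c₀ E D W β Q p.2} =
      ⋃ k ∈ generations c₀ E, ⋃ Q' ∈ {Q' ∈ D k | Q' ⊆ Q}, whitneyRegion W β k Q' ×ˢ Q' := by
    ext ⟨X, x⟩
    simp only [truncatedCone, mem_iUnion, mem_prod, mem_ofPred_eq, exists_prop]
    constructor
    · rintro ⟨k, hk, Q', ⟨hQ', hx, hsub⟩, hX⟩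
      exact ⟨k, hk, Q', ⟨hQ', hsub⟩, hX, hx⟩
    · rintro ⟨k, hk, Q', ⟨hQ', hsub⟩, hX, hx⟩
      exact ⟨k, hk, Q', ⟨hQ', hx, hsub⟩, hX⟩
  rw [this]
  refine MeasurableSet.biUnion (to_countable _) fun k hk => ?_
  refine MeasurableSet.biUnion ((h.countable hC₁ hk).mono fun _ hQ' => hQ'.1) fun Q' hQ' => ?_
  exact (measurableSet_whitneyRegion W β k Q').prod (h.borel k hk Q' hQ'.1)

/-- A point near `E` belongs to the Whitney region of a grid cube of comparable size, inside a
given coarser generation. -/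
theorem exists_cube_of_mem {W : Set (CubeCode n)} (hE : IsClosed E) (hne : E.Nonempty)
    (hD : IsDyadicGrid c₀ a₀ η C₁ C₂ E D) (hW : IsWhitney E W) (hC₁ : 0 < C₁)
    {β : ℝ} (hβ : 41 * √(n + 1) ≤ β) {t : ℝ} {k : ℤ} (hk : k ∈ generations c₀ E)
    (hmin : ∀ j ∈ generations c₀ E, len j ≤ t → k ≤ j) {X : Space n} (hX : X ∈ Eᶜ)
    (hXt : delta E X ≤ 4 * t)
    (hXc : ENNReal.ofReal (delta E X) ≤ ENNReal.ofReal (4 * c₀) * Metric.ediam E) :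
    ∃ Q ∈ D k, ∃ y ∈ Q, dist X y = delta E X ∧ ∃ Q' ⊆ Q, MeasurableSet Q' ∧
      ENNReal.ofReal (C₁⁻¹ * (delta E X / (41 * √(n + 1))) ^ n) ≤ surface E Q' ∧
        ∀ x ∈ Q', X ∈ truncatedCone c₀ E D W β Q x := by
  rw [← hW.cover] at hX
  obtain ⟨I, hI, hXI⟩ := mem_iUnion₂.1 hX
  have hl := len_pos I.1
  have h1 := hW.len_le_delta hE hne hI hXI
  have h2 := hW.delta_le hI hXI
  -- The cube `Q'` will have exactly the side length of the Whitney cube `I` containing `X`; as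
  -- `4ℓ(I) ≤ δ(X)`, the bound `4 c₀ diam E` on `δ(X)` makes this an available generation.
  have hj : I.1 ∈ generations c₀ E := by
    have h3 : ENNReal.ofReal 4 * ENNReal.ofReal (len I.1) ≤
        ENNReal.ofReal 4 * (ENNReal.ofReal c₀ * Metric.ediam E) := by
      rw [← ENNReal.ofReal_mul (by norm_num), ← mul_assoc, ← ENNReal.ofReal_mul (by norm_num)]
      exact (ENNReal.ofReal_le_ofReal h1).trans hXc
    exact (ENNReal.mul_le_mul_iff_right (by simp) ENNReal.ofReal_ne_top).1 h3
  have hkj : k ≤ I.1 := hmin _ hj (by linarith)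
  obtain ⟨y, hy, hXy⟩ := exists_dist_eq_delta hE hne X
  obtain ⟨Q', hQ', hyQ'⟩ : y ∈ ⋃₀ D I.1 := by rw [hD.cover _ hj]; exact hy
  obtain ⟨Q, hQ, hsub⟩ : ∃ Q ∈ D k, Q' ⊆ Q := by
    rcases hkj.eq_or_lt with h | h
    · exact ⟨Q', h ▸ hQ', subset_rfl⟩
    · obtain ⟨Q, hQ, -⟩ := hD.ancestor k hk I.1 hj h Q' hQ'
      exact ⟨Q, hQ.1, hQ.2⟩
  refine ⟨Q, hQ, y, hsub hyQ', hXy, Q', hsub, hD.borel _ hj Q' hQ', ?_, fun x hx => ?_⟩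
  · refine le_trans (ENNReal.ofReal_le_ofReal ?_) (hD.measure_lower _ hj Q' hQ')
    have := delta_nonneg E X
    gcongr
    rw [div_le_iff₀ (by positivity)]
    linarith
  · refine mem_iUnion₂.2 ⟨I.1, hj, mem_iUnion₂.2 ⟨Q', ⟨hQ', hx, hsub⟩,
      mem_iUnion₂.2 ⟨I, ⟨hI, by linarith, by linarith, ?_⟩, hXI⟩⟩⟩
    -- `Q'` contains a point nearest to `X`, so its distance to `I` is at most `δ(X) ≤ 41 √(n + 1)
    -- ℓ(I)`. This dictates the lower bound on `β`.
    refine (setDist_le_edist hyQ' hXI).trans ?_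
    rw [edist_comm, edist_dist, hXy]
    refine ENNReal.ofReal_le_ofReal (h2.trans ?_)
    gcongr

end Grid

/-! ### Carleson's condition for the measure built from `Θ1`. -/

/-- The measure `|Θ1(X)|² dX / δ(X)` near `E`. -/
noncomputable def thetaMeasure (E : Set (Space n)) (ψ : Space n → Space n → ℂ) :
    Measure (Space n) :=
  (nearMeasure E).withDensity fun X => ‖theta E ψ (fun _ => 1) X‖ₑ ^ 2

/-- The contribution to Carleson's condition of the points at distance to `E` comparable with the
diameter of `E`. -/
theorem exists_far_carleson_bound (n : ℕ) {c₀ B : ℝ} (hc₀ : 0 < c₀) (hB : 0 ≤ B) :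
    ∃ c : ℝ, 0 ≤ c ∧ ∀ E : Set (Space n), IsClosed E → ∀ x ∈ E, ∀ r : ℝ,
      ∀ g : Space n → ℝ≥0∞, (∀ X ∈ Eᶜ, g X ≤ ENNReal.ofReal B) →
        ∫⁻ X in {X | X ∈ nearRegion E ∧ X ∈ Metric.ball x r ∧
            ENNReal.ofReal c₀ * Metric.ediam E < ENNReal.ofReal (delta E X)},
          g X / ENNReal.ofReal (delta E X) ≤ ENNReal.ofReal (c * r ^ n) := by
  obtain ⟨V, hV0, hV⟩ := exists_volume_growth n
  refine ⟨B / c₀ * V * 2 ^ (n + 1) / c₀ ^ n, by positivity, fun E hE x hx r g hg => ?_⟩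
  set S := {X | X ∈ nearRegion E ∧ X ∈ Metric.ball x r ∧
    ENNReal.ofReal c₀ * Metric.ediam E < ENNReal.ofReal (delta E X)} with hS
  rcases S.eq_empty_or_nonempty with h | ⟨X₀, hX₀, hX₀r, hX₀c⟩
  · simp [h]
  have hfin : Metric.ediam E ≠ ⊤ := by
    intro h
    rw [h, ENNReal.mul_top (ENNReal.ofReal_pos.2 hc₀).ne'] at hX₀c
    exact not_top_lt hX₀c
  set d := (Metric.ediam E).toReal with hd
  have hEd : Metric.ediam E = ENNReal.ofReal d := (ENNReal.ofReal_toReal hfin).symm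
  have hd0 : 0 < d := by
    rw [hd]; exact ENNReal.toReal_pos (ne_bot_of_gt hX₀.2) hfin
  have hSd : ∀ X ∈ S, c₀ * d < delta E X ∧ delta E X < d := fun X hX => by
    have h1 := hX.2.2
    have h2 := hX.1.2
    rw [hEd] at h1 h2
    rw [← ENNReal.ofReal_mul hc₀.le] at h1
    exact ⟨(ENNReal.ofReal_lt_ofReal_iff_of_nonneg (by positivity)).1 h1,
      (ENNReal.ofReal_lt_ofReal_iff hd0).1 h2⟩
  have hsub : S ⊆ Metric.ball x (2 * d) := fun X hX => by
    obtain ⟨y, hy, hXy⟩ := exists_dist_eq_delta hE ⟨x, hx⟩ X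
    have h1 : dist y x ≤ d := by
      rw [← ENNReal.ofReal_le_ofReal_iff hd0.le, ← edist_dist, ← hEd]
      exact Metric.edist_le_ediam_of_mem hy hx
    rw [Metric.mem_ball]
    linarith [dist_triangle X y x, (hSd X hX).2]
  -- A single point of the set lies within `r` of `x` but at distance more than `c₀ d` from `E`;
  -- hence a bound by a multiple of `dⁿ` suffices.
  have hdr : d ≤ r / c₀ := by
    rw [le_div_iff₀ hc₀]
    have h1 := (hSd X₀ ⟨hX₀, hX₀r, hX₀c⟩).1
    have h2 := delta_le_dist hx X₀
    have h3 := Metric.mem_ball.1 hX₀r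
    linarith
  have hSm : MeasurableSet S :=
    (measurableSet_nearRegion hE).inter (Metric.isOpen_ball.measurableSet.inter
      (measurableSet_lt measurable_const (measurable_delta E).ennreal_ofReal))
  calc _ ≤ ∫⁻ X in S, ENNReal.ofReal (B / (c₀ * d)) := by
        refine setLIntegral_mono' hSm fun X hX => ?_
        rw [ENNReal.ofReal_div_of_pos (by positivity)]
        exact ENNReal.div_le_div (hg X hX.1.1) (ENNReal.ofReal_le_ofReal (hSd X hX).1.le)
    _ = ENNReal.ofReal (B / (c₀ * d)) * volume S := by
        rw [lintegral_const, Measure.restrict_apply_univ]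
    _ ≤ ENNReal.ofReal (B / (c₀ * d)) * ENNReal.ofReal (V * (2 * d) ^ ((n : ℝ) + 1)) := by
        gcongr
        exact (measure_mono hsub).trans (hV x _ (by positivity))
    _ = ENNReal.ofReal (B / c₀ * V * 2 ^ (n + 1) * d ^ n) := by
        rw [← ENNReal.ofReal_mul (by positivity)]
        congr 1
        have : (2 * d) ^ ((n : ℝ) + 1) = (2 * d) ^ (n + 1) := by
          rw [← Real.rpow_natCast]; push_cast; rfl
        rw [this, mul_pow]
        field_simp
        ring
    _ ≤ ENNReal.ofReal (B / c₀ * V * 2 ^ (n + 1) * (r / c₀) ^ n) := by gcongr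
    _ = _ := by rw [div_pow]; congr 1; ring

/-- The contribution to Carleson's condition of the points close to `E`: here the square function
condition on grid cubes is used. -/
theorem exists_near_carleson_bound (n : ℕ) {G β c₀ a₀ η C₁ C₂ : ℝ} (hG : 0 ≤ G)
    (hβ : 41 * √(n + 1) ≤ β) (hc₀ : 0 < c₀) (hC₁ : 0 < C₁) (M : ℝ≥0) :
    ∃ c : ℝ, 0 ≤ c ∧ ∀ (E : Set (Space n)) (D : ℤ → Set (Set (Space n))) (W : Set (CubeCode n)),
      IsClosed E → Metric.ediam E ≠ 0 → HasGrowth n G (surface E) →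
        IsDyadicGrid c₀ a₀ η C₁ C₂ E D → IsWhitney E W →
        ∀ g : Space n → ℝ≥0∞, AEMeasurable g (volume.restrict Eᶜ) →
          (∀ k ∈ generations c₀ E, ∀ Q ∈ D k, (surface E Q)⁻¹ *
            ∫⁻ x in Q, (∫⁻ Y in truncatedCone c₀ E D W β Q x,
              g Y / ENNReal.ofReal (delta E Y ^ (n + 1))) ∂surface E ≤ M) →
          ∀ x ∈ E, ∀ r : ℝ, 0 < r →
            ∫⁻ X in {X | X ∈ nearRegion E ∧ X ∈ Metric.ball x r ∧
              ENNReal.ofReal (delta E X) ≤ ENNReal.ofReal (4 * c₀) * Metric.ediam E},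
              g X / ENNReal.ofReal (delta E X) ≤ ENNReal.ofReal (c * r ^ n) := by
  set b : ℝ := C₁ * (41 * √(n + 1)) ^ n with hb
  have hb0 : 0 ≤ b := by positivity
  refine ⟨b * M * (G * (C₁ + 3) ^ n), by positivity,
    fun E D W hE hd hg hD hW g hgm hM x hx r hr => ?_⟩
  have := hg.isLocallyFiniteMeasure
  have hne : E.Nonempty := ⟨x, hx⟩
  have hδm := measurable_delta E
  -- With `t = r / 4`, every point of the ball has `δ(X) < r = 4t`, so its Whitney cube has
  -- generation at least `k`. No lower bound for `len k` is required.
  obtain ⟨k, hk, hkr, hmin⟩ := exists_coarsest_generation hc₀ hd (t := r / 4) (by positivity)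
  set S := {X | X ∈ nearRegion E ∧ X ∈ Metric.ball x r ∧
    ENNReal.ofReal (delta E X) ≤ ENNReal.ofReal (4 * c₀) * Metric.ediam E} with hS
  have hSm : MeasurableSet S :=
    (measurableSet_nearRegion hE).inter (Metric.isOpen_ball.measurableSet.inter
      (measurableSet_le hδm.ennreal_ofReal measurable_const))
  set h : Space n → ℝ≥0∞ := fun Y => g Y / ENNReal.ofReal (delta E Y ^ (n + 1)) with hh
  have hhm : AEMeasurable h (volume.restrict Eᶜ) := hgm.div (by fun_prop)
  set 𝒬 : Set (Set (Space n)) := {Q ∈ D k | (Q ∩ Metric.ball x (2 * r)).Nonempty} with h𝒬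
  have h𝒬c : 𝒬.Countable := (hD.countable hC₁ hk).mono fun _ hQ => hQ.1
  have : Countable 𝒬 := h𝒬c
  set Z : Set (Space n) → Space n → Space n → ℝ≥0∞ := fun Q Y z =>
    indicator {p : Space n × Space n | p.1 ∈ truncatedCone c₀ E D W β Q p.2}
      (fun p => h p.1) (Y, z) with hZ
  have hZm : ∀ Q ∈ 𝒬, AEMeasurable (Function.uncurry (Z Q))
      ((volume.restrict Eᶜ).prod ((surface E).restrict Q)) := fun Q hQ =>
    (hhm.comp_fst).indicator (hD.measurableSet_cone hC₁ W β Q)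
  -- The weight `δ⁻¹` is `δ⁻ⁿ⁻¹` times `δⁿ`, and `δⁿ` is at most `b σ(Q')`. As `X` is in the cone of
  -- each `z` in `Q'`, the mass becomes an integral over `Q` of the cone's indicator.
  have hpt : ∀ X ∈ S, g X / ENNReal.ofReal (delta E X) ≤
      ENNReal.ofReal b * ∑' Q : 𝒬, ∫⁻ z in (Q : Set (Space n)), Z Q X z ∂surface E := by
    intro X hX
    have hδ := delta_pos hE hne hX.1.1
    have hδr : delta E X < r := (delta_le_dist hx X).trans_lt hX.2.1
    obtain ⟨Q, hQ, y, hyQ, hXy, Q', hsub, hQ'm, hσ, hcone⟩ := exists_cube_of_mem hE hne hD hW hC₁ hβ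
      hk hmin hX.1.1 (by linarith) hX.2.2
    have hQ𝒬 : Q ∈ 𝒬 := by
      refine ⟨hQ, y, hyQ, ?_⟩
      have h1 := Metric.mem_ball.1 hX.2.1
      rw [Metric.mem_ball]
      linarith [dist_triangle y X x, dist_comm y X]
    calc g X / ENNReal.ofReal (delta E X) = ENNReal.ofReal b *
          (h X * ENNReal.ofReal (C₁⁻¹ * (delta E X / (41 * √(n + 1))) ^ n)) := by
          have h1 : ENNReal.ofReal b * (h X * ENNReal.ofReal (C₁⁻¹ * (delta E X / (41 * √(n + 1))) ^ n))
              = g X * ((ENNReal.ofReal (delta E X ^ (n + 1)))⁻¹ * (ENNReal.ofReal b *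
                ENNReal.ofReal (C₁⁻¹ * (delta E X / (41 * √(n + 1))) ^ n))) := by
            simp only [hh, div_eq_mul_inv (g X)]; ring
          rw [h1, ← ENNReal.ofReal_inv_of_pos (by positivity), ← ENNReal.ofReal_mul hb0,
            ← ENNReal.ofReal_mul (by positivity), div_eq_mul_inv, ← ENNReal.ofReal_inv_of_pos hδ]
          congr 2
          rw [hb, div_pow]
          field_simp
          ring
      _ ≤ ENNReal.ofReal b * (h X * surface E Q') := by gcongr
      _ ≤ ENNReal.ofReal b * ∫⁻ z in Q', Z Q X z ∂surface E := by
          gcongr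
          rw [← setLIntegral_const]
          refine setLIntegral_mono' hQ'm fun z hz => ?_
          simp only [hZ]
          rw [indicator_of_mem (by exact hcone z hz)]
      _ ≤ ENNReal.ofReal b * ∫⁻ z in Q, Z Q X z ∂surface E := by
          gcongr
      _ ≤ _ := by
          gcongr
          exact ENNReal.le_tsum (f := fun Q : 𝒬 => ∫⁻ z in (Q : Set (Space n)), Z Q X z ∂surface E)
            ⟨Q, hQ𝒬⟩
  have hQle : ∀ Q ∈ 𝒬, ∫⁻ X in Eᶜ, (∫⁻ z in Q, Z Q X z ∂surface E) ≤ M * surface E Q := by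
    intro Q hQ
    have h1 := hM k hk Q hQ.1
    rw [mul_comm, ← div_eq_mul_inv, ENNReal.div_le_iff_le_mul
      (Or.inl (hD.surface_pos hC₁ hk hQ.1).ne') (Or.inl (hD.surface_ne_top hk hQ.1))] at h1
    rw [lintegral_lintegral_swap (hZm Q hQ)]
    refine le_trans (lintegral_mono fun z => ?_) h1
    have hcm : MeasurableSet (truncatedCone c₀ E D W β Q z) :=
      measurable_prodMk_right (hD.measurableSet_cone hC₁ W β Q)
    calc ∫⁻ X in Eᶜ, Z Q X z = ∫⁻ X in Eᶜ, indicator (truncatedCone c₀ E D W β Q z) h X := rfl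
      _ ≤ ∫⁻ X, indicator (truncatedCone c₀ E D W β Q z) h X := setLIntegral_le_lintegral _ _
      _ = _ := lintegral_indicator hcm _
  -- The cubes are disjoint, meet `B(x, 2r)` and have diameter at most `C₁ r`, so they all lie in
  -- `B(x, (C₁ + 3) r)`.
  have hunion : ∑' Q : 𝒬, surface E (Q : Set (Space n)) ≤ ENNReal.ofReal (G * (C₁ + 3) ^ n * r ^ n) := by
    rw [← measure_biUnion (f := fun Q => Q) h𝒬c
      ((hD.pairwiseDisjoint hk).subset fun _ hQ => hQ.1)
      fun Q hQ => hD.borel k hk Q hQ.1]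
    calc _ ≤ surface E (Metric.ball x ((C₁ + 3) * r)) := by
          refine measure_mono (iUnion₂_subset fun Q hQ z hz => ?_)
          obtain ⟨y, hy, hyx⟩ := hQ.2
          have h1 : dist z y ≤ C₁ * len k := by
            rw [← ENNReal.ofReal_le_ofReal_iff (by have := len_pos k; positivity), ← edist_dist]
            exact (Metric.edist_le_ediam_of_mem hz hy).trans (hD.diam_upper k hk Q hQ.1)
          rw [Metric.mem_ball] at hyx ⊢
          have h2 : C₁ * len k ≤ C₁ * r := by gcongr; linarith
          linarith [dist_triangle z y x]
      _ ≤ _ := hg x _ (by positivity)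
      _ = _ := by rw [Real.rpow_natCast, mul_pow, mul_assoc]
  calc ∫⁻ X in S, g X / ENNReal.ofReal (delta E X)
      ≤ ∫⁻ X in S, ENNReal.ofReal b *
          ∑' Q : 𝒬, ∫⁻ z in (Q : Set (Space n)), Z Q X z ∂surface E := setLIntegral_mono' hSm hpt
    _ ≤ ∫⁻ X in Eᶜ, ENNReal.ofReal b *
          ∑' Q : 𝒬, ∫⁻ z in (Q : Set (Space n)), Z Q X z ∂surface E :=
        lintegral_mono_set fun X hX => hX.1.1
    _ = ENNReal.ofReal b * ∑' Q : 𝒬, ∫⁻ X in Eᶜ, (∫⁻ z in (Q : Set (Space n)), Z Q X z ∂surface E) := by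
        rw [lintegral_const_mul' _ _ ENNReal.ofReal_ne_top, lintegral_tsum]
        exact fun Q => (hZm Q Q.2).lintegral_prod_right'
    _ ≤ ENNReal.ofReal b * ∑' Q : 𝒬, M * surface E (Q : Set (Space n)) := by
        gcongr with Q
        exact hQle Q Q.2
    _ ≤ ENNReal.ofReal b * (M * ENNReal.ofReal (G * (C₁ + 3) ^ n * r ^ n)) := by
        rw [ENNReal.tsum_mul_left]; gcongr
    _ = _ := by
        rw [← ENNReal.ofReal_coe_nnreal, ← ENNReal.ofReal_mul M.coe_nonneg, ← ENNReal.ofReal_mul hb0]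
        congr 1; ring

theorem enorm_theta_one_le {E : Set (Space n)} {ψ : Space n → Space n → ℂ} (X : Space n) :
    ‖theta E ψ (fun _ => 1) X‖ₑ ≤ ∫⁻ y, ‖ψ X y‖ₑ ∂surface E := by
  rw [theta]
  simp only [mul_one]
  exact enorm_integral_le_lintegral_enorm _

theorem thetaMeasure_apply {E : Set (Space n)} (hE : IsClosed E) (hne : E.Nonempty)
    (ψ : Space n → Space n → ℂ) {s : Set (Space n)} (hs : MeasurableSet s) :
    thetaMeasure E ψ s = ∫⁻ X in nearRegion E ∩ s,
      ‖theta E ψ (fun _ => 1) X‖ₑ ^ 2 / ENNReal.ofReal (delta E X) := by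
  rw [thetaMeasure, withDensity_apply _ hs, ← lintegral_indicator hs, lintegral_nearMeasure hE hne,
    inter_comm, ← Measure.restrict_restrict hs, ← lintegral_indicator hs]
  refine lintegral_congr fun X => ?_
  by_cases hX : X ∈ s
  · rw [indicator_of_mem hX, indicator_of_mem hX]
  · rw [indicator_of_notMem hX, indicator_of_notMem hX, ENNReal.zero_div]

/-- The square function condition on grid cubes implies Carleson's condition for
`|Θ1(X)|² dX / δ(X)`. -/
theorem exists_isCarleson_thetaMeasure (n : ℕ) {G β c₀ a₀ η C₁ C₂ α K : ℝ} (hG : 0 ≤ G)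
    (hβ : 41 * √(n + 1) ≤ β) (hc₀ : 0 < c₀) (hC₁ : 0 < C₁) (hα : 0 < α) (hK : 0 ≤ K) (M : ℝ≥0) :
    ∃ c : ℝ, 0 ≤ c ∧ ∀ (E : Set (Space n)) (D : ℤ → Set (Set (Space n))) (W : Set (CubeCode n))
      (ψ : Space n → Space n → ℂ), IsClosed E → Metric.ediam E ≠ 0 → HasGrowth n G (surface E) →
        IsDyadicGrid c₀ a₀ η C₁ C₂ E D → IsWhitney E W → IsKernel α K E ψ →
          (∀ k ∈ generations c₀ E, ∀ Q ∈ D k, (surface E Q)⁻¹ *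
            ∫⁻ x in Q, (∫⁻ Y in truncatedCone c₀ E D W β Q x, ‖theta E ψ (fun _ => 1) Y‖ₑ ^ 2 /
              ENNReal.ofReal (delta E Y ^ (n + 1))) ∂surface E ≤ M) →
          IsCarleson c E (thetaMeasure E ψ) := by
  obtain ⟨B, hB⟩ := exists_lintegral_kernel_bound n hG hα hK
  obtain ⟨c₁, hc₁0, hc₁⟩ := exists_near_carleson_bound n (a₀ := a₀) (η := η) (C₂ := C₂) hG hβ hc₀
    hC₁ M
  -- The threshold `4 c₀` complements the range treated by the near bound.
  obtain ⟨c₂, hc₂0, hc₂⟩ := exists_far_carleson_bound n (c₀ := 4 * c₀) (B := (B : ℝ) ^ 2)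
    (by positivity) (by positivity)
  refine ⟨c₁ + c₂, by positivity, fun E D W ψ hE hd hg hD hW hψ hM x hx r hr => ?_⟩
  have := hg.isLocallyFiniteMeasure
  have hgm : AEMeasurable (fun X => ‖theta E ψ (fun _ => 1) X‖ₑ ^ 2) (volume.restrict Eᶜ) :=
    (hψ.aestronglyMeasurable_theta aestronglyMeasurable_const).enorm.pow_const 2
  have h1 := hc₁ E D W hE hd hg hD hW _ hgm hM x hx r hr
  have h2 := hc₂ E hE x hx r (fun X => ‖theta E ψ (fun _ => 1) X‖ₑ ^ 2) fun X hX => by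
    rw [ENNReal.ofReal_pow B.coe_nonneg, ENNReal.ofReal_coe_nnreal]
    gcongr
    exact (enorm_theta_one_le X).trans (hB E hE hg ψ hψ X hX)
  rw [thetaMeasure_apply hE ⟨x, hx⟩ ψ Metric.isOpen_ball.measurableSet, add_mul,
    ENNReal.ofReal_add (by positivity) (by positivity)]
  refine le_trans ?_ (add_le_add h1 h2)
  refine le_trans (lintegral_mono_set ?_) (lintegral_union_le _ _ _)
  intro X hX
  rcases le_or_gt (ENNReal.ofReal (delta E X)) (ENNReal.ofReal (4 * c₀) * Metric.ediam E) with h | h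
  · exact Or.inl ⟨hX.1, hX.2, h⟩
  · exact Or.inr ⟨hX.1, hX.2, h⟩

/-! ### The region far from a bounded set. -/

theorem _root_.MeasureTheory.MemLp.lintegral_enorm_sq_ne_top {X F : Type*} [MeasurableSpace X]
    [NormedAddCommGroup F] {μ : Measure X} {f : X → F} (hf : MemLp f 2 μ) :
    ∫⁻ x, ‖f x‖ₑ ^ 2 ∂μ ≠ ⊤ := by
  have := (eLpNorm_lt_top_iff_lintegral_rpow_enorm_lt_top two_ne_zero ENNReal.ofNat_ne_top).1 hf.2
  simpa using this.ne

theorem sq_lintegral_le {X : Type*} [MeasurableSpace X] {μ : Measure X} {u : X → ℝ≥0∞}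
    (hu : AEMeasurable u μ) : (∫⁻ x, u x ∂μ) ^ 2 ≤ μ univ * ∫⁻ x, u x ^ 2 ∂μ := by
  have h := ENNReal.lintegral_mul_le_Lp_mul_Lq μ Real.HolderConjugate.two_two hu
    (aemeasurable_const (b := (1 : ℝ≥0∞)))
  simp only [Pi.mul_apply, mul_one, ENNReal.one_rpow, lintegral_const, one_mul] at h
  calc (∫⁻ x, u x ∂μ) ^ 2 ≤ ((∫⁻ x, u x ^ (2 : ℝ) ∂μ) ^ (1 / 2 : ℝ) * μ univ ^ (1 / 2 : ℝ)) ^ 2 := by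
        gcongr
    _ = _ := by
        rw [mul_pow, ← ENNReal.rpow_natCast, ← ENNReal.rpow_natCast, ← ENNReal.rpow_mul,
          ← ENNReal.rpow_mul, mul_comm]
        norm_num

/-- Far from a bounded set `E`, the square function is controlled by the size of the kernel. -/
theorem exists_far_bound (hn : 1 ≤ n) {G α K : ℝ} (hG : 0 ≤ G) (hα : 0 < α) (hK : 0 ≤ K) :
    ∃ C : ℝ≥0, ∀ E : Set (Space n), IsClosed E → Metric.ediam E ≠ 0 → HasGrowth n G (surface E) →
      ∀ ψ : Space n → Space n → ℂ, IsKernel α K E ψ → ∀ f : Space n → ℂ,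
        MemLp f 2 (surface E) →
          ∫⁻ X in {X | X ∈ Eᶜ ∧ Metric.ediam E ≤ ENNReal.ofReal (delta E X)},
            ‖theta E ψ f X‖ₑ ^ 2 / ENNReal.ofReal (delta E X) ≤
              C * ∫⁻ y, ‖f y‖ₑ ^ 2 ∂surface E := by
  obtain ⟨V, hV0, hV⟩ := exists_volume_growth n
  -- Cauchy-Schwarz and `σ(E) ≲ dⁿ` will give `dⁿ δ⁻²ⁿ⁻¹`, comparable with `ρ⁻ⁿ⁻¹ (d / ρ)ⁿ` for `ρ`
  -- the distance to a point of `E`. Hence the exponent `a = n`, positive since `n ≥ 1`.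
  obtain ⟨C, hC⟩ := exists_radial_bound n (d := (n : ℝ) + 1) (a := n) (by positivity) hV0
    (by exact_mod_cast hn)
  refine ⟨(K ^ 2 * (G * 2 ^ n) * 2 ^ (2 * n + 1)).toNNReal * C,
    fun E hE hd hg ψ hψ f hf => ?_⟩
  have hne : E.Nonempty := by
    rw [nonempty_iff_ne_empty]; rintro rfl; exact hd Metric.ediam_empty
  set S := {X | X ∈ Eᶜ ∧ Metric.ediam E ≤ ENNReal.ofReal (delta E X)} with hS
  by_cases hfin : Metric.ediam E = ⊤
  · have : S = ∅ := by
      rw [hS, hfin]; ext X; simp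
    simp [this]
  set d := (Metric.ediam E).toReal with hdd
  have hEd : Metric.ediam E = ENNReal.ofReal d := (ENNReal.ofReal_toReal hfin).symm
  have hd0 : 0 < d := ENNReal.toReal_pos hd hfin
  obtain ⟨z, hz⟩ := hne
  have hdist : ∀ y ∈ E, dist y z ≤ d := fun y hy => by
    rw [← ENNReal.ofReal_le_ofReal_iff hd0.le, ← edist_dist, ← hEd]
    exact Metric.edist_le_ediam_of_mem hy hz
  have hσ : surface E univ ≤ ENNReal.ofReal (G * 2 ^ n * d ^ n) := by
    calc surface E univ = surface E E := by rw [← surface_inter_self hE, univ_inter]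
      _ ≤ surface E (Metric.ball z (2 * d)) :=
          measure_mono fun y hy => by rw [Metric.mem_ball]; linarith [hdist y hy]
      _ ≤ _ := hg z _ (by positivity)
      _ = _ := by rw [Real.rpow_natCast, mul_pow, mul_assoc]
  set N := ∫⁻ y, ‖f y‖ₑ ^ 2 ∂surface E with hN
  set H : Space n → ℝ≥0∞ := fun X => ENNReal.ofReal
    (dist z X ^ (-((n : ℝ) + 1)) * min (dist z X / d) (d / dist z X) ^ (n : ℝ)) with hH
  set κ : ℝ := K ^ 2 * (G * 2 ^ n) * 2 ^ (2 * n + 1) with hκ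
  have hpt : ∀ X ∈ S, ‖theta E ψ f X‖ₑ ^ 2 / ENNReal.ofReal (delta E X) ≤
      ENNReal.ofReal κ * N * H X := by
    intro X hX
    have hδ := delta_pos hE ⟨z, hz⟩ hX.1
    have hdδ : d ≤ delta E X := by
      have := hX.2; rw [hEd] at this
      exact (ENNReal.ofReal_le_ofReal_iff hδ.le).1 this
    have h1 : ‖theta E ψ f X‖ₑ ≤
        ENNReal.ofReal (K * (delta E X ^ n)⁻¹) * ∫⁻ y, ‖f y‖ₑ ∂surface E := by
      rw [← lintegral_const_mul' _ _ ENNReal.ofReal_ne_top, theta]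
      refine (enorm_integral_le_lintegral_enorm _).trans (lintegral_mono_ae ?_)
      filter_upwards [hψ.ae_norm_le hE hα hK hX.1] with y hy
      rw [enorm_mul]
      gcongr
      rw [← ofReal_norm]
      exact ENNReal.ofReal_le_ofReal hy
    obtain ⟨y, hy, hXy⟩ := exists_dist_eq_delta hE ⟨z, hz⟩ X
    set ρ := dist z X with hρ
    have hρ1 : delta E X ≤ ρ := by rw [hρ, dist_comm]; exact delta_le_dist hz X
    have hρ2 : ρ ≤ 2 * delta E X := by
      rw [hρ, dist_comm]
      linarith [dist_triangle X y z, hdist y hy]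
    have hρ0 : 0 < ρ := hδ.trans_le hρ1
    have hmin : min (ρ / d) (d / ρ) = d / ρ :=
      min_eq_right (((div_le_one hρ0).2 (hdδ.trans hρ1)).trans
        ((one_le_div hd0).2 (hdδ.trans hρ1)))
    have hreal : (K * (delta E X ^ n)⁻¹) ^ 2 * (G * 2 ^ n * d ^ n) * (delta E X)⁻¹ ≤
        κ * (ρ ^ (-((n : ℝ) + 1)) * min (ρ / d) (d / ρ) ^ (n : ℝ)) := by
      have e1 : ρ ^ (-((n : ℝ) + 1)) = (ρ ^ (n + 1))⁻¹ := by
        rw [Real.rpow_neg hρ0.le, ← Real.rpow_natCast]; push_cast; rfl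
      have e2 : (delta E X ^ (2 * n + 1))⁻¹ ≤ 2 ^ (2 * n + 1) * (ρ ^ (2 * n + 1))⁻¹ := by
        rw [← div_eq_mul_inv, ← div_pow, ← inv_pow]
        refine pow_le_pow_left₀ (by positivity) ?_ _
        rw [inv_le_comm₀ hδ (by positivity), inv_div]
        linarith
      rw [hmin, e1, Real.rpow_natCast, div_pow]
      calc _ = K ^ 2 * (G * 2 ^ n) * d ^ n * (delta E X ^ (2 * n + 1))⁻¹ := by
            rw [pow_succ, two_mul, pow_add]; field_simp; ring
        _ ≤ K ^ 2 * (G * 2 ^ n) * d ^ n * (2 ^ (2 * n + 1) * (ρ ^ (2 * n + 1))⁻¹) := by gcongr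
        _ = _ := by
            rw [hκ, pow_succ ρ, pow_succ ρ, two_mul, pow_add ρ]; field_simp
    calc _ ≤ (ENNReal.ofReal (K * (delta E X ^ n)⁻¹) * ∫⁻ y, ‖f y‖ₑ ∂surface E) ^ 2 /
          ENNReal.ofReal (delta E X) := by gcongr
      _ = ENNReal.ofReal (K * (delta E X ^ n)⁻¹) ^ 2 * (∫⁻ y, ‖f y‖ₑ ∂surface E) ^ 2 *
          ENNReal.ofReal (delta E X)⁻¹ := by
          rw [mul_pow, div_eq_mul_inv, ENNReal.ofReal_inv_of_pos hδ]
      _ ≤ ENNReal.ofReal (K * (delta E X ^ n)⁻¹) ^ 2 * (ENNReal.ofReal (G * 2 ^ n * d ^ n) * N) *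
          ENNReal.ofReal (delta E X)⁻¹ := by
          gcongr
          exact (sq_lintegral_le hf.1.enorm).trans (by gcongr)
      _ = ENNReal.ofReal ((K * (delta E X ^ n)⁻¹) ^ 2 * (G * 2 ^ n * d ^ n) * (delta E X)⁻¹) * N := by
          rw [ENNReal.ofReal_mul (p := (K * (delta E X ^ n)⁻¹) ^ 2 * (G * 2 ^ n * d ^ n))
            (by positivity), ENNReal.ofReal_mul (p := (K * (delta E X ^ n)⁻¹) ^ 2) (by positivity),
            ← ENNReal.ofReal_pow (by positivity)]
          ring
      _ ≤ ENNReal.ofReal (κ * (ρ ^ (-((n : ℝ) + 1)) * min (ρ / d) (d / ρ) ^ (n : ℝ))) * N := by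
          gcongr
      _ = _ := by
          rw [ENNReal.ofReal_mul (by positivity)]
          ring
  have hNt : N ≠ ⊤ := hf.lintegral_enorm_sq_ne_top
  have hSm : MeasurableSet S := hE.measurableSet.compl.inter
    (measurableSet_le measurable_const (measurable_delta E).ennreal_ofReal)
  calc _ ≤ ∫⁻ X in S, ENNReal.ofReal κ * N * H X := setLIntegral_mono' hSm hpt
    _ = ENNReal.ofReal κ * N * ∫⁻ X in S, H X :=
        lintegral_const_mul' _ _ (ENNReal.mul_ne_top ENNReal.ofReal_ne_top hNt)
    _ ≤ ENNReal.ofReal κ * N * C := by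
        refine mul_le_mul_right ((lintegral_mono_set fun X hX => ?_).trans (hC _ hV z d hd0)) _
        have := (delta_pos hE ⟨z, hz⟩ hX.1).trans_le (delta_le_dist hz X)
        rw [dist_comm] at this
        exact this
    _ = _ := by push_cast; rw [ENNReal.ofReal]; ring

end SquareFunction

/-! ### The theorem, from the near and far bounds. -/

theorem theorem2 (n : ℕ) (hn : 1 ≤ n) (A : ℝ) (hA : 0 < A) :
    ∃ β₀ : ℝ, 0 < β₀ ∧ ∀ β : ℝ, β₀ ≤ β →
      ∀ c₀ a₀ η C₁ C₂ : ℝ, 0 < c₀ → 0 < a₀ → 0 < η → 0 < C₁ → 0 < C₂ →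
      ∀ α K : ℝ, 0 < α → 0 < K →
      ∀ M : ℝ≥0, ∃ C : ℝ≥0,
        ∀ (E : Set (Space n)) (D : ℤ → Set (Set (Space n))) (W : Set (CubeCode n))
          (ψ : Space n → Space n → ℂ),
          IsADR A E → IsDyadicGrid c₀ a₀ η C₁ C₂ E D → IsWhitney E W → IsKernel α K E ψ →
          (∀ k ∈ generations c₀ E, ∀ Q ∈ D k,
            (surface E Q)⁻¹ * ∫⁻ x in Q, (∫⁻ Y in truncatedCone c₀ E D W β Q x,
              ‖theta E ψ (fun _ => 1) Y‖ₑ ^ 2 / ENNReal.ofReal (delta E Y ^ (n + 1)))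
                ∂surface E ≤ M) →
          ∀ f : Space n → ℂ, MemLp f 2 (surface E) →
            (∀ X ∈ Eᶜ, Integrable (fun y => ψ X y * f y) (surface E)) ∧
            ∫⁻ Y in Eᶜ, ‖theta E ψ f Y‖ₑ ^ 2 / ENNReal.ofReal (delta E Y)
              ≤ C * ∫⁻ y, ‖f y‖ₑ ^ 2 ∂surface E := by
  refine ⟨41 * √(n + 1), by positivity, fun β hβ c₀ a₀ η C₁ C₂ hc₀ _ _ hC₁ _ α₀ K hα₀ hK M => ?_⟩
  -- The averaging kernel is only Lipschitz, so the remainder keeps a Hölder exponent at most 1.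
  set α := min α₀ 1 with hα'
  have hα : 0 < α := lt_min hα₀ one_pos
  have hα1 : α ≤ 1 := min_le_right _ _
  obtain ⟨G, hG, hgrowth⟩ := exists_surface_growth hn hA
  obtain ⟨B, hB⟩ := exists_lintegral_kernel_bound n hG hα hK.le
  obtain ⟨c, hc0, hc⟩ := exists_isCarleson_thetaMeasure n (a₀ := a₀) (η := η) (C₂ := C₂) hG hβ hc₀
    hC₁ hα hK.le M
  obtain ⟨C₃, hC₃⟩ := exists_carleson_embedding hn hG hc0
  obtain ⟨C₄, hC₄⟩ := exists_cancellative_bound n hA hG hα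
    (K := K + B * (3 * A * 3 ^ ((n : ℝ) + α) + A * 6 ^ (n + 1))) (by positivity)
  obtain ⟨C₅, hC₅⟩ := exists_far_bound hn hG hα hK.le
  refine ⟨2 * (C₄ + (3 * A).toNNReal ^ 2 * C₃) + C₅, fun E D W ψ hADR hD hW hψ₀ hM f hf => ?_⟩
  have hE := hADR.isClosed
  have hg := hgrowth E hADR
  have := hg.isLocallyFiniteMeasure
  have hψ : IsKernel α K E ψ := hψ₀.mono hE hK.le hα (min_le_left _ _)
  refine ⟨fun X hX => (hψ.memLp hE hα hK.le hG hg hX).integrable_mul hf, ?_⟩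
  -- For `E` empty or a single point `σ` vanishes, and so does `Θf`.
  rcases eq_or_ne (Metric.ediam E) 0 with hd | hd
  · have h0 : surface E = 0 := surface_eq_zero_of_ediam_eq_zero hn hd
    simp [theta, h0]
  have hne : E.Nonempty := by
    rw [nonempty_iff_ne_empty]; rintro rfl; exact hd Metric.ediam_empty
  set N := ∫⁻ y, ‖f y‖ₑ ^ 2 ∂surface E with hN
  have hNtop : N ≠ ⊤ := hf.lintegral_enorm_sq_ne_top
  -- The embedding theorem asks for a Borel function, so `|f|` is replaced by a measurable
  -- representative; the averages do not change.
  set u : Space n → ℝ≥0∞ := fun y => ‖hf.1.mk f y‖ₑ with hu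
  have hum : Measurable u := hf.1.stronglyMeasurable_mk.enorm
  have huf : (fun y => ‖f y‖ₑ) =ᵐ[surface E] u := by
    filter_upwards [hf.1.ae_eq_mk] with y hy
    simp only [hu]; rw [← hy]
  have huN : ∫⁻ y, u y ^ 2 ∂surface E = N :=
    lintegral_congr_ae (by filter_upwards [huf] with y hy; rw [← hy])
  have havg : ∀ X, coneAvg E (fun y => ‖f y‖ₑ) X = coneAvg E u X := fun X => by
    rw [coneAvg, coneAvg, lintegral_congr_ae (ae_restrict_of_ae huf)]
  have hΘ : ∀ X ∈ Eᶜ, ‖theta E ψ (fun _ => 1) X‖ ≤ B := fun X hX => by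
    have := (enorm_theta_one_le (E := E) (ψ := ψ) X).trans (hB E hE hg ψ hψ X hX)
    rw [enorm_le_coe] at this
    exact_mod_cast this
  have hr := hψ.cancelKernel hADR hA hα hα1 hK.le B.coe_nonneg hΘ
  have hΘm : AEMeasurable (fun X => ‖theta E ψ (fun _ => 1) X‖ₑ ^ 2) (nearMeasure E) :=
    (hψ.aestronglyMeasurable_theta_nearMeasure aestronglyMeasurable_const).enorm.pow_const 2
  have hRm : AEMeasurable (fun X => ‖theta E (cancelKernel E ψ) f X‖ₑ ^ 2) (nearMeasure E) :=
    (hr.aestronglyMeasurable_theta_nearMeasure hf.1).enorm.pow_const 2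
  have hR : ∫⁻ X, ‖theta E (cancelKernel E ψ) f X‖ₑ ^ 2 ∂nearMeasure E ≤ C₄ * N :=
    hC₄ E hADR hne hg _ hr (fun X hX => integral_cancelKernel hADR hA hne
      (hψ.integrable hE hα hK.le hG hg hX)) f hf
  have hCar : ∫⁻ X, ‖theta E ψ (fun _ => 1) X‖ₑ ^ 2 * coneAvg E u X ^ 2 ∂nearMeasure E ≤ C₃ * N := by
    have h1 := hC₃ E hE hne hg (thetaMeasure E ψ) (hc E D W ψ hE hd hg hD hW hψ hM)
      ((withDensity_absolutelyContinuous _ _).ae_le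
        ((ae_mem_nearRegion hE).mono fun X hX => hX.1)) u hum (by rwa [huN])
    rw [huN, thetaMeasure, lintegral_withDensity_eq_lintegral_mul₀ hΘm
      ((measurable_coneAvg hum).pow_const 2).aemeasurable] at h1
    exact h1
  have hnear : ∫⁻ X in nearRegion E, ‖theta E ψ f X‖ₑ ^ 2 / ENNReal.ofReal (delta E X) ≤
      2 * (C₄ + ENNReal.ofReal (3 * A) ^ 2 * C₃) * N := by
    rw [← lintegral_nearMeasure hE hne]
    calc _ ≤ ∫⁻ X, 2 * (‖theta E (cancelKernel E ψ) f X‖ₑ ^ 2 + ENNReal.ofReal (3 * A) ^ 2 *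
          (‖theta E ψ (fun _ => 1) X‖ₑ ^ 2 * coneAvg E u X ^ 2)) ∂nearMeasure E := by
          refine lintegral_mono_ae ?_
          filter_upwards [ae_mem_nearRegion hE] with X hX
          have h1 := enorm_theta_le hADR hA hne hX hf (hψ.memLp hE hα hK.le hG hg hX.1)
          rw [havg] at h1
          rw [← mul_pow, ← mul_pow]
          exact (pow_le_pow_left₀ bot_le h1 2).trans (add_sq_le_two_mul _ _)
      _ = 2 * (∫⁻ X, ‖theta E (cancelKernel E ψ) f X‖ₑ ^ 2 ∂nearMeasure E +
          ENNReal.ofReal (3 * A) ^ 2 *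
            ∫⁻ X, ‖theta E ψ (fun _ => 1) X‖ₑ ^ 2 * coneAvg E u X ^ 2 ∂nearMeasure E) := by
          rw [lintegral_const_mul' _ _ (by simp), lintegral_add_left' hRm,
            lintegral_const_mul' _ _ (ENNReal.pow_ne_top ENNReal.ofReal_ne_top)]
      _ ≤ 2 * (C₄ * N + ENNReal.ofReal (3 * A) ^ 2 * (C₃ * N)) := by gcongr
      _ = _ := by ring
  calc _ ≤ ∫⁻ X in nearRegion E ∪ {X | X ∈ Eᶜ ∧ Metric.ediam E ≤ ENNReal.ofReal (delta E X)},
        ‖theta E ψ f X‖ₑ ^ 2 / ENNReal.ofReal (delta E X) :=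
        lintegral_mono_set fun X hX => (lt_or_ge _ _).imp (fun h => ⟨hX, h⟩) fun h => ⟨hX, h⟩
    _ ≤ _ := lintegral_union_le _ _ _
    _ ≤ 2 * (C₄ + ENNReal.ofReal (3 * A) ^ 2 * C₃) * N + C₅ * N :=
        add_le_add hnear (hC₅ E hE hd hg ψ hψ f hf)
    _ = _ := by push_cast; rw [ENNReal.ofReal]; ring
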